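/- \textbf{Setting.} A discrete graph $G$ is a finite set $F(G)$ of flags with an idempotent root map $r_G$ and an involution $\iota_G$ with $\iota_G\circ r_G=r_G$. Its vertices are the elements of $V(G)=\operatorname{im} r_G$; on the remaining flags, the orbits of $\iota_G$ of size $1$ are the legs and those of size $2$ are the edges ($E(G)$). The valency of a vertex $V$ is $\operatorname{val}(V)=\#r_G^{-1}(V)-1$. A discrete admissible cover $\pi\colon G\to H$ is a surjective map of flags commuting with root maps and involutions, with $\pi^{-1}(V(H))\subseteq V(G)$, together with $d_\pi\colon F(G)\to\mathbb{Z}_{>0}$, $d_\pi\circ\iota_G=d_\pi$, such that for every $V\in V(G)$: (i) $d_\pi(V)=\sum_{x\in\pi^{-1}(y)\cap r_G^{-1}(V)}d_\pi(x)$ for every $y\in r_H^{-1}(\pi(V))\setminus\{\pi(V)\}$; (ii) $\operatorname{val}(V)-2=d_\pi(V)\,(\operatorname{val}(\pi(V))-2)$. Let $g\ge 2$, $m=3g$, $\mu_1=(g)$, $\mu_i=(2,1^{g-2})$ for $2\le i\le 3g$, and $n=1+(3g-1)(g-1)$. The objects of $\mathbb{AC}_{g,0}(\vec\mu)$ are the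 discrete admissible covers $\pi\colon G\to H$ of degree $g$ (that is, $\sum_{V\in\pi^{-1}(A)}d_\pi(V)=g$ for every $A\in V(H)$), where $H$ is a tree with $3g$ labelled legs, $G$ is a connected graph of first Betti number $g$ with $n$ labelled legs, all vertices of $G$ and $H$ are at least $3$-valent, and for each $k$ the legs of $G$ over the $k$-th leg of $H$ are those with labels $(k,j)$, $1\le j\le \ell(\mu_k)$ (standing for the label $\sum_{i<k}\ell(\mu_i)+j$), with weights $d_\pi$ equal to $\mu_k^j$. The cover $\pi$ is \emph{of top dimension} if $\#E(H)=3g-3$. For $h\in E(H)$ put $\operatorname{lcm}_h=\operatorname{lcm}(d_\pi(e))_{e\in\pi^{-1}(h)}$, and let $F_\pi\colon\mathbb{R}^{E(H)}\to\mathbb{R}^{E(G)}$, $(F_\pi(v))_e=\frac{\operatorname{lcm}_{\pi(e)}}{d_\pi(e)}v_{\pi(e)}$. Let $\operatorname{ft}(G)$ be obtained from $G$ by deleting all legs, repeatedly deleting univalent vertices with their edge, and then suppressing bivalent vertices; the edges of $G$ deleted on the way are called expunged. Let $\operatorname{ft}\colon\mathbb{R}^{E(G)}\to\mathbb{R}^{E(\operatorname{ft}(G))}$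 be the linear map that adds the lengths of the edges of $G$ merged into one edge of $\operatorname{ft}(G)$. Let $|\det(\operatorname{ft}\circ F_\pi)|$ be the absolute value of the determinant of the matrix of $\operatorname{ft}\circ F_\pi$, read as $0$ if $\#E(H)\ne\#E(\operatorname{ft}(G))$. The standard weight of $\pi$ is $$\varpi(\pi)=\frac{\prod_{e\in E(G)}d_\pi(e)\cdot\prod_{V\in V(G)}H(V)\,\mathrm{CF}(V)}{\prod_{h\in E(H)}\operatorname{lcm}_h}.$$ Here $H(V)$ is the local connected Hurwitz number: if $\lambda_1,\dots,\lambda_k$ are the partitions of $D=d_\pi(V)$ given by the weights of the flags at $V$ over the $k$ flags at $\pi(V)$, then $H(V)$ is $\frac1{D!}$ times the number of tuples $(\sigma_1,\dots,\sigma_k)\in S_D^k$ with $\sigma_i$ of cycle type $\lambda_i$, $\sigma_1\cdots\sigma_k=1$, generating a transitive subgroup. $\mathrm{CF}(V)$ is the product of the factors $k!$ over all maximal sets of $k$ edges or legs at $V$ with the same weight and the same image. The group $S_{3g-1}$ acts on covers by permuting the labels $k\in\{2,\dots,3g\}$ of the legs of $H$ and, simultaneously, the labels $(k,j)$ of the legs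 of $G$ in their first entry. The group $(S_{g-2})^{3g-1}$ acts by permuting, for each $k\ge2$ separately, the labels of the $g-2$ legs of $G$ of weight $1$ with labels $(k,j)$, $2\le j\le g-1$. Let $\operatorname{HS}(\pi)$ and $\operatorname{VS}(\pi)$ be the orders of the stabilizers of $\pi$ in $S_{3g-1}$ and $(S_{g-2})^{3g-1}$, respectively, where a relabelled cover is identified with $\pi$ if there is an isomorphism of labelled covers between them that induces the identity on $\operatorname{ft}(G)$ (equivalently, fixes every half-edge that is not expunged). \textbf{Lemma.} For every object $\pi$ of top dimension of $\mathbb{AC}_{g,0}(\vec\mu)$, the multiplicity $$\operatorname{mult}(\pi)=\frac{\varpi(\pi)\cdot|\det(\operatorname{ft}\circ F_\pi)|}{\operatorname{HS}(\pi)\cdot\operatorname{VS}(\pi)}$$ is a non-negative integer. -/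

import Mathlib

namespace TropicalCovers

/-! ### Discrete graphs -/

/-- A discrete graph with (finite) set of flags `F`: an idempotent root map and an involution
fixing the vertices, i.e. the elements in the image of the root map. -/
structure DiscreteGraph (F : Type*) where
  root : F → F
  inv : F → F
  root_root : ∀ x, root (root x) = root x
  inv_inv : ∀ x, inv (inv x) = x
  inv_root : ∀ x, inv (root x) = root x

namespace DiscreteGraph

variable {F : Type*} [Fintype F] [DecidableEq F] (G : DiscreteGraph F)

/-- The vertices: the image of the root map. -/
def vertices : Finset F := Finset.univ.image G.root

/-- The legs: flags that are not vertices and form an orbit of size one. -/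
def legs : Finset F := Finset.univ.filter fun x => x ∉ G.vertices ∧ G.inv x = x

/-- The edges: orbits `{x, inv x}` of size two. -/
def edges : Finset (Finset F) :=
  (Finset.univ.filter fun x => G.inv x ≠ x).image fun x => {x, G.inv x}

/-- The half-edges and legs attached to `v`. -/
def star (v : F) : Finset F := Finset.univ.filter fun x => G.root x = v ∧ x ≠ v

/-- The valency of a vertex, `#root⁻¹(v) - 1`. -/
def val (v : F) : ℕ := (G.star v).card

/-- Connectedness: any two flags are joined through the root map and the involution. -/
def IsConnected : Prop :=
  Nonempty F ∧ ∀ x y : F, Relation.EqvGen (fun a b => b = G.root a ∨ b = G.inv a) x y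

/-- The data of a graph together with a marking `mark` of its legs by `L` is a connected marked
graph of genus (first Betti number) `g` all of whose vertices are at least trivalent. -/
structure IsStableMarked {L : Type*} (g : ℕ) (mark : L → F) : Prop where
  connected : G.IsConnected
  genus : (G.edges.card : ℤ) - G.vertices.card + 1 = g
  valency : ∀ v ∈ G.vertices, 3 ≤ G.val v
  mark_injective : Function.Injective mark
  mark_range : ∀ x, x ∈ G.legs ↔ ∃ l, mark l = x

/-! #### Forgetting the legs

Forgetting all legs deletes the legs, then repeatedly deletes univalent vertices together with
their edge, and finally suppresses the bivalent vertices, adding up the lengths of the edges that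
are merged. -/

/-- A set of half-edges (no legs) closed under the involution in which no half-edge is alone at
its vertex. -/
def IsLeaflessSubset (S : Finset F) : Prop :=
  ∀ x ∈ S, G.inv x ≠ x ∧ G.inv x ∈ S ∧ ∃ y ∈ S, y ≠ x ∧ G.root y = G.root x

open scoped Classical in
/-- The half-edges that survive when all legs are deleted and univalent vertices are pruned
repeatedly: the largest leafless subset. All other edges are expunged. -/
noncomputable def core : Finset F :=
  Finset.univ.filter fun x => ∃ S : Finset F, G.IsLeaflessSubset S ∧ x ∈ S

/-- The valency of a vertex after deleting the legs and pruning. -/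
noncomputable def coreVal (v : F) : ℕ := (G.core.filter fun x => G.root x = v).card

/-- Two surviving half-edges belong to the same edge of the stabilization if they are the two
halves of one edge, or if they meet at a vertex that has become bivalent. -/
def Merges (x y : F) : Prop :=
  x ∈ G.core ∧ y ∈ G.core ∧ (y = G.inv x ∨ (G.root y = G.root x ∧ G.coreVal (G.root x) = 2))

open scoped Classical in
/-- The edges of the graph `ft(G)` obtained by forgetting all legs, each given as the set of all
half-edges of `G` that are merged into it. -/
noncomputable def ftEdges : Finset (Finset F) :=
  G.core.image fun x => G.core.filter fun y => Relation.EqvGen G.Merges x y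

/-- The matrix of the forgetful map `ℝ^{E(G)} → ℝ^{E(ft(G))}` on edge lengths: the length of an
edge of `ft(G)` is the sum of the lengths of the edges merged into it. -/
noncomputable def ftMatrix : Matrix G.ftEdges G.edges ℚ :=
  Matrix.of fun c e => if e.1 ⊆ c.1 then 1 else 0

end DiscreteGraph

/-! ### Discrete admissible covers -/

/-- A discrete admissible cover `G → H`: a surjective non-contracting map of graphs with a
positive integral degree on flags which is balanced at the vertices and has vanishing
Riemann–Hurwitz number at every vertex. -/
structure AdmissibleCover {F K : Type*} [Fintype F] [DecidableEq F] [Fintype K] [DecidableEq K]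
    (G : DiscreteGraph F) (H : DiscreteGraph K) where
  toFun : F → K
  map_root : ∀ x, toFun (G.root x) = H.root (toFun x)
  map_inv : ∀ x, toFun (G.inv x) = H.inv (toFun x)
  surjective : Function.Surjective toFun
  nonContracting : ∀ x, toFun x ∈ H.vertices → x ∈ G.vertices
  deg : F → ℕ
  deg_pos : ∀ x, 0 < deg x
  deg_inv : ∀ x, deg (G.inv x) = deg x
  balanced : ∀ V ∈ G.vertices, ∀ y ∈ H.star (toFun V),
    deg V = ∑ x ∈ (G.star V).filter (fun x => toFun x = y), deg x
  riemannHurwitz : ∀ V ∈ G.vertices,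
    (G.val V : ℤ) - 2 = deg V * ((H.val (toFun V) : ℤ) - 2)

/-- The number of tuples `(σ₁, …, σ_k)` of permutations of `D` letters with cycle types
`λ₁, …, λ_k`, with product `1` and generating a transitive group, divided by `D!`. This is the
connected Hurwitz number over the sphere; it does not depend on the order of `λ₁, …, λ_k`. The
covering surface has genus `0` if and only if `∑ (D - ℓ(λ_i)) = 2D - 2`. -/
noncomputable def hurwitzNumber (D : ℕ) (P : List (Multiset ℕ)) : ℚ :=
  (Nat.card {σ : Fin P.length → Equiv.Perm (Fin D) //
    (∀ i, (σ i).partition.parts = P.get i) ∧ (List.ofFn σ).prod = 1 ∧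
      MulAction.IsPretransitive (Subgroup.closure (Set.range σ)) (Fin D)} : ℚ) / D.factorial

namespace AdmissibleCover

variable {F K : Type*} [Fintype F] [DecidableEq F] [Fintype K] [DecidableEq K]
  {G : DiscreteGraph F} {H : DiscreteGraph K} (π : AdmissibleCover G H)

/-- The weight of an edge: the common degree of its two half-edges. -/
def edgeDeg (e : Finset F) : ℕ := e.sup π.deg

/-- The edges of `G` over an edge `h` of `H`. -/
def edgeFiber (h : Finset K) : Finset (Finset F) :=
  G.edges.filter fun e => e.image π.toFun = h

/-- The least common multiple of the weights of the edges over `h`. -/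
def edgeLcm (h : Finset K) : ℕ := (π.edgeFiber h).lcm π.edgeDeg

/-- The matrix `F_π : ℝ^{E(H)} → ℝ^{E(G)}` of the cover. -/
def edgeMatrix : Matrix G.edges H.edges ℚ :=
  Matrix.of fun e h => if e.1.image π.toFun = h.1 then (π.edgeLcm h.1 : ℚ) / π.edgeDeg e.1 else 0

/-- The partition of `deg V` induced over a half-edge or leg `y` at `π V`. -/
def localPartition (V : F) (y : K) : Multiset ℕ :=
  ((G.star V).filter fun x => π.toFun x = y).val.map π.deg

/-- The local Hurwitz number `H(V)`. -/
noncomputable def localHurwitz (V : F) : ℚ :=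
  hurwitzNumber (π.deg V) ((H.star (π.toFun V)).toList.map (π.localPartition V))

/-- The combinatorial factor `CF(V)`: a factor `k!` for each maximal `k`-tuple of edges or legs at
`V` which have the same weight and the same image. -/
def combFactor (V : F) : ℕ :=
  ∏ y ∈ H.star (π.toFun V), ∏ w ∈ (π.localPartition V y).toFinset,
    ((π.localPartition V y).count w).factorial

/-- The standard weight of the cover. -/
noncomputable def standardWeight : ℚ :=
  ((∏ e ∈ G.edges, (π.edgeDeg e : ℚ)) *
      ∏ V ∈ G.vertices, π.localHurwitz V * (π.combFactor V : ℚ)) /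
    ∏ h ∈ H.edges, (π.edgeLcm h : ℚ)

/-- The matrix of the composition `ft ∘ F_π : ℝ^{E(H)} → ℝ^{E(ft(G))}`. -/
noncomputable def ftEdgeMatrix : Matrix G.ftEdges H.edges ℚ := G.ftMatrix * π.edgeMatrix

/-- `(φ, ψ)` is an automorphism of the (unmarked) admissible cover. -/
structure IsAut (φ : Equiv.Perm F) (ψ : Equiv.Perm K) : Prop where
  src_root : ∀ x, φ (G.root x) = G.root (φ x)
  src_inv : ∀ x, φ (G.inv x) = G.inv (φ x)
  trgt_root : ∀ y, ψ (H.root y) = H.root (ψ y)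
  trgt_inv : ∀ y, ψ (H.inv y) = H.inv (ψ y)
  comm : ∀ x, π.toFun (φ x) = ψ (π.toFun x)
  deg_eq : ∀ x, π.deg (φ x) = π.deg x

/-- `φ` induces the identity on `ft(G)`: it fixes every half-edge that is not expunged. -/
def InducesIdOnFt (G : DiscreteGraph F) (φ : Equiv.Perm F) : Prop := ∀ x ∈ G.core, φ x = x

end AdmissibleCover

open scoped Classical in
/-- The absolute value of the determinant of a matrix whose rows and columns are indexed by
different finite sets: that of the square matrix obtained from any bijection between the index
sets, and `0` by convention if the matrix is not square. -/
noncomputable def absDet {α β : Type*} [Fintype α] (M : Matrix α β ℚ) : ℚ :=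
  if h : Nonempty (α ≃ β) then |(M.submatrix id h.some).det| else 0

theorem absDet_eq {α β : Type*} [Fintype α] [DecidableEq α] (M : Matrix α β ℚ) (e : α ≃ β) :
    absDet M = |(M.submatrix id e).det| := by
  classical
  have h : Nonempty (α ≃ β) := ⟨e⟩
  have key : M.submatrix id h.some = (M.submatrix id e).submatrix id (h.some.trans e.symm) := by
    ext i j
    simp
  unfold absDet
  rw [dif_pos h]
  have h2 := Matrix.det_permute' (h.some.trans e.symm) (M.submatrix id e)
  rw [← key] at h2
  have h3 : |(M.submatrix id h.some).det| = |(M.submatrix id e).det| := by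
    rcases Int.units_eq_one_or (Equiv.Perm.sign (h.some.trans e.symm)) with hs | hs <;>
      simp [h2, hs]
  convert h3

/-- An object of the category `AC_{d,h}(μ)` whose source has genus `g`: a degree-`d` discrete
admissible cover of an `m`-marked genus-`h` graph with ramification `μ_k` over the `k`-th leg.
The legs of the source are labelled by the pairs `(k, j)`, where `k` runs over the legs of the
target and `j` over the positions in the list of parts of `μ_k` (the pair `(k, j)` stands for the
label `∑_{i<k} ℓ(μ_i) + j`). -/
structure ACObject (F K : Type*) [Fintype F] [DecidableEq F] [Fintype K] [DecidableEq K]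
    (d h g : ℕ) {m : ℕ} (μ : Fin m → List ℕ) where
  src : DiscreteGraph F
  trgt : DiscreteGraph K
  srcMark : (Σ k : Fin m, Fin (μ k).length) → F
  trgtMark : Fin m → K
  src_stable : src.IsStableMarked g srcMark
  trgt_stable : trgt.IsStableMarked h trgtMark
  cover : AdmissibleCover src trgt
  degree : ∀ A ∈ trgt.vertices,
    ∑ V ∈ src.vertices.filter (fun V => cover.toFun V = A), cover.deg V = d
  map_leg : ∀ k j, cover.toFun (srcMark ⟨k, j⟩) = trgtMark k
  deg_leg : ∀ k j, cover.deg (srcMark ⟨k, j⟩) = (μ k).get j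

/-- The ramification data `μ₁ = (g)`, `μ_i = (2, 1^{g-2})` for `2 ≤ i ≤ 3g` (with indices shifted
to start at `0`). -/
def weierstrassProfile (g : ℕ) : Fin (3 * g) → List ℕ := fun k =>
  if k.val = 0 then [g] else 2 :: List.replicate (g - 2) 1

/-- The indices of the legs of the target with simple ramification. -/
abbrev SimpleIndex (g : ℕ) : Type := {k : Fin (3 * g) // k.val ≠ 0}

namespace ACObject

variable {F K : Type*} [Fintype F] [DecidableEq F] [Fintype K] [DecidableEq K] {g : ℕ}
  (π : ACObject F K g 0 g (weierstrassProfile g))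

/-- The order of the stabilizer of `π` in `S_{3g-1}`. A permutation `β` acts by permuting the
markings of the target legs with simple ramification, and correspondingly the blocks of markings
of the source legs over them, keeping the position in the block. It stabilizes `π` if the cover
with the permuted markings is isomorphic to `π` by an isomorphism inducing the identity on the
graph `ft(src π)`. -/
noncomputable def horizontalStab : ℕ :=
  Nat.card {β : Equiv.Perm (SimpleIndex g) //
    ∃ (φ : Equiv.Perm F) (ψ : Equiv.Perm K), π.cover.IsAut φ ψ ∧
      AdmissibleCover.InducesIdOnFt π.src φ ∧
      (∀ k, ψ (π.trgtMark k) = π.trgtMark (Equiv.Perm.ofSubtype β k)) ∧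
      (∀ k j j', j.val = j'.val →
        φ (π.srcMark ⟨k, j⟩) = π.srcMark ⟨Equiv.Perm.ofSubtype β k, j'⟩)}

/-- The order of the stabilizer of `π` in `(S_{g-2})^{3g-1}`. A tuple `α` acts by permuting, for
each target leg `k` with simple ramification, the markings of the `g - 2` source legs of weight
`1` over it by `α k`; all other markings are kept. It stabilizes `π` if the cover with the
permuted markings is isomorphic to `π` by an isomorphism inducing the identity on the graph
`ft(src π)`. -/
noncomputable def verticalStab : ℕ :=
  Nat.card {α : SimpleIndex g → Equiv.Perm (Fin (g - 2)) //
    ∃ (φ : Equiv.Perm F) (ψ : Equiv.Perm K), π.cover.IsAut φ ψ ∧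
      AdmissibleCover.InducesIdOnFt π.src φ ∧
      (∀ k, ψ (π.trgtMark k) = π.trgtMark k) ∧
      (∀ k j, k.val = 0 ∨ j.val = 0 → φ (π.srcMark ⟨k, j⟩) = π.srcMark ⟨k, j⟩) ∧
      (∀ (k : SimpleIndex g) (a : Fin (g - 2)) (j j' : Fin (weierstrassProfile g k.1).length),
        j.val = a.val + 1 → j'.val = (α k a).val + 1 →
          φ (π.srcMark ⟨k.1, j⟩) = π.srcMark ⟨k.1, j'⟩)}

/-- `π` is of top dimension: its cone of metrics, which is parametrized by the lengths of the
edges of the target, has the maximal dimension `3g - 3`. -/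
def IsTopDimensional : Prop := π.trgt.edges.card = 3 * g - 3

/-- The multiplicity of `π`. -/
noncomputable def multiplicity : ℚ :=
  π.cover.standardWeight * absDet π.cover.ftEdgeMatrix /
    ((π.horizontalStab : ℚ) * (π.verticalStab : ℚ))

end ACObject

end TropicalCovers

set_option linter.unusedSectionVars false

namespace TropicalCovers

/-! ### Labelled cycles of permutations -/

section CycleLabels

open Equiv Equiv.Perm

/-! If the determinant vanishes, so does the multiplicity. Otherwise every half-edge of the target
lies below a half-edge of the core (the part of the source that survives in `ft(G)`), so an
automorphism inducing the identity on `ft(G)` fixes all edges and vertices of the target. The target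
is trivalent by counting. A horizontal symmetry can then only exchange two simple legs at a common
vertex (a cherry), so HS divides a power of two with one factor for each cherry. A vertical symmetry
comes from a deck transformation fixing the core, so VS divides the order of `deckGroup ∅`.

The deck group is estimated vertex by vertex. At a vertex `V` of degree `D`, a group `P` of
permutations of the flags that preserves images and weights acts, together with `S_D`, on the
Hurwitz tuples with labelled cycles, of which there are `D! H(V) CF(V)`. A stabilizer acts freely on
the sheets, so its order divides the weight of every flag fixed by `P`; by Riemann–Hurwitz it is
trivial if three flags are fixed. Hence `|P|` divides `w H(V) CF(V)` (`factorial_mul_card_dvd`),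
where `w` is `1` at a core vertex of core valency at least three, the gcd of the two core weights at
a bivalent core vertex, and the weight of an edge leading towards the core at any other vertex.
Together these bound VS by the local Hurwitz factors, the gcds and the weights of expunged edges
(`card_deckGroup_mul_prod_dvd`).

The gcds and HS must still be found in the determinant. Multiplying the row of an edge `c` of
`ft(G)` by the weights of all edges on `c` turns each entry into an lcm times a sum of products of
all weights but one. As `c` is a chain, its remaining edges can be matched with its bivalent
vertices, so the gcds divide each product (`prod_bivalent_dvd`). In the column of an edge at a
cherry, the core folds two edges of weight one together at a vertex of degree two; the summands pair
up and the column is even (`cherryFactor_dvd`). Extracting these factors leaves an integral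
determinant (`exists_absDet_mul`), and everything cancels. -/

theorem multiset_eq_filter_add_replicate {m : Multiset ℕ} (hm : ∀ x ∈ m, 0 < x) :
    m = m.filter (2 ≤ ·) + Multiset.replicate (m.sum - (m.filter (2 ≤ ·)).sum) 1 := by
  have h1 : m.filter (fun x => ¬ 2 ≤ x) = Multiset.replicate (m.filter (fun x => ¬ 2 ≤ x)).card 1 := by
    rw [Multiset.eq_replicate_card]
    intro x hx
    rw [Multiset.mem_filter] at hx
    have := hm x hx.1
    omega
  have h2 : m.filter (2 ≤ ·) + m.filter (fun x => ¬ 2 ≤ x) = m := Multiset.filter_add_not _ _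
  have h3 : (m.filter (2 ≤ ·)).sum + (m.filter (fun x => ¬ 2 ≤ x)).card = m.sum := by
    conv_rhs => rw [← h2, Multiset.sum_add, h1]
    simp
  conv_lhs => rw [← h2, h1]
  rw [← h3, Nat.add_sub_cancel_left]

theorem multiset_eq_of_filter_eq_of_sum_eq {m m' : Multiset ℕ} (hm : ∀ x ∈ m, 0 < x)
    (hm' : ∀ x ∈ m', 0 < x) (hf : m.filter (2 ≤ ·) = m'.filter (2 ≤ ·)) (hs : m.sum = m'.sum) :
    m = m' := by
  rw [multiset_eq_filter_add_replicate hm, multiset_eq_filter_add_replicate hm', hf, hs]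

variable {α Φ : Type*} [Fintype α] [DecidableEq α] [DecidableEq Φ]

/-- `l` labels the cycles of `σ` (fixed points included) by the elements of `s`. -/
structure IsCycleLabelling (σ : Perm α) (s : Finset Φ) (l : α → Φ) : Prop where
  eq_iff : ∀ a b, l a = l b ↔ σ.SameCycle a b
  mem_iff : ∀ x, x ∈ s ↔ ∃ a, l a = x

/-- The size of the fibre of a labelling. -/
def fibreCard (l : α → Φ) (x : Φ) : ℕ := (Finset.univ.filter fun a => l a = x).card

theorem IsCycleLabelling.card_support_cycleOf {σ : Perm α} {s : Finset Φ} {l : α → Φ}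
    (h : IsCycleLabelling σ s l) {a : α} (ha : σ a ≠ a) :
    (cycleOf σ a).support.card = fibreCard l (l a) := by
  unfold fibreCard
  congr 1
  ext b
  rw [mem_support_cycleOf_iff' ha, Finset.mem_filter, ← h.eq_iff]
  simp [eq_comm]

theorem IsCycleLabelling.two_le_fibreCard {σ : Perm α} {s : Finset Φ} {l : α → Φ}
    (h : IsCycleLabelling σ s l) {a : α} : 2 ≤ fibreCard l (l a) ↔ σ a ≠ a := by
  constructor
  · intro h2 ha
    have : Finset.univ.filter (fun b => l b = l a) ⊆ {a} := by
      intro b hb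
      rw [Finset.mem_filter, h.eq_iff] at hb
      have := (hb.2.symm.eq_of_left ha)
      simp [this]
    have := Finset.card_le_card this
    unfold fibreCard at h2
    simp at this
    omega
  · intro ha
    rw [← h.card_support_cycleOf ha]
    exact two_le_card_support_cycleOf_iff.2 ha

/-- Both multisets consist of positive numbers and have the number of letters as sum, so only the
parts that are at least `2` need comparing. Those on the right are the lengths of the nontrivial
cycles. -/
theorem IsCycleLabelling.map_fibreCard {σ : Perm α} {s : Finset Φ} {l : α → Φ}
    (h : IsCycleLabelling σ s l) : s.val.map (fibreCard l) = σ.partition.parts := by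
  apply multiset_eq_of_filter_eq_of_sum_eq
  · intro x hx
    obtain ⟨y, hy, rfl⟩ := Multiset.mem_map.1 hx
    obtain ⟨a, rfl⟩ := (h.mem_iff y).1 hy
    exact Finset.card_pos.2 ⟨a, by simp⟩
  · exact fun x hx => σ.partition.parts_pos hx
  · rw [filter_parts_partition_eq_cycleType, cycleType_def, Multiset.filter_map]
    -- A label with at least two letters corresponds to the cycle through any letter carrying it.
    have key : σ.cycleFactorsFinset.val =
        ((s.filter fun x => 2 ≤ fibreCard l x).val.attach.map fun x =>
          cycleOf σ ((h.mem_iff x.1).1 (Finset.mem_filter.1 x.2).1).choose) := by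
      apply (Multiset.Nodup.ext σ.cycleFactorsFinset.nodup ?_).2
      · intro f
        simp only [Finset.mem_val, Multiset.mem_map, Subtype.exists]
        constructor
        · intro hf
          have hc := (mem_cycleFactorsFinset_iff.1 hf).1
          obtain ⟨a, ha⟩ := hc.nonempty_support
          have hfa := cycle_is_cycleOf ha hf
          have hσa : σ a ≠ a := by
            rw [hfa, mem_support_cycleOf_iff] at ha
            exact mem_support.1 ha.2
          have hmem : l a ∈ s.filter fun x => 2 ≤ fibreCard l x :=
            Finset.mem_filter.2 ⟨(h.mem_iff _).2 ⟨a, rfl⟩, h.two_le_fibreCard.2 hσa⟩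
          refine ⟨l a, hmem, Multiset.mem_attach _ _, ?_⟩
          have hsp := ((h.mem_iff (l a)).1 (Finset.mem_filter.1 hmem).1).choose_spec
          rw [hfa]
          exact ((h.eq_iff _ _).1 hsp).cycleOf_eq
        · rintro ⟨x, hx, -, rfl⟩
          rw [cycleOf_mem_cycleFactorsFinset_iff, mem_support, ← h.two_le_fibreCard,
            ((h.mem_iff x).1 (Finset.mem_filter.1 hx).1).choose_spec]
          exact (Finset.mem_filter.1 hx).2
      · refine Multiset.Nodup.map_on ?_ (Multiset.nodup_attach.2 (Finset.nodup _))
        rintro ⟨x, hx⟩ - ⟨y, hy⟩ - hxy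
        have hx1 := ((h.mem_iff x).1 (Finset.mem_filter.1 hx).1).choose_spec
        have hy1 := ((h.mem_iff y).1 (Finset.mem_filter.1 hy).1).choose_spec
        have hx2 := (Finset.mem_filter.1 hx).2
        rw [← hx1, h.two_le_fibreCard] at hx2
        have hs : σ.SameCycle ((h.mem_iff x).1 (Finset.mem_filter.1 hx).1).choose
            ((h.mem_iff y).1 (Finset.mem_filter.1 hy).1).choose := by
          by_contra hne
          have h1 := cycleOf_apply_of_not_sameCycle
            (fun hh => hne (SameCycle.symm hh) : ¬ σ.SameCycle _ _)
          have h2 := cycleOf_apply_self σ ((h.mem_iff x).1 (Finset.mem_filter.1 hx).1).choose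
          simp only at hxy
          rw [hxy, h1] at h2
          exact hx2 h2.symm
        rw [← h.eq_iff, hx1, hy1] at hs
        exact Subtype.ext hs
    rw [key, Multiset.map_map]
    change ((s.filter fun x => 2 ≤ fibreCard l x).val).map (fibreCard l) = _
    conv_lhs => rw [← Multiset.attach_map_val (s.filter fun x => 2 ≤ fibreCard l x).val,
      Multiset.map_map]
    refine Multiset.map_congr rfl ?_
    rintro ⟨x, hx⟩ -
    have hx1 := ((h.mem_iff x).1 (Finset.mem_filter.1 hx).1).choose_spec
    have hx2 := (Finset.mem_filter.1 hx).2
    rw [← hx1, h.two_le_fibreCard] at hx2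
    simp only [Function.comp]
    rw [h.card_support_cycleOf hx2, hx1]
  · rw [σ.partition.parts_sum]
    change ∑ x ∈ s, fibreCard l x = _
    have := Finset.card_eq_sum_card_fiberwise (f := l) (s := Finset.univ) (t := s)
      (fun a _ => (h.mem_iff _).2 ⟨a, rfl⟩)
    rw [Finset.card_univ] at this
    exact this.symm

end CycleLabels

/-! ### Counting the labellings of the cycles of a permutation -/

section CycleLabels

open Equiv Equiv.Perm

theorem exists_equiv_of_map_univ_eq {A B ι : Type*} [Fintype A] [Fintype B] [DecidableEq ι]
    (f : A → ι) (g : B → ι) (h : Finset.univ.val.map f = Finset.univ.val.map g) :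
    ∃ e : A ≃ B, ∀ a, g (e a) = f a := by
  have hc : ∀ i, Nonempty ({a // f a = i} ≃ {b // g b = i}) := by
    intro i
    rw [← Fintype.card_eq, Fintype.card_subtype, Fintype.card_subtype]
    have := congrArg (Multiset.count i) h
    rw [Multiset.count_map, Multiset.count_map] at this
    simp only [Finset.card, Finset.filter_val, eq_comm (b := i)]
    simpa [eq_comm] using this
  let e := fun i => (hc i).some
  refine ⟨(Equiv.sigmaFiberEquiv f).symm.trans
    ((Equiv.sigmaCongrRight e).trans (Equiv.sigmaFiberEquiv g)), fun a => ?_⟩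
  simp only [Equiv.trans_apply]
  exact ((e (f a)) ⟨a, rfl⟩).2

variable {α Φ : Type*} [Fintype α] [DecidableEq α] [DecidableEq Φ]

/-- The cycles label themselves by the quotient for `SameCycle`; equality of the multisets of sizes
gives a size-preserving bijection from this quotient to `s`. -/
theorem exists_isCycleLabelling (σ : Perm α) (s : Finset Φ) (d : Φ → ℕ)
    (h : s.val.map d = σ.partition.parts) :
    ∃ l, IsCycleLabelling σ s l ∧ ∀ x ∈ s, fibreCard l x = d x := by
  classical
  let _ : Fintype (Quotient (SameCycle.setoid σ)) := Fintype.ofFinite _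
  set q : α → Quotient (SameCycle.setoid σ) := Quotient.mk _
  have hq : IsCycleLabelling σ Finset.univ q :=
    ⟨fun a b => Quotient.eq, fun x => ⟨fun _ => Quotient.exists_rep x, fun _ => Finset.mem_univ _⟩⟩
  have h2 : Finset.univ.val.map (fibreCard q) =
      (Finset.univ : Finset s).val.map (fun x : s => d x) := by
    rw [hq.map_fibreCard, ← h]
    change _ = (s.attach.val).map _
    conv_lhs => rw [← Finset.attach_map_val (s := s), Finset.map_val, Multiset.map_map]
    rfl
  obtain ⟨e, he⟩ := exists_equiv_of_map_univ_eq _ _ h2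
  refine ⟨fun a => (e (q a)).1, ⟨fun a b => ?_, fun x => ⟨fun hx => ?_, ?_⟩⟩, fun x hx => ?_⟩
  · rw [Subtype.coe_inj, e.apply_eq_iff_eq, hq.eq_iff]
  · obtain ⟨a, ha⟩ := Quotient.exists_rep (e.symm ⟨x, hx⟩)
    exact ⟨a, by simp [q, ha]⟩
  · rintro ⟨a, rfl⟩
    exact (e (q a)).2
  · have h3 := he (e.symm ⟨x, hx⟩)
    rw [e.apply_symm_apply] at h3
    rw [h3]
    unfold fibreCard
    congr 1
    ext a
    simp only [Finset.mem_filter, Finset.mem_univ, true_and]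
    rw [Equiv.eq_symm_apply, Subtype.ext_iff]

/-- Labellings form a torsor under the permutations of `s` that preserve `d`: two of them differ by
exactly one such permutation. For the flags over one branch point this count is their share of
`CF(V)`. -/
theorem card_isCycleLabelling (σ : Perm α) (s : Finset Φ) (d : Φ → ℕ)
    (h : s.val.map d = σ.partition.parts) :
    Nat.card {l : α → Φ // IsCycleLabelling σ s l ∧ ∀ x ∈ s, fibreCard l x = d x} =
      ∏ w ∈ (s.val.map d).toFinset, ((s.val.map d).count w).factorial := by
  obtain ⟨l, hl, hld⟩ := exists_isCycleLabelling σ s d h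
  have hls : ∀ a, l a ∈ s := fun a => (hl.mem_iff _).2 ⟨a, rfl⟩
  set f : s → ℕ := fun x => d x with hf
  have h1 : Nat.card {g : Perm s // f ∘ g = f} =
      ∏ w ∈ (s.val.map d).toFinset, ((s.val.map d).count w).factorial := by
    rw [Nat.card_eq_fintype_card, DomMulAct.stabilizer_card']
    refine Finset.prod_congr ?_ ?_
    · ext w
      simp [hf]
    · intro w _
      congr 1
      rw [Fintype.card_subtype, Multiset.count_map]
      change _ = (s.filter fun x => w = d x).card
      rw [← Finset.card_map (Function.Embedding.subtype _)]
      congr 1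
      ext x
      simp [hf, eq_comm, and_comm]
  rw [← h1]
  symm
  have hfib : ∀ (g : Perm s) (x : s), fibreCard (fun a => (g ⟨l a, hls a⟩ : Φ)) (g x) =
      fibreCard l x := by
    intro g x
    unfold fibreCard
    congr 1
    ext a
    simp only [Finset.mem_filter, Finset.mem_univ, true_and, Subtype.coe_inj,
      g.apply_eq_iff_eq]
    rw [Subtype.ext_iff]
  refine Nat.card_eq_of_bijective (fun g => ⟨fun a => (g.1 ⟨l a, hls a⟩).1,
    ⟨fun a b => ?_, fun x => ⟨fun hx => ?_, ?_⟩⟩, fun x hx => ?_⟩) ⟨?_, ?_⟩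
  · rw [Subtype.coe_inj, g.1.apply_eq_iff_eq, Subtype.mk.injEq, hl.eq_iff]
  · obtain ⟨a, ha⟩ := (hl.mem_iff _).1 (g.1.symm ⟨x, hx⟩).2
    exact ⟨a, by simp [ha]⟩
  · rintro ⟨a, rfl⟩
    exact (g.1 _).2
  · have h3 := hfib g.1 (g.1.symm ⟨x, hx⟩)
    rw [g.1.apply_symm_apply] at h3
    rw [h3, hld _ (g.1.symm ⟨x, hx⟩).2]
    have := congrFun g.2 (g.1.symm ⟨x, hx⟩)
    simp only [Function.comp, g.1.apply_symm_apply, hf] at this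
    exact this.symm
  · rintro ⟨g, hg⟩ ⟨g', hg'⟩ hgg
    rw [Subtype.mk.injEq] at hgg ⊢
    ext ⟨x, hx⟩
    obtain ⟨a, rfl⟩ := (hl.mem_iff _).1 hx
    exact congrFun hgg a
  · rintro ⟨l', hl', hld'⟩
    have hls' : ∀ a, l' a ∈ s := fun a => (hl'.mem_iff _).2 ⟨a, rfl⟩
    have hch : ∀ x : s, ∃ a, l a = x := fun x => (hl.mem_iff _).1 x.2
    choose c hc using hch
    have hinj : Function.Injective fun x : s => (⟨l' (c x), hls' _⟩ : s) := by
      intro x y hxy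
      simp only [Subtype.mk.injEq, hl'.eq_iff, ← hl.eq_iff, hc] at hxy
      exact Subtype.ext hxy
    set g : Perm s := Equiv.ofBijective _ (Finite.injective_iff_bijective.1 hinj) with hg
    have hgl : ∀ a, (g ⟨l a, hls a⟩ : Φ) = l' a := by
      intro a
      rw [hg, Equiv.ofBijective_apply]
      simp only
      rw [hl'.eq_iff, ← hl.eq_iff, hc]
    refine ⟨⟨g, ?_⟩, ?_⟩
    · funext x
      simp only [Function.comp, hf]
      rw [← hld' _ (g x).2, ← hld _ x.2, ← hfib g x]
      congr 1
      funext a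
      exact (hgl a).symm
    · rw [Subtype.mk.injEq]
      exact funext hgl

end CycleLabels

/-! ### Divisibility from orbit counting -/

section OrbitCounting

open MulAction

/-- An orbit has `|G| / |Stab|` elements, and `w` times this is a multiple of `|G|` as soon as
`|Stab|` divides `w`. Sum over the orbits. -/
theorem card_dvd_mul_card_of_card_stabilizer_dvd {G X : Type*} [Group G] [Finite G]
    [MulAction G X] [Finite X] (w : ℕ) (h : ∀ x : X, Nat.card (stabilizer G x) ∣ w) :
    Nat.card G ∣ w * Nat.card X := by
  classical
  let _ : Fintype (orbitRel.Quotient G X) := Fintype.ofFinite _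
  rw [Nat.card_congr (selfEquivSigmaOrbitsQuotientStabilizer G X), Nat.card_sigma,
    Finset.mul_sum]
  refine Finset.dvd_sum fun ω _ => ?_
  rw [Subgroup.card_eq_card_quotient_mul_card_subgroup (stabilizer G ω.out), mul_comm]
  exact mul_dvd_mul (h _) dvd_rfl

theorem card_dvd_card_of_free {G X : Type*} [Group G] [Finite G] [MulAction G X] [Finite X]
    (h : ∀ (g : G) (x : X), g • x = x → g = 1) : Nat.card G ∣ Nat.card X := by
  have := card_dvd_mul_card_of_card_stabilizer_dvd (G := G) (X := X) 1 (fun x => ?_)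
  · simpa using this
  · rw [Nat.dvd_one, Nat.card_eq_one_iff_unique]
    refine ⟨⟨fun a b => ?_⟩, ⟨1⟩⟩
    exact Subtype.ext ((h a.1 x a.2).trans (h b.1 x b.2).symm)

end OrbitCounting

/-! ### A linear algebra form of Riemann–Hurwitz -/

section RiemannHurwitz

open MulAction Module

variable {α : Type*} [Fintype α] (Q : Type*) [Group Q] [MulAction Q α]

/-- The functions that are invariant under the action of `Q`. -/
def invariantFunctions : Submodule ℚ (α → ℚ) where
  carrier := {f | ∀ (q : Q) a, f (q • a) = f a}
  add_mem' hf hg q a := by simp [hf q a, hg q a]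
  zero_mem' _ _ := rfl
  smul_mem' c f hf q a := by simp [hf q a]

/-- The functions that are invariant under `σ`. -/
def permInvariant (σ : Equiv.Perm α) : Submodule ℚ (α → ℚ) where
  carrier := {f | ∀ a, f (σ a) = f a}
  add_mem' hf hg a := by simp [hf a, hg a]
  zero_mem' _ := rfl
  smul_mem' c f hf a := by simp [hf a]

/-- The Riemann–Hurwitz inequality for the quotient by `Q` of a transitive triple of permutations
with product `1`. -/
theorem finrank_permInvariant_le (σ₁ σ₂ σ₃ : Equiv.Perm α) (hσ : σ₁ * σ₂ * σ₃ = 1)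
    (hc : ∀ u : α → ℚ, (∀ a, u (σ₁ a) = u a) → (∀ a, u (σ₂ a) = u a) → (∀ a, u (σ₃ a) = u a) →
      ∀ a b, u a = u b) (hQ : ∀ (q : Q) a, σ₁ (q • a) = q • σ₁ a) :
    finrank ℚ ↥(permInvariant σ₁ ⊓ invariantFunctions Q) +
      finrank ℚ ↥(permInvariant σ₂ ⊓ invariantFunctions Q) +
      finrank ℚ ↥(permInvariant σ₃ ⊓ invariantFunctions Q) ≤
      finrank ℚ (invariantFunctions Q : Submodule ℚ (α → ℚ)) + 2 := by
  set V : Submodule ℚ (α → ℚ) := invariantFunctions Q with hV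
  set V₁ := permInvariant σ₁ ⊓ V with hV₁
  set V₂ := permInvariant σ₂ ⊓ V with hV₂
  set V₃ := permInvariant σ₃ ⊓ V with hV₃
  have h123 : ∀ a, σ₁ (σ₂ (σ₃ a)) = a := fun a => by
    have := Equiv.congr_fun hσ a
    simpa using this
  have hone : ∀ U : Submodule ℚ (α → ℚ), (∀ u ∈ U, ∀ a b, u a = u b) → finrank ℚ U ≤ 1 := by
    intro U hU
    rcases isEmpty_or_nonempty α with he | ⟨⟨a₀⟩⟩
    · have : Subsingleton U := ⟨fun x y => Subtype.ext (funext fun a => (he.false a).elim)⟩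
      rw [finrank_zero_of_subsingleton]
      exact zero_le_one
    · have hUle : U ≤ Submodule.span ℚ {fun _ => (1 : ℚ)} := by
        intro u hu
        rw [Submodule.mem_span_singleton]
        exact ⟨u a₀, funext fun a => by simp [hU u hu a₀ a]⟩
      exact (Submodule.finrank_mono hUle).trans ((finrank_span_le_card _).trans (by simp))
  -- The image `W` of `V₃` under `u ↦ u - u ∘ σ₁` has dimension at least `dim V₃ - 1`, because the
  -- kernel consists of constants. It is orthogonal to `V₁` and to `V₂`, whose sum has dimension at
  -- least `dim V₁ + dim V₂ - 1`. Both spaces lie in `V`, which gives the bound.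
  let T : (α → ℚ) →ₗ[ℚ] (α → ℚ) := LinearMap.id - LinearMap.funLeft ℚ ℚ σ₁
  have hT : ∀ u a, T u a = u a - u (σ₁ a) := fun u a => rfl
  have hker : finrank ℚ (LinearMap.ker (T.domRestrict V₃)) ≤ 1 := by
    have hm : finrank ℚ (LinearMap.ker (T.domRestrict V₃)) =
        finrank ℚ ((LinearMap.ker (T.domRestrict V₃)).map V₃.subtype) :=
      (LinearEquiv.finrank_eq (Submodule.equivMapOfInjective _ V₃.injective_subtype _))
    rw [hm]
    apply hone
    rintro _ ⟨⟨u, hu⟩, hk, rfl⟩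
    have h1 : ∀ a, u (σ₁ a) = u a := fun a => by
      have := congrFun (LinearMap.mem_ker.1 hk) a
      rw [LinearMap.domRestrict_apply, hT] at this
      simp only [Pi.zero_apply] at this
      linarith
    have h3 : ∀ a, u (σ₃ a) = u a := hu.1
    refine hc u h1 (fun a => ?_) h3
    have := h123 (σ₃⁻¹ a)
    rw [show σ₃ (σ₃⁻¹ a) = a from by simp] at this
    rw [← h1 (σ₂ a), this, ← h3 (σ₃⁻¹ a)]
    simp
  have hrank := LinearMap.finrank_range_add_finrank_ker (T.domRestrict V₃)
  set W := LinearMap.range (T.domRestrict V₃) with hW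
  have hinf : finrank ℚ ↥(V₁ ⊓ V₂) ≤ 1 := by
    apply hone
    rintro u ⟨hu1, hu2⟩
    have h1 : ∀ a, u (σ₁ a) = u a := hu1.1
    have h2 : ∀ a, u (σ₂ a) = u a := hu2.1
    refine hc u h1 h2 fun a => ?_
    conv_rhs => rw [← h123 a, h1, h2]
  have hsup := Submodule.finrank_sup_add_finrank_inf_eq V₁ V₂
  have hWT : ∀ x ∈ W, ∃ u ∈ V₃, ∀ a, x a = u a - u (σ₁ a) := by
    rintro _ ⟨⟨u, hu⟩, rfl⟩
    exact ⟨u, hu, fun a => rfl⟩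
  have horth1 : ∀ x ∈ W, ∀ v ∈ V₁, ∑ a, x a * v a = 0 := by
    intro x hx v hv
    obtain ⟨u, hu, hxu⟩ := hWT x hx
    have h1 : ∀ a, v (σ₁ a) = v a := hv.1
    calc ∑ a, x a * v a = ∑ a, u a * v a - ∑ a, u (σ₁ a) * v (σ₁ a) := by
          rw [← Finset.sum_sub_distrib]
          exact Finset.sum_congr rfl fun a _ => by rw [hxu, h1]; ring
      _ = 0 := by
          rw [Equiv.sum_comp σ₁ (fun a => u a * v a), sub_self]
  have horth2 : ∀ x ∈ W, ∀ v ∈ V₂, ∑ a, x a * v a = 0 := by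
    intro x hx v hv
    obtain ⟨u, hu, hxu⟩ := hWT x hx
    have h2 : ∀ a, v (σ₂ a) = v a := hv.1
    have h3 : ∀ a, u (σ₃ a) = u a := hu.1
    have h12 : ∀ a, u (σ₁ (σ₂ a)) = u a := fun a => by
      have := h123 (σ₃⁻¹ a)
      rw [show σ₃ (σ₃⁻¹ a) = a from by simp] at this
      rw [this, ← h3 (σ₃⁻¹ a)]
      simp
    calc ∑ a, x a * v a = ∑ a, u a * v a - ∑ a, u (σ₁ a) * v a := by
          rw [← Finset.sum_sub_distrib]
          exact Finset.sum_congr rfl fun a _ => by rw [hxu]; ring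
      _ = ∑ a, u a * v a - ∑ a, u (σ₁ (σ₂ a)) * v (σ₂ a) := by
          rw [Equiv.sum_comp σ₂ (fun a => u (σ₁ a) * v a)]
      _ = 0 := by simp only [h12, h2, sub_self]
  -- A common element is orthogonal to itself, hence zero over `ℚ`.
  have hdisj : Disjoint W (V₁ ⊔ V₂) := by
    rw [Submodule.disjoint_def]
    intro x hx hx'
    obtain ⟨v₁, hv₁, v₂, hv₂, hsum⟩ := Submodule.mem_sup.1 hx'
    have h0 : ∑ a, x a * x a = 0 := by
      calc ∑ a, x a * x a = ∑ a, x a * v₁ a + ∑ a, x a * v₂ a := by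
            rw [← Finset.sum_add_distrib]
            refine Finset.sum_congr rfl fun a _ => ?_
            conv_lhs => rw [← hsum]
            rw [← hsum]
            simp only [Pi.add_apply]
            ring
        _ = 0 := by rw [horth1 x hx v₁ hv₁, horth2 x hx v₂ hv₂, add_zero]
    have := (Finset.sum_eq_zero_iff_of_nonneg fun a _ => mul_self_nonneg (x a)).1 h0
    exact funext fun a => mul_self_eq_zero.1 (this a (Finset.mem_univ a))
  have hWV : W ≤ V := by
    intro x hx q a
    obtain ⟨u, hu, hxu⟩ := hWT x hx
    have hq : ∀ a, u (q • a) = u a := hu.2 q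
    rw [hxu, hxu, hQ, hq, hq]
  have hle : W ⊔ (V₁ ⊔ V₂) ≤ V := sup_le hWV (sup_le inf_le_right inf_le_right)
  have h1 := Submodule.finrank_mono hle
  have h2 := Submodule.finrank_sup_add_finrank_inf_eq W (V₁ ⊔ V₂)
  rw [hdisj.eq_bot, finrank_bot] at h2
  omega

end RiemannHurwitz

/-! ### Rigidity of genus zero covers with three fixed flags -/

section RiemannHurwitz

open MulAction Module

/-- A nontrivial rotation of the sphere fixes only two points. Here Riemann–Hurwitz bounds the
number of orbits on `Φ` by that on `α` plus two. By Burnside, freeness on `α` and three common fixed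
points in `Φ` give `|Φ| + 3(|Q| - 1) ≤ |α| + 2|Q|`; with `|Φ| = |α| + 2` this means `|Q| ≤ 1`. -/
theorem card_eq_one_of_three_fixed {α Φ Q : Type*} [Fintype α] [Fintype Φ] [Group Q] [Finite Q]
    [MulAction Q α] [MulAction Q Φ] (hfree : ∀ (q : Q) (a : α), q • a = a → q = 1)
    (σ : Fin 3 → Equiv.Perm α) (hσ : σ 0 * σ 1 * σ 2 = 1)
    (hc : ∀ u : α → ℚ, (∀ i a, u (σ i a) = u a) → ∀ a b, u a = u b)
    (hQ : ∀ i (q : Q) a, σ i (q • a) = q • σ i a) (l : Fin 3 → α → Φ)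
    (hlQ : ∀ i (q : Q) a, l i (q • a) = q • l i a) (hlσ : ∀ i a, l i (σ i a) = l i a)
    (hls : ∀ x, ∃ i a, l i a = x) (hcard : Fintype.card Φ = Fintype.card α + 2)
    (T : Finset Φ) (hT : 3 ≤ T.card) (hTQ : ∀ x ∈ T, ∀ q : Q, q • x = x) : Nat.card Q = 1 := by
  classical
  have _ : Fintype Q := Fintype.ofFinite Q
  have _ : Fintype (Quotient (orbitRel Q Φ)) := Fintype.ofFinite _
  have _ : Fintype (Quotient (orbitRel Q α)) := Fintype.ofFinite _
  have hRH := finrank_permInvariant_le Q (σ 0) (σ 1) (σ 2) hσ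
    (fun u h0 h1 h2 => hc u (fun i => by fin_cases i; exacts [h0, h1, h2])) (hQ 0)
  let V : Fin 3 → Submodule ℚ (α → ℚ) := fun i => permInvariant (σ i) ⊓ invariantFunctions Q
  -- An invariant function is determined by its values on orbit representatives.
  have hup : finrank ℚ (invariantFunctions Q : Submodule ℚ (α → ℚ)) ≤
      Fintype.card (Quotient (orbitRel Q α)) := by
    rw [← finrank_fintype_fun_eq_card ℚ]
    refine LinearMap.finrank_le_finrank_of_injective
      (f := (LinearMap.funLeft ℚ ℚ (Quotient.out : Quotient (orbitRel Q α) → α)).comp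
        (invariantFunctions Q).subtype) ?_
    rintro ⟨f, hf⟩ ⟨g, hg⟩ hfg
    refine Subtype.ext (funext fun a => ?_)
    have h1 : f (Quotient.out (Quotient.mk (orbitRel Q α) a)) =
        g (Quotient.out (Quotient.mk (orbitRel Q α) a)) := congrFun hfg _
    obtain ⟨q, hq⟩ : (Quotient.mk (orbitRel Q α) a).out ∈ orbit Q a :=
      orbitRel_apply.1 (Quotient.exact (Quotient.out_eq _))
    simp only at hq
    rw [← hq, hf q a, hg q a] at h1
    exact h1
  -- Functions on the set of orbits of `Φ` pull back along the three labellings; the pullback is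
  -- injective because every label is attained.
  have hlow : Fintype.card (Quotient (orbitRel Q Φ)) ≤
      finrank ℚ (V 0) + finrank ℚ (V 1) + finrank ℚ (V 2) := by
    rw [← finrank_fintype_fun_eq_card ℚ, ← Fin.sum_univ_three (fun i => finrank ℚ (V i)),
      ← Module.finrank_pi_fintype]
    let A : (Quotient (orbitRel Q Φ) → ℚ) →ₗ[ℚ] (∀ i, V i) :=
      LinearMap.pi fun i => (LinearMap.funLeft ℚ ℚ
        (fun a => (Quotient.mk (orbitRel Q Φ) (l i a)))).codRestrict (V i) (fun f => by
          refine ⟨fun a => ?_, fun q a => ?_⟩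
          · simp only [LinearMap.funLeft_apply, hlσ]
          · simp only [LinearMap.funLeft_apply, hlQ]
            congr 1
            exact Quotient.sound ⟨q, rfl⟩)
    refine LinearMap.finrank_le_finrank_of_injective (f := A) ?_
    intro f g hfg
    funext ω
    obtain ⟨x, rfl⟩ := Quotient.exists_rep ω
    obtain ⟨i, a, rfl⟩ := hls x
    exact congrFun (congrArg Subtype.val (congrFun hfg i)) a
  have hBα := sum_card_fixedBy_eq_card_orbits_mul_card_group Q α
  have hBΦ := sum_card_fixedBy_eq_card_orbits_mul_card_group Q Φ
  have h1 : ∑ q : Q, Fintype.card (fixedBy α q) = Fintype.card α := by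
    rw [Finset.sum_eq_single 1]
    · exact Fintype.card_congr (Equiv.subtypeUnivEquiv (fun a => one_smul Q a : ∀ a, a ∈ fixedBy α (1 : Q)))
    · intro q _ hq
      rw [Fintype.card_eq_zero_iff]
      exact ⟨fun a => hq (hfree q a.1 a.2)⟩
    · simp
  have h2 : Fintype.card Φ + 3 * (Fintype.card Q - 1) ≤
      ∑ q : Q, Fintype.card (fixedBy Φ q) := by
    rw [← Finset.add_sum_erase _ _ (Finset.mem_univ (1 : Q))]
    refine Nat.add_le_add ?_ ?_
    · exact (Fintype.card_congr (Equiv.subtypeUnivEquiv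
        (fun a => one_smul Q a : ∀ a, a ∈ fixedBy Φ (1 : Q)))).ge
    · have : 3 * (Fintype.card Q - 1) = ∑ q ∈ Finset.univ.erase (1 : Q), 3 := by
        rw [Finset.sum_const, Finset.card_erase_of_mem (Finset.mem_univ _), Finset.card_univ,
          smul_eq_mul, mul_comm]
      rw [this]
      refine Finset.sum_le_sum fun q _ => hT.trans ?_
      rw [← Fintype.card_coe]
      exact Fintype.card_le_of_injective (fun x : T => ⟨x.1, hTQ x.1 x.2 q⟩)
        fun x y hxy => Subtype.ext (congrArg (fun z : fixedBy Φ q => z.1) hxy)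
  have hV : finrank ℚ (V 0) + finrank ℚ (V 1) + finrank ℚ (V 2) ≤
      finrank ℚ (invariantFunctions Q : Submodule ℚ (α → ℚ)) + 2 := hRH
  have h3 : Fintype.card (Quotient (orbitRel Q Φ)) ≤
    Fintype.card (Quotient (orbitRel Q α)) + 2 := by omega
  have h4 := Nat.mul_le_mul_right (Fintype.card Q) h3
  rw [h1] at hBα
  rw [hBΦ] at h2
  rw [add_mul, ← hBα] at h4
  have h5 : 0 < Fintype.card Q := Fintype.card_pos
  rw [Nat.card_eq_fintype_card]
  omega

/-- When `Q` preserves the label `x`, it acts freely on the sheets carrying it. -/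
theorem card_dvd_fibreCard {α Φ Q : Type*} [Fintype α] [DecidableEq Φ] [Group Q] [Finite Q]
    [MulAction Q α] (hfree : ∀ (q : Q) (a : α), q • a = a → q = 1) (l : α → Φ) (x : Φ)
    (hl : ∀ (q : Q) a, l a = x → l (q • a) = x) : Nat.card Q ∣ fibreCard l x := by
  let act : MulAction Q {a // l a = x} :=
    { smul := fun q a => ⟨q • a.1, hl q a.1 a.2⟩
      one_smul := fun a => Subtype.ext (one_smul Q a.1)
      mul_smul := fun q q' a => Subtype.ext (mul_smul q q' a.1) }
  have h : Nat.card Q ∣ Nat.card {a // l a = x} :=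
    card_dvd_card_of_free fun q a ha => hfree q a.1 (congrArg Subtype.val ha)
  have h2 : Nat.card {a // l a = x} = fibreCard l x := by
    rw [Nat.card_eq_fintype_card, Fintype.card_subtype]
    rfl
  rwa [h2] at h

end RiemannHurwitz

/-! ### Hurwitz tuples with labelled cycles -/

section LabelledTuples

open Equiv MulAction

variable {n D : ℕ} {Φ : Type*} [Fintype Φ] [DecidableEq Φ] (κ : Φ → Fin n) (d : Φ → ℕ)

/-- The parts of the partition over the `i`-th branch point. -/
def partsOver (i : Fin n) : Multiset ℕ := (Finset.univ.filter fun x => κ x = i).val.map d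

/-- The tuples counted by Hurwitz numbers. -/
def IsHurwitzTuple (μ : Fin n → Multiset ℕ) (σ : Fin n → Perm (Fin D)) : Prop :=
  (∀ i, (σ i).partition.parts = μ i) ∧ (List.ofFn σ).prod = 1 ∧
    IsPretransitive (Subgroup.closure (Set.range σ)) (Fin D)

/-- Transitive tuples with product `1` together with a labelling of their cycles by `Φ`. -/
structure IsLabelledTuple (σ : Fin n → Perm (Fin D)) (l : Fin n → Fin D → Φ) : Prop where
  prod_eq : (List.ofFn σ).prod = 1
  transitive : IsPretransitive (Subgroup.closure (Set.range σ)) (Fin D)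
  labelling : ∀ i, IsCycleLabelling (σ i) (Finset.univ.filter fun x => κ x = i) (l i)
  fibre : ∀ i, ∀ x ∈ Finset.univ.filter fun x => κ x = i, fibreCard (l i) x = d x

/-- The type of labelled tuples. -/
def LabelledTuple (D : ℕ) {Φ : Type*} [Fintype Φ] [DecidableEq Φ] (κ : Φ → Fin n)
    (d : Φ → ℕ) : Type _ :=
  {s : (Fin n → Perm (Fin D)) × (Fin n → Fin D → Φ) // IsLabelledTuple κ d s.1 s.2}

instance : Finite (LabelledTuple D κ d) := by
  unfold LabelledTuple
  infer_instance

/-- The labellings over different branch points are chosen independently. For the flags at a vertex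
`V` the count is `D! H(V) CF(V)`, which turns the rational local factor into the size of a set
carrying a group action. -/
theorem card_labelledTuple : Nat.card (LabelledTuple D κ d) =
    Nat.card {σ : Fin n → Perm (Fin D) // IsHurwitzTuple (partsOver κ d) σ} *
      ∏ i, ∏ w ∈ (partsOver κ d i).toFinset, ((partsOver κ d i).count w).factorial := by
  classical
  let e : LabelledTuple D κ d ≃
      Σ σ : {σ : Fin n → Perm (Fin D) // IsHurwitzTuple (partsOver κ d) σ},
        ∀ i, {l : Fin D → Φ // IsCycleLabelling (σ.1 i) (Finset.univ.filter fun x => κ x = i) l ∧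
          ∀ x ∈ Finset.univ.filter fun x => κ x = i, fibreCard l x = d x} :=
    { toFun := fun s => ⟨⟨s.1.1, fun i => by
          rw [← (s.2.labelling i).map_fibreCard]
          exact Multiset.map_congr rfl (s.2.fibre i), s.2.prod_eq, s.2.transitive⟩,
          fun i => ⟨s.1.2 i, s.2.labelling i, s.2.fibre i⟩⟩
      invFun := fun t => ⟨(t.1.1, fun i => (t.2 i).1),
        ⟨t.1.2.2.1, t.1.2.2.2, fun i => (t.2 i).2.1, fun i => (t.2 i).2.2⟩⟩
      left_inv := fun s => rfl
      right_inv := fun t => rfl }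
  rw [Nat.card_congr e, Nat.card_sigma]
  have : ∀ σ : {σ : Fin n → Perm (Fin D) // IsHurwitzTuple (partsOver κ d) σ},
      Nat.card (∀ i, {l : Fin D → Φ //
        IsCycleLabelling (σ.1 i) (Finset.univ.filter fun x => κ x = i) l ∧
          ∀ x ∈ Finset.univ.filter fun x => κ x = i, fibreCard l x = d x}) =
      ∏ i, ∏ w ∈ (partsOver κ d i).toFinset, ((partsOver κ d i).count w).factorial := by
    intro σ
    rw [Nat.card_pi]
    exact Finset.prod_congr rfl fun i _ => card_isCycleLabelling _ _ _ (σ.2.1 i).symm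
  rw [Finset.sum_congr rfl fun σ _ => this σ, Finset.sum_const, Finset.card_univ,
    smul_eq_mul, Nat.card_eq_fintype_card]

theorem IsLabelledTuple.smul {κ : Φ → Fin n} {d : Φ → ℕ} {σ : Fin n → Perm (Fin D)}
    {l : Fin n → Fin D → Φ} (h : IsLabelledTuple κ d σ l) (τ : Perm (Fin D)) (p : Perm Φ)
    (hκ : ∀ x, κ (p x) = κ x) (hd : ∀ x, d (p x) = d x) :
    IsLabelledTuple κ d (fun i => τ * σ i * τ⁻¹) (fun i a => p (l i (τ⁻¹ a))) where
  prod_eq := by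
    have : List.ofFn (fun i => τ * σ i * τ⁻¹) = (List.ofFn σ).map (MulAut.conj τ) := by
      rw [List.map_ofFn]
      rfl
    rw [this, ← map_list_prod, h.prod_eq, map_one]
  transitive := by
    have hr : Set.range (fun i => τ * σ i * τ⁻¹) =
        (MulAut.conj τ).toMonoidHom '' Set.range σ := by
      rw [← Set.range_comp]
      rfl
    rw [hr, ← MonoidHom.map_closure]
    refine ⟨fun a b => ?_⟩
    obtain ⟨g, hg⟩ := h.transitive.exists_smul_eq (τ⁻¹ a) (τ⁻¹ b)
    refine ⟨⟨MulAut.conj τ g.1, Subgroup.mem_map_of_mem _ g.2⟩, ?_⟩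
    change τ (g.1 (τ⁻¹ a)) = b
    change g.1 (τ⁻¹ a) = τ⁻¹ b at hg
    rw [hg]
    simp
  labelling i := by
    refine ⟨fun a b => ?_, fun x => ?_⟩
    · rw [p.apply_eq_iff_eq, (h.labelling i).eq_iff, Perm.sameCycle_conj]
    · rw [Finset.mem_filter]
      have hx := (h.labelling i).mem_iff (p⁻¹ x)
      rw [Finset.mem_filter] at hx
      have hκ' : κ (p⁻¹ x) = κ x := by
        rw [← hκ (p⁻¹ x)]
        simp
      rw [hκ'] at hx
      simp only [Finset.mem_univ, true_and] at hx ⊢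
      rw [hx]
      constructor
      · rintro ⟨a, ha⟩
        exact ⟨τ a, by simp [ha]⟩
      · rintro ⟨a, ha⟩
        exact ⟨τ⁻¹ a, by simp [← ha]⟩
  fibre i x hx := by
    rw [Finset.mem_filter] at hx
    have hκ' : κ (p⁻¹ x) = κ x := by
      rw [← hκ (p⁻¹ x)]
      simp
    have hd' : d (p⁻¹ x) = d x := by
      rw [← hd (p⁻¹ x)]
      simp
    rw [← hd', ← h.fibre i (p⁻¹ x) (Finset.mem_filter.2 ⟨Finset.mem_univ _, hκ'.trans hx.2⟩)]
    unfold fibreCard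
    refine Finset.card_bij (fun a _ => τ⁻¹ a) ?_ ?_ ?_
    · intro a ha
      simp only [Finset.mem_filter, Finset.mem_univ, true_and] at ha ⊢
      rw [← ha]
      simp
    · intro a _ b _ hab
      exact τ⁻¹.injective hab
    · intro b hb
      simp only [Finset.mem_filter, Finset.mem_univ, true_and] at hb
      exact ⟨τ b, by simp [hb], by simp⟩

variable (P : Subgroup (Perm Φ))

/-- Pairs of a relabelling of the sheets and of the cycles act on labelled tuples. -/
@[reducible] def labelledTupleAction (hκ : ∀ p ∈ P, ∀ x, κ (p x) = κ x)
    (hd : ∀ p ∈ P, ∀ x, d (p x) = d x) : MulAction (Perm (Fin D) × P) (LabelledTuple D κ d) where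
  smul g s := ⟨(fun i => g.1 * s.1.1 i * g.1⁻¹, fun i a => g.2.1 (s.1.2 i (g.1⁻¹ a))),
    s.2.smul g.1 g.2.1 (hκ _ g.2.2) (hd _ g.2.2)⟩
  one_smul s := by
    refine Subtype.ext (Prod.ext ?_ rfl)
    funext i
    exact (by simp : (1 : Perm (Fin D)) * s.1.1 i * 1⁻¹ = s.1.1 i)
  mul_smul g g' s := by
    refine Subtype.ext (Prod.ext ?_ ?_)
    · funext i
      exact (by simp [mul_assoc] : (g.1 * g'.1) * s.1.1 i * (g.1 * g'.1)⁻¹ =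
        g.1 * (g'.1 * s.1.1 i * g'.1⁻¹) * g.1⁻¹)
    · funext i a
      exact (by simp : (g.2.1 * g'.2.1) (s.1.2 i ((g.1 * g'.1)⁻¹ a)) =
        g.2.1 (g'.2.1 (s.1.2 i (g'.1⁻¹ (g.1⁻¹ a)))))

/-- A group of permutations of the flags at a vertex that preserves images and degrees has order
dividing the number of labelled covers, up to a factor controlled by the flags it fixes. -/
theorem factorial_mul_card_dvd (hκ : ∀ p ∈ P, ∀ x, κ (p x) = κ x)
    (hd : ∀ p ∈ P, ∀ x, d (p x) = d x) (w : ℕ)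
    (hw : (∀ e, (∀ x, (∀ p ∈ P, p x = x) → e ∣ d x) → e ∣ w) ∨
      (n = 3 ∧ Fintype.card Φ = D + 2 ∧
        ∃ T : Finset Φ, 3 ≤ T.card ∧ ∀ x ∈ T, ∀ p ∈ P, p x = x)) :
    D.factorial * Nat.card P ∣
      w * (Nat.card {σ : Fin n → Perm (Fin D) // IsHurwitzTuple (partsOver κ d) σ} *
        ∏ i, ∏ w ∈ (partsOver κ d i).toFinset, ((partsOver κ d i).count w).factorial) := by
  classical
  let act := labelledTupleAction (D := D) κ d P hκ hd
  rw [← card_labelledTuple]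
  have hG : Nat.card (Perm (Fin D) × P) = D.factorial * Nat.card P := by
    rw [Nat.card_prod, Nat.card_eq_fintype_card (α := Perm (Fin D)), Fintype.card_perm,
      Fintype.card_fin]
  rw [← hG]
  refine card_dvd_mul_card_of_card_stabilizer_dvd w fun s => ?_
  set σ := s.1.1 with hσ
  set l := s.1.2 with hl
  have hs : IsLabelledTuple κ d σ l := s.2
  set Q := stabilizer (Perm (Fin D) × P) s with hQdef
  have hcomm : ∀ (q : Q) i a, σ i (q.1.1 a) = q.1.1 (σ i a) := by
    intro q i a
    have h1 : q.1.1 * σ i * q.1.1⁻¹ = σ i :=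
      congrFun (congrArg (fun s : LabelledTuple D κ d => s.1.1) q.2) i
    have h2 := Equiv.congr_fun h1 (q.1.1 a)
    rw [← h2]
    simp
  have hlab : ∀ (q : Q) i a, l i (q.1.1 a) = q.1.2.1 (l i a) := by
    intro q i a
    have h1 : (fun a => q.1.2.1 (l i (q.1.1⁻¹ a))) = l i :=
      congrFun (congrArg (fun s : LabelledTuple D κ d => s.1.2) q.2) i
    have h2 := congrFun h1 (q.1.1 a)
    rw [← h2]
    simp
  have hsurj : ∀ x, ∃ i a, l i a = x := fun x =>
    ⟨κ x, ((hs.labelling (κ x)).mem_iff x).1 (by simp)⟩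
  -- The sheet component commutes with a transitive group, so fixing one sheet makes it trivial. The
  -- flag component is then trivial too, since every flag occurs as a label.
  have hfree : ∀ (q : Q) (a : Fin D), q.1.1 a = a → q = 1 := by
    intro q a ha
    have hτ : q.1.1 = 1 := by
      ext b
      obtain ⟨⟨g, hg⟩, hgb⟩ := hs.transitive.exists_smul_eq a b
      change g a = b at hgb
      have hg' : ∀ c, g (q.1.1 c) = q.1.1 (g c) := by
        have hle : Subgroup.closure (Set.range σ) ≤ Subgroup.centralizer {q.1.1} := by
          rw [Subgroup.closure_le]
          rintro _ ⟨i, rfl⟩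
          refine Subgroup.mem_centralizer_singleton_iff.2 ?_
          ext c
          simp [hcomm q i c]
        have := Subgroup.mem_centralizer_singleton_iff.1 (hle hg)
        intro c
        exact Equiv.congr_fun this c
      rw [← hgb, ← hg', ha]
      rfl
    refine Subtype.ext (Prod.ext hτ (Subtype.ext ?_))
    ext x
    obtain ⟨i, b, rfl⟩ := hsurj x
    rw [← hlab, hτ]
    rfl
  let f₁ : Q →* Perm (Fin D) := (MonoidHom.fst _ _).comp Q.subtype
  let f₂ : Q →* Perm Φ := P.subtype.comp ((MonoidHom.snd _ _).comp Q.subtype)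
  let actα : MulAction Q (Fin D) := MulAction.compHom (Fin D) f₁
  let actΦ : MulAction Q Φ := MulAction.compHom Φ f₂
  -- A flag fixed by `P` has its set of sheets preserved by `Q`, so `|Q|` divides its weight. In the
  -- other case the three fixed flags make `Q` trivial.
  rcases hw with hw | ⟨rfl, hcard, T, hT, hTP⟩
  · refine hw _ fun x hx => ?_
    rw [← hs.fibre (κ x) x (by simp)]
    refine card_dvd_fibreCard (Q := Q) hfree (l (κ x)) x fun q a ha => ?_
    change l (κ x) (q.1.1 a) = x
    rw [hlab, ha, hx _ q.1.2.2]
  · have : Nat.card Q = 1 := by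
      refine card_eq_one_of_three_fixed (Q := Q) hfree σ ?_ ?_ (fun i q a => hcomm q i a) l
        (fun i q a => hlab q i a) ?_ hsurj (by rw [hcard, Fintype.card_fin]) T hT
        (fun x hx q => hTP x hx _ q.1.2.2)
      · simpa [List.ofFn_succ, mul_assoc] using hs.prod_eq
      · intro u hu a b
        obtain ⟨⟨g, hg⟩, hgb⟩ := hs.transitive.exists_smul_eq a b
        change g a = b at hgb
        rw [← hgb]
        clear hgb
        revert a
        induction hg using Subgroup.closure_induction with
        | mem g hg =>
          obtain ⟨i, rfl⟩ := hg
          exact fun a => (hu i a).symm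
        | one => exact fun a => rfl
        | mul g g' _ _ h h' =>
          intro a
          rw [h' a, h (g' a)]
          rfl
        | inv g _ h =>
          intro a
          rw [h (g⁻¹ a)]
          simp
      · intro i a
        rw [(hs.labelling i).eq_iff]
        exact Perm.sameCycle_apply_left.2 (Perm.SameCycle.refl _ _)
    rw [this]
    exact one_dvd _

end LabelledTuples

/-! ### Flags, connectedness and the core of a graph -/

namespace DiscreteGraph

variable {F : Type*} [Fintype F] [DecidableEq F] {G : DiscreteGraph F}

theorem mem_vertices {v : F} : v ∈ G.vertices ↔ G.root v = v := by
  unfold vertices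
  rw [Finset.mem_image]
  exact ⟨fun ⟨x, _, hx⟩ => by rw [← hx, G.root_root], fun h => ⟨v, Finset.mem_univ _, h⟩⟩

theorem root_mem_vertices (x : F) : G.root x ∈ G.vertices := mem_vertices.2 (G.root_root x)

theorem mem_star {v x : F} : x ∈ G.star v ↔ G.root x = v ∧ x ≠ v := by
  simp [star]

theorem inv_eq_of_mem_vertices {v : F} (hv : v ∈ G.vertices) : G.inv v = v := by
  rw [← mem_vertices.1 hv, G.inv_root]

theorem mem_star_root {x : F} (hx : G.inv x ≠ x) : x ∈ G.star (G.root x) :=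
  mem_star.2 ⟨rfl, fun h => hx (inv_eq_of_mem_vertices (mem_vertices.2 h.symm))⟩

theorem mem_legs {x : F} : x ∈ G.legs ↔ x ∉ G.vertices ∧ G.inv x = x := by
  simp [legs]

theorem inv_inv_ne {x : F} (hx : G.inv x ≠ x) : G.inv (G.inv x) ≠ G.inv x := by
  rw [G.inv_inv]
  exact hx.symm

variable (G) in
/-- The orbit of a flag under the involution. -/
def edgeOf (x : F) : Finset F := {x, G.inv x}

theorem edgeOf_inv (x : F) : G.edgeOf (G.inv x) = G.edgeOf x := by
  unfold edgeOf
  rw [G.inv_inv, Finset.pair_comm]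

theorem mem_edgeOf {x y : F} : y ∈ G.edgeOf x ↔ y = x ∨ y = G.inv x := by
  simp [edgeOf]

theorem edgeOf_eq_iff {x y : F} : G.edgeOf y = G.edgeOf x ↔ y = x ∨ y = G.inv x := by
  constructor
  · intro h
    rw [← mem_edgeOf, ← h]
    exact mem_edgeOf.2 (Or.inl rfl)
  · rintro (rfl | rfl)
    · rfl
    · exact edgeOf_inv x

theorem mem_edges {e : Finset F} : e ∈ G.edges ↔ ∃ x, G.inv x ≠ x ∧ G.edgeOf x = e := by
  simp [edges, edgeOf]

theorem edgeOf_mem_edges {x : F} (hx : G.inv x ≠ x) : G.edgeOf x ∈ G.edges :=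
  mem_edges.2 ⟨x, hx, rfl⟩

theorem two_mul_card_image_edgeOf {W : Finset F} (hW : ∀ x ∈ W, G.inv x ≠ x ∧ G.inv x ∈ W) :
    2 * (W.image G.edgeOf).card = W.card := by
  rw [Finset.card_eq_sum_card_image G.edgeOf W, mul_comm, ← smul_eq_mul, ← Finset.sum_const]
  refine Finset.sum_congr rfl fun e he => ?_
  obtain ⟨x, hx, rfl⟩ := Finset.mem_image.1 he
  have : W.filter (fun y => G.edgeOf y = G.edgeOf x) = {x, G.inv x} := by
    ext y
    rw [Finset.mem_filter, edgeOf_eq_iff, Finset.mem_insert, Finset.mem_singleton]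
    constructor
    · exact fun h => h.2
    · rintro (rfl | rfl)
      · exact ⟨hx, Or.inl rfl⟩
      · exact ⟨(hW x hx).2, Or.inr rfl⟩
  rw [this, Finset.card_pair (hW x hx).1.symm]

/-! #### Connectedness -/

theorem IsConnected.induction (hG : G.IsConnected) (p : F → Prop)
    (hroot : ∀ x, p x ↔ p (G.root x)) (hinv : ∀ x, p x ↔ p (G.inv x)) {x : F} (hx : p x) (y : F) :
    p y := by
  have h : ∀ a b, Relation.EqvGen (fun a b => b = G.root a ∨ b = G.inv a) a b → (p a ↔ p b) := by
    intro a b hab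
    induction hab with
    | rel a b h =>
      rcases h with rfl | rfl
      · exact hroot a
      · exact hinv a
    | refl a => rfl
    | symm a b _ h => exact h.symm
    | trans a b c _ _ h h' => exact h.trans h'
  exact (h x y (hG.2 x y)).1 hx

/-- If no half-edge crossed the boundary of `T`, having its root in `T` would be a property
invariant under the root map and the involution, hence constant on a connected graph. -/
theorem IsConnected.exists_crossing (hG : G.IsConnected) {T : Finset F} {t v : F} (ht : t ∈ T)
    (htv : t ∈ G.vertices) (hv : v ∈ G.vertices) (hvT : v ∉ T) :
    ∃ x, G.inv x ≠ x ∧ G.root x ∉ T ∧ G.root (G.inv x) ∈ T := by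
  by_contra! hcon
  have := hG.induction (fun x => G.root x ∈ T) (fun x => by rw [G.root_root]) (fun x => ?_)
    (x := t) (by rwa [mem_vertices.1 htv]) v
  · simp only [mem_vertices.1 hv] at this
    exact hvT this
  · by_cases hx : G.inv x = x
    · rw [hx]
    · constructor
      · intro h
        by_contra hn
        exact hcon (G.inv x) (inv_inv_ne hx) hn (by rwa [G.inv_inv])
      · intro h
        by_contra hn
        exact hcon x hx hn h

theorem IsConnected.exists_halfEdge (hG : G.IsConnected) (hE : G.edges.Nonempty) {v : F}
    (hv : v ∈ G.vertices) : ∃ x, G.inv x ≠ x ∧ G.root x = v := by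
  obtain ⟨e, he⟩ := hE
  obtain ⟨x, hx, -⟩ := mem_edges.1 he
  by_cases hxv : G.root x = v
  · exact ⟨x, hx, hxv⟩
  · obtain ⟨y, hy, hy1, hy2⟩ := hG.exists_crossing (T := {v}) (Finset.mem_singleton_self v) hv
      (root_mem_vertices x) (by simpa using hxv)
    exact ⟨G.inv y, inv_inv_ne hy, by simpa using hy2⟩

/-! #### The core -/

theorem mem_core {x : F} : x ∈ G.core ↔ ∃ S : Finset F, G.IsLeaflessSubset S ∧ x ∈ S := by
  simp [core]

theorem IsLeaflessSubset.subset_core {S : Finset F} (hS : G.IsLeaflessSubset S) : S ⊆ G.core :=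
  fun _ hx => mem_core.2 ⟨S, hS, hx⟩

variable (G) in
theorem isLeaflessSubset_core : G.IsLeaflessSubset G.core := by
  intro x hx
  obtain ⟨S, hS, hxS⟩ := mem_core.1 hx
  obtain ⟨h1, h2, y, hy, h3⟩ := hS x hxS
  exact ⟨h1, hS.subset_core h2, y, hS.subset_core hy, h3⟩

theorem inv_ne_of_mem_core {x : F} (hx : x ∈ G.core) : G.inv x ≠ x :=
  (G.isLeaflessSubset_core x hx).1

theorem inv_mem_core {x : F} (hx : x ∈ G.core) : G.inv x ∈ G.core :=
  (G.isLeaflessSubset_core x hx).2.1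

theorem inv_mem_core_iff {x : F} : G.inv x ∈ G.core ↔ x ∈ G.core :=
  ⟨fun h => by simpa [G.inv_inv] using inv_mem_core h, inv_mem_core⟩

theorem two_le_coreVal {x : F} (hx : x ∈ G.core) : 2 ≤ G.coreVal (G.root x) := by
  obtain ⟨-, -, y, hy, hyx, hr⟩ := G.isLeaflessSubset_core x hx
  exact Finset.one_lt_card.2 ⟨x, by simp [hx], y, by simp [hy, hr], hyx.symm⟩

/-- The half-edges `a` and `b` of `S` are halves of one edge, or adjacent to the same vertex. -/
def Adjacent (G : DiscreteGraph F) (S : Finset F) (a b : F) : Prop :=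
  a ∈ S ∧ b ∈ S ∧ (b = G.inv a ∨ G.root b = G.root a)

/-- A connected set of half-edges with Euler characteristic `1 - g` that contains the core. -/
structure IsSpine (G : DiscreteGraph F) (g : ℕ) (S : Finset F) : Prop where
  inv_ne : ∀ x ∈ S, G.inv x ≠ x
  inv_mem : ∀ x ∈ S, G.inv x ∈ S
  core_subset : G.core ⊆ S
  connected : ∀ x ∈ S, ∀ y ∈ S, Relation.EqvGen (G.Adjacent S) x y
  card_eq : S.card + 2 = 2 * g + 2 * (S.image G.root).card

/-- Pruning a pendant edge loses two half-edges and one vertex, so the Euler characteristic is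
unchanged. Paths through the removed edge can be rerouted through another half-edge at its far end.
-/
theorem IsSpine.erase {g : ℕ} (hg : 2 ≤ g) {S : Finset F} (hS : IsSpine G g S) {x : F} (hx : x ∈ S)
    (hlone : ∀ y ∈ S, y ≠ x → G.root y ≠ G.root x) :
    IsSpine G g ((S.erase x).erase (G.inv x)) := by
  have hxc : x ∉ G.core := by
    intro hc
    obtain ⟨-, -, y, hy, hyx, hr⟩ := G.isLeaflessSubset_core x hc
    exact hlone y (hS.core_subset hy) hyx hr
  have hix := hS.inv_ne x hx
  set S' := (S.erase x).erase (G.inv x) with hS'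
  have hmem : ∀ y, y ∈ S' ↔ y ≠ G.inv x ∧ y ≠ x ∧ y ∈ S := by
    intro y
    rw [hS', Finset.mem_erase, Finset.mem_erase]
  -- Without a further half-edge at the far end, `S` would be the single edge `{x, inv x}`, contrary
  -- to the Euler characteristic for `g ≥ 2`.
  obtain ⟨z, hz, hzr⟩ : ∃ z ∈ S', G.root z = G.root (G.inv x) := by
    by_contra! hcon
    have hclosed : ∀ a b, Relation.EqvGen (G.Adjacent S) a b →
        ((a = x ∨ a = G.inv x) ↔ (b = x ∨ b = G.inv x)) := by
      intro a b hab
      induction hab with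
      | rel a b h =>
        obtain ⟨ha, hb, rfl | hr⟩ := h
        · constructor
          · rintro (rfl | rfl)
            · exact Or.inr rfl
            · exact Or.inl (G.inv_inv _)
          · rintro (h | h)
            · exact Or.inr (by rw [← h, G.inv_inv])
            · exact Or.inl (by rw [← G.inv_inv a, h, G.inv_inv])
        · have key : ∀ a ∈ S, ∀ b ∈ S, G.root b = G.root a → (a = x ∨ a = G.inv x) →
              (b = x ∨ b = G.inv x) := by
            intro a ha b hb hr h
            by_contra! hn
            rcases h with rfl | rfl
            · exact hlone b hb hn.1 hr
            · exact hcon b ((hmem b).2 ⟨hn.2, hn.1, hb⟩) hr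
          exact ⟨key a ha b hb hr, key b hb a ha hr.symm⟩
      | refl a => rfl
      | symm a b _ h => exact h.symm
      | trans a b c _ _ h h' => exact h.trans h'
    have hSeq : S = {x, G.inv x} := by
      ext y
      simp only [Finset.mem_insert, Finset.mem_singleton]
      constructor
      · intro hy
        exact (hclosed x y (hS.connected x hx y hy)).1 (Or.inl rfl)
      · rintro (rfl | rfl)
        exacts [hx, hS.inv_mem x hx]
    have h1 : S.card = 2 := by rw [hSeq, Finset.card_pair hix.symm]
    have h2 : 0 < (S.image G.root).card :=
      Finset.card_pos.2 ⟨_, Finset.mem_image_of_mem _ hx⟩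
    have := hS.card_eq
    omega
  refine ⟨fun y hy => hS.inv_ne y ((hmem y).1 hy).2.2, fun y hy => ?_, fun y hy => ?_, ?_, ?_⟩
  · obtain ⟨h1, h2, h3⟩ := (hmem y).1 hy
    refine (hmem _).2 ⟨fun h => h2 ?_, fun h => h1 ?_, hS.inv_mem y h3⟩
    · rw [← G.inv_inv y, h, G.inv_inv]
    · rw [← h, G.inv_inv]
  · refine (hmem y).2 ⟨?_, ?_, hS.core_subset hy⟩
    · rintro rfl
      exact hxc (inv_mem_core_iff.1 hy)
    · rintro rfl
      exact hxc hy
  -- The retraction sends both halves of the removed edge to `z` and carries paths in `S` to paths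
  -- in `S'`.
  · let r : F → F := fun y => if y = x ∨ y = G.inv x then z else y
    have hr1 : ∀ y, (y = x ∨ y = G.inv x) → r y = z := fun y hy => if_pos hy
    have hr2 : ∀ y ∈ S', r y = y := fun y hy => if_neg (by
      have := (hmem y).1 hy
      tauto)
    have key : ∀ a b, Relation.EqvGen (G.Adjacent S) a b →
        Relation.EqvGen (G.Adjacent S') (r a) (r b) := by
      intro a b hab
      induction hab with
      | rel a b h =>
        obtain ⟨ha, hb, h⟩ := h
        by_cases hax : a = x ∨ a = G.inv x
        · rw [hr1 a hax]
          by_cases hbx : b = x ∨ b = G.inv x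
          · rw [hr1 b hbx]
            exact Relation.EqvGen.refl _
          · have hbS : b ∈ S' := (hmem b).2 (by tauto)
            rw [hr2 b hbS]
            refine Relation.EqvGen.rel _ _ ⟨hz, hbS, Or.inr ?_⟩
            rcases h with rfl | h
            · exfalso
              apply hbx
              rcases hax with rfl | rfl
              · exact Or.inr rfl
              · exact Or.inl (G.inv_inv _)
            · rcases hax with rfl | rfl
              · exact absurd h (hlone b hb fun hh => hbx (Or.inl hh))
              · rw [h, hzr]
        · have haS : a ∈ S' := (hmem a).2 (by tauto)
          rw [hr2 a haS]
          by_cases hbx : b = x ∨ b = G.inv x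
          · rw [hr1 b hbx]
            refine Relation.EqvGen.rel _ _ ⟨haS, hz, Or.inr ?_⟩
            rcases h with rfl | h
            · exfalso
              apply hax
              rcases hbx with hh | hh
              · exact Or.inr (by rw [← hh, G.inv_inv])
              · exact Or.inl (by rw [← G.inv_inv a, hh, G.inv_inv])
            · rcases hbx with rfl | rfl
              · exact absurd h.symm (hlone a ha fun hh => hax (Or.inl hh))
              · rw [← h, hzr]
          · have hbS : b ∈ S' := (hmem b).2 (by tauto)
            rw [hr2 b hbS]
            exact Relation.EqvGen.rel _ _ ⟨haS, hbS, h⟩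
      | refl a => exact Relation.EqvGen.refl _
      | symm a b _ h => exact h.symm
      | trans a b c _ _ h h' => exact h.trans _ _ _ h'
    intro a ha b hb
    have := key a b (hS.connected a ((hmem a).1 ha).2.2 b ((hmem b).1 hb).2.2)
    rwa [hr2 a ha, hr2 b hb] at this
  · have hc : S.card = S'.card + 2 := by
      have hm : G.inv x ∈ S.erase x := Finset.mem_erase.2 ⟨hix, hS.inv_mem x hx⟩
      have h1 := Finset.card_erase_add_one hx
      have h2 := Finset.card_erase_add_one hm
      rw [hS']
      omega
    have hi : S.image G.root = insert (G.root x) (S'.image G.root) := by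
      ext v
      rw [Finset.mem_insert, Finset.mem_image, Finset.mem_image]
      constructor
      · rintro ⟨y, hy, rfl⟩
        by_cases hyx : y = x
        · exact Or.inl (by rw [hyx])
        · by_cases hyx' : y = G.inv x
          · exact Or.inr ⟨z, hz, by rw [hzr, hyx']⟩
          · exact Or.inr ⟨y, (hmem y).2 ⟨hyx', hyx, hy⟩, rfl⟩
      · rintro (rfl | ⟨y, hy, rfl⟩)
        · exact ⟨x, hx, rfl⟩
        · exact ⟨y, ((hmem y).1 hy).2.2, rfl⟩
    have hni : G.root x ∉ S'.image G.root := by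
      rw [Finset.mem_image]
      rintro ⟨y, hy, hr⟩
      have := (hmem y).1 hy
      exact hlone y this.2.2 this.2.1 hr
    have := hS.card_eq
    rw [hi, Finset.card_insert_of_notMem hni] at this
    omega

/-- Pruning stops at a leafless set containing the core. As the core contains every leafless set,
the two coincide. -/
theorem IsSpine.core {g : ℕ} (hg : 2 ≤ g) {S : Finset F} (hS : IsSpine G g S) :
    IsSpine G g G.core := by
  induction hn : S.card using Nat.strong_induction_on generalizing S with
  | _ n ih =>
    subst hn
    by_cases hl : G.IsLeaflessSubset S
    · rwa [← hS.core_subset.antisymm hl.subset_core] at hS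
    · unfold IsLeaflessSubset at hl
      push Not at hl
      obtain ⟨x, hx, hx'⟩ := hl
      refine ih _ ?_ (hS.erase hg hx (hx' (hS.inv_ne x hx) (hS.inv_mem x hx))) rfl
      refine (Finset.card_erase_le).trans_lt (Finset.card_erase_lt_of_mem hx)

/-- The pruning starts from the set of all half-edges. Since `g ≥ 2` forces an edge to exist, each
vertex carries a half-edge, and the genus formula becomes the required count. -/
theorem IsConnected.isSpine_core {g : ℕ} (hg : 2 ≤ g) (hG : G.IsConnected)
    (hgenus : (G.edges.card : ℤ) - G.vertices.card + 1 = g) : IsSpine G g G.core := by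
  obtain ⟨v⟩ := hG.1
  have hV : 0 < G.vertices.card := Finset.card_pos.2 ⟨_, root_mem_vertices v⟩
  have hE : G.edges.Nonempty := by
    rw [← Finset.card_pos]
    omega
  set S : Finset F := Finset.univ.filter fun x => G.inv x ≠ x with hS
  have hmem : ∀ x, x ∈ S ↔ G.inv x ≠ x := fun x => by simp [hS]
  have hinv : ∀ x ∈ S, G.inv x ∈ S := fun x hx => (hmem _).2 (inv_inv_ne ((hmem x).1 hx))
  refine IsSpine.core hg (S := S) ⟨fun x hx => (hmem x).1 hx, hinv,
    fun x hx => (hmem x).2 (inv_ne_of_mem_core hx), ?_, ?_⟩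
  · have key : ∀ a b, Relation.EqvGen (fun a b => b = G.root a ∨ b = G.inv a) a b →
        ∀ x ∈ S, ∀ y ∈ S, G.root x = G.root a → G.root y = G.root b →
          Relation.EqvGen (G.Adjacent S) x y := by
      intro a b hab
      induction hab with
      | rel a b h =>
        intro x hx y hy hxa hyb
        have hsame : G.root b = G.root a → Relation.EqvGen (G.Adjacent S) x y := fun hba =>
          Relation.EqvGen.rel _ _ ⟨hx, hy, Or.inr (by rw [hyb, hxa, hba])⟩
        rcases h with rfl | rfl
        · exact hsame (G.root_root a)
        · by_cases ha : G.inv a = a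
          · exact hsame (by rw [ha])
          · have haS := (hmem a).2 ha
            exact ((Relation.EqvGen.rel _ _ ⟨hx, haS, Or.inr hxa.symm⟩).trans _ _ _
              (Relation.EqvGen.rel _ _ ⟨haS, hinv a haS, Or.inl rfl⟩)).trans _ _ _
              (Relation.EqvGen.rel _ _ ⟨hinv a haS, hy, Or.inr hyb⟩)
      | refl a =>
        intro x hx y hy hxa hyb
        exact Relation.EqvGen.rel _ _ ⟨hx, hy, Or.inr (by rw [hyb, hxa])⟩
      | symm a b _ h =>
        intro x hx y hy hxa hyb
        exact (h y hy x hx hyb hxa).symm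
      | trans a b c _ _ h h' =>
        intro x hx y hy hxa hyb
        obtain ⟨z, hz, hzr⟩ := hG.exists_halfEdge hE (root_mem_vertices b)
        exact (h x hx z ((hmem z).2 hz) hxa hzr).trans _ _ _ (h' z ((hmem z).2 hz) y hy hzr hyb)
    intro x hx y hy
    exact key x y (hG.2 x y) x hx y hy rfl rfl
  · have h1 : S.image G.root = G.vertices := by
      ext u
      rw [Finset.mem_image]
      constructor
      · rintro ⟨x, -, rfl⟩
        exact root_mem_vertices x
      · intro hu
        obtain ⟨x, hx, hxu⟩ := hG.exists_halfEdge hE hu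
        exact ⟨x, (hmem x).2 hx, hxu⟩
    have h2 : S.image G.edgeOf = G.edges := rfl
    have h3 := two_mul_card_image_edgeOf (G := G) (W := S)
      fun x hx => ⟨(hmem x).1 hx, hinv x hx⟩
    rw [h2] at h3
    rw [h1]
    omega

/-- The core of a graph of genus at least two has no component that is a cycle. -/
theorem IsSpine.no_cycle {g : ℕ} (hg : 2 ≤ g) (hG : IsSpine G g G.core) {C : Finset F}
    (hC : C ⊆ G.core) (hne : C.Nonempty) (hinv : ∀ x ∈ C, G.inv x ∈ C)
    (hroot : ∀ x ∈ C, ∀ y ∈ G.core, G.root y = G.root x → y ∈ C)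
    (hval : ∀ x ∈ C, G.coreVal (G.root x) = 2) : False := by
  have key : ∀ a b, Relation.EqvGen (G.Adjacent G.core) a b → (a ∈ C ↔ b ∈ C) := by
    intro a b hab
    induction hab with
    | rel a b h =>
      obtain ⟨ha, hb, rfl | hr⟩ := h
      · exact ⟨hinv a, fun h => by simpa [G.inv_inv] using hinv _ h⟩
      · exact ⟨fun h => hroot a h b hb hr, fun h => hroot b h a ha hr.symm⟩
    | refl a => rfl
    | symm a b _ h => exact h.symm
    | trans a b c _ _ h h' => exact h.trans h'
  obtain ⟨x, hx⟩ := hne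
  have hCeq : C = G.core := hC.antisymm fun y hy =>
    (key x y (hG.connected x (hC hx) y hy)).1 hx
  -- By connectedness the cycle is the whole core. Its half-edges then number twice its vertices,
  -- which would mean `g = 1`.
  have h1 := Finset.card_eq_sum_card_image G.root G.core
  have h2 : ∑ v ∈ G.core.image G.root, (G.core.filter fun x => G.root x = v).card =
      ∑ v ∈ G.core.image G.root, 2 := by
    refine Finset.sum_congr rfl fun v hv => ?_
    obtain ⟨y, hy, rfl⟩ := Finset.mem_image.1 hv
    exact hval y (hCeq ▸ hy)
  rw [h2, Finset.sum_const, smul_eq_mul] at h1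
  have := hG.card_eq
  omega

end DiscreteGraph

namespace DiscreteGraph

variable {F : Type*} [Fintype F] [DecidableEq F] {G : DiscreteGraph F}

/-! #### The edges of the stabilization -/

theorem merges_inv {x : F} (hx : x ∈ G.core) : G.Merges x (G.inv x) :=
  ⟨hx, inv_mem_core hx, Or.inl rfl⟩

theorem Merges.symm {x y : F} (h : G.Merges x y) : G.Merges y x := by
  obtain ⟨hx, hy, rfl | ⟨hr, hv⟩⟩ := h
  · exact ⟨hy, hx, Or.inl (G.inv_inv x).symm⟩
  · exact ⟨hy, hx, Or.inr ⟨hr.symm, by rwa [hr]⟩⟩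

variable (G) in
open scoped Classical in
/-- The edge of the stabilization that contains `x`. -/
noncomputable def ftEdgeOf (x : F) : Finset F :=
  G.core.filter fun y => Relation.EqvGen G.Merges x y

theorem mem_ftEdgeOf {x y : F} : y ∈ G.ftEdgeOf x ↔ y ∈ G.core ∧ Relation.EqvGen G.Merges x y := by
  classical
  simp [ftEdgeOf]

theorem mem_ftEdges {c : Finset F} : c ∈ G.ftEdges ↔ ∃ x ∈ G.core, G.ftEdgeOf x = c := by
  unfold ftEdges ftEdgeOf
  rw [Finset.mem_image]

theorem ftEdgeOf_mem_ftEdges {x : F} (hx : x ∈ G.core) : G.ftEdgeOf x ∈ G.ftEdges :=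
  mem_ftEdges.2 ⟨x, hx, rfl⟩

theorem self_mem_ftEdgeOf {x : F} (hx : x ∈ G.core) : x ∈ G.ftEdgeOf x :=
  mem_ftEdgeOf.2 ⟨hx, Relation.EqvGen.refl _⟩

theorem subset_core_of_mem_ftEdges {c : Finset F} (hc : c ∈ G.ftEdges) : c ⊆ G.core := by
  obtain ⟨x, hx, rfl⟩ := mem_ftEdges.1 hc
  exact fun y hy => (mem_ftEdgeOf.1 hy).1

theorem eq_ftEdgeOf {c : Finset F} (hc : c ∈ G.ftEdges) {x : F} (hx : x ∈ c) :
    c = G.ftEdgeOf x := by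
  obtain ⟨y, hy, rfl⟩ := mem_ftEdges.1 hc
  have hyx := (mem_ftEdgeOf.1 hx).2
  ext z
  rw [mem_ftEdgeOf, mem_ftEdgeOf]
  exact and_congr_right fun _ => ⟨fun h => hyx.symm.trans _ _ _ h, fun h => hyx.trans _ _ _ h⟩

theorem mem_of_merges {c : Finset F} (hc : c ∈ G.ftEdges) {x y : F} (hx : x ∈ c)
    (h : G.Merges x y) : y ∈ c := by
  rw [eq_ftEdgeOf hc hx]
  exact mem_ftEdgeOf.2 ⟨h.2.1, Relation.EqvGen.rel _ _ h⟩

theorem inv_mem_of_mem_ftEdges {c : Finset F} (hc : c ∈ G.ftEdges) {x : F} (hx : x ∈ c) :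
    G.inv x ∈ c :=
  mem_of_merges hc hx (merges_inv (subset_core_of_mem_ftEdges hc hx))

theorem eq_of_merges_closed {c : Finset F} (hc : c ∈ G.ftEdges) {W : Finset F} (hW : W ⊆ c)
    (hne : W.Nonempty) (hcl : ∀ x ∈ W, ∀ y, G.Merges x y → y ∈ W) : W = c := by
  obtain ⟨x, hx⟩ := hne
  have key : ∀ a b, Relation.EqvGen G.Merges a b → (a ∈ W ↔ b ∈ W) := by
    intro a b hab
    induction hab with
    | rel a b h => exact ⟨fun ha => hcl a ha b h, fun hb => hcl b hb a h.symm⟩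
    | refl a => rfl
    | symm a b _ h => exact h.symm
    | trans a b c _ _ h h' => exact h.trans h'
  refine hW.antisymm fun y hy => ?_
  rw [eq_ftEdgeOf hc (hW hx)] at hy
  exact (key x y (mem_ftEdgeOf.1 hy).2).1 hx

theorem edgeOf_subset_iff {c : Finset F} (hc : c ∈ G.ftEdges) {x : F} :
    G.edgeOf x ⊆ c ↔ x ∈ c := by
  constructor
  · exact fun h => h (mem_edgeOf.2 (Or.inl rfl))
  · intro h y hy
    rcases mem_edgeOf.1 hy with rfl | rfl
    · exact h
    · exact inv_mem_of_mem_ftEdges hc h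

/-- The bivalent vertices of the core on the edge `c` of the stabilization. -/
noncomputable def bivalent (G : DiscreteGraph F) (c : Finset F) : Finset F :=
  (c.image G.root).filter fun v => G.coreVal v = 2

/-- An edge of the stabilization is a chain: after removing one edge of `G` from it, its bivalent
vertices can be matched with adjacent edges. -/
theorem prod_bivalent_dvd {g : ℕ} (hg : 2 ≤ g) (hG : IsSpine G g G.core) {c : Finset F}
    (hc : c ∈ G.ftEdges) {x₀ : F} (hx₀ : x₀ ∈ c) (w : F → ℕ) (δ : Finset F → ℕ)
    (hw : ∀ x ∈ G.core, G.coreVal (G.root x) = 2 → w (G.root x) ∣ δ (G.edgeOf x)) :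
    ∏ v ∈ G.bivalent c, w v ∣ ∏ e ∈ (c.image G.edgeOf).erase (G.edgeOf x₀), δ e := by
  have hcc := subset_core_of_mem_ftEdges hc
  -- The chain `W` grows from the edge of `x₀`. After passing the `k` bivalent vertices in `B` it
  -- has `k + 1` edges; each vertex is matched with the edge added when it was passed.
  have main : ∀ k ≤ (G.bivalent c).card, ∃ W B : Finset F, B.card = k ∧ B ⊆ G.bivalent c ∧
      W ⊆ c ∧ (∀ x ∈ W, G.inv x ∈ W) ∧ x₀ ∈ W ∧ W.card = 2 * k + 2 ∧
      (∀ x ∈ G.core, G.root x ∈ B → x ∈ W) ∧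
      ∏ v ∈ B, w v ∣ ∏ e ∈ (W.image G.edgeOf).erase (G.edgeOf x₀), δ e := by
    intro k
    induction k with
    | zero =>
      intro _
      refine ⟨G.edgeOf x₀, ∅, rfl, Finset.empty_subset _, (edgeOf_subset_iff hc).2 hx₀, ?_,
        mem_edgeOf.2 (Or.inl rfl), ?_, by simp, by simp⟩
      · intro x hx
        rcases mem_edgeOf.1 hx with rfl | rfl
        · exact mem_edgeOf.2 (Or.inr rfl)
        · exact mem_edgeOf.2 (Or.inl (G.inv_inv _))
      · exact Finset.card_pair (inv_ne_of_mem_core (hcc hx₀)).symm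
    | succ k ih =>
      intro hk
      obtain ⟨W, B, hBk, hB, hWc, hWinv, hxW, hWk, hBW, hdvd⟩ := ih (by omega)
      -- If every bivalent vertex met by `W` had been passed, `W` would be closed under merging,
      -- hence equal to `c`, and `B` would already be complete.
      obtain ⟨x, hx, hxb, hxB⟩ : ∃ x ∈ W, G.coreVal (G.root x) = 2 ∧ G.root x ∉ B := by
        by_contra! hcon
        have hWeq := eq_of_merges_closed hc hWc ⟨_, hxW⟩ (fun x hx y hxy => by
          obtain ⟨-, hy, rfl | ⟨hr, hv⟩⟩ := hxy
          · exact hWinv x hx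
          · exact hBW y hy (hr ▸ hcon x hx hv))
        have : B = G.bivalent c := by
          refine hB.antisymm fun v hv => ?_
          obtain ⟨hv1, hv2⟩ := Finset.mem_filter.1 hv
          obtain ⟨x, hx, rfl⟩ := Finset.mem_image.1 hv1
          exact hcon x (hWeq ▸ hx) hv2
        rw [this] at hBk
        omega
      obtain ⟨x', hx', hxx', hx2⟩ : ∃ x' ∈ G.core, x' ≠ x ∧
          G.core.filter (fun y => G.root y = G.root x) = {x, x'} := by
        obtain ⟨a, b, hab, hs⟩ := Finset.card_eq_two.1 hxb
        have hxm : x ∈ ({a, b} : Finset F) := by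
          rw [← hs]
          simp [hcc (hWc hx)]
        have ha : a ∈ G.core := (Finset.mem_filter.1 (hs ▸ Finset.mem_insert_self a {b})).1
        have hb : b ∈ G.core := (Finset.mem_filter.1 (hs ▸ (by simp) :
          b ∈ G.core.filter (fun y => G.root y = G.root x))).1
        rcases Finset.mem_insert.1 hxm with rfl | hxb'
        · exact ⟨b, hb, hab.symm, hs⟩
        · rw [Finset.mem_singleton] at hxb'
          subst hxb'
          exact ⟨a, ha, hab, by rw [hs, Finset.pair_comm]⟩
      have hrx' : G.root x' = G.root x :=
        (Finset.mem_filter.1 (hx2 ▸ (by simp) :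
          x' ∈ G.core.filter (fun y => G.root y = G.root x))).2
      -- Otherwise the `2(k + 1)` half-edges at the passed vertices and at the new one would exhaust
      -- `W`, making `W` a cyclic component of the core.
      have hx'W : x' ∉ W := by
        intro hx'W
        have hfib : ∀ v ∈ insert (G.root x) B,
            W.filter (fun y => G.root y = v) = G.core.filter (fun y => G.root y = v) := by
          intro v hv
          refine (Finset.filter_subset_filter _ (hWc.trans hcc)).antisymm fun y hy => ?_
          obtain ⟨hy1, hy2⟩ := Finset.mem_filter.1 hy
          refine Finset.mem_filter.2 ⟨?_, hy2⟩
          rcases Finset.mem_insert.1 hv with rfl | hv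
          · rw [hx2] at hy
            rcases Finset.mem_insert.1 hy with rfl | hy
            · exact hx
            · rwa [Finset.mem_singleton.1 hy]
          · exact hBW y hy1 (hy2 ▸ hv)
        have hval : ∀ v ∈ insert (G.root x) B, G.coreVal v = 2 := by
          intro v hv
          rcases Finset.mem_insert.1 hv with rfl | hv
          · exact hxb
          · exact (Finset.mem_filter.1 (hB hv)).2
        have hcount : (W.filter fun y => G.root y ∈ insert (G.root x) B).card = W.card := by
          rw [Finset.card_eq_sum_card_fiberwise (f := G.root) (t := insert (G.root x) B)
            (s := W.filter fun y => G.root y ∈ insert (G.root x) B) (fun y hy => (Finset.mem_filter.1 hy).2), hWk]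
          have : ∀ v ∈ insert (G.root x) B, ((W.filter fun y => G.root y ∈
              insert (G.root x) B).filter fun y => G.root y = v).card = 2 := by
            intro v hv
            rw [← hval v hv, coreVal, ← hfib v hv, Finset.filter_filter]
            congr 1
            refine Finset.filter_congr fun y _ => ⟨fun h => h.2, fun h => ⟨h ▸ hv, h⟩⟩
          rw [Finset.sum_congr rfl this, Finset.sum_const, Finset.card_insert_of_notMem hxB, hBk,
            smul_eq_mul]
          ring
        have hWeq := Finset.eq_of_subset_of_card_le (Finset.filter_subset _ _) hcount.ge
        have hWr : ∀ y ∈ W, G.root y ∈ insert (G.root x) B := fun y hy => by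
          rw [← hWeq] at hy
          exact (Finset.mem_filter.1 hy).2
        refine hG.no_cycle hg (hWc.trans hcc) ⟨_, hx⟩ hWinv (fun y hy z hz hzy => ?_)
          (fun y hy => hval _ (hWr y hy))
        have : z ∈ G.core.filter (fun u => G.root u = G.root y) :=
          Finset.mem_filter.2 ⟨hz, hzy⟩
        rw [← hfib _ (hWr y hy)] at this
        exact (Finset.mem_filter.1 this).1
      have hix'W : G.inv x' ∉ W := fun h => hx'W (by simpa [G.inv_inv] using hWinv _ h)
      have hix' := inv_ne_of_mem_core hx'
      have hx'c : x' ∈ c := mem_of_merges hc (hWc hx)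
        ⟨hcc (hWc hx), hx', Or.inr ⟨hrx', hxb⟩⟩
      have hnot : G.edgeOf x' ∉ W.image G.edgeOf := by
        rw [Finset.mem_image]
        rintro ⟨y, hy, hyx⟩
        rcases edgeOf_eq_iff.1 hyx with rfl | rfl
        exacts [hx'W hy, hix'W hy]
      refine ⟨insert x' (insert (G.inv x') W), insert (G.root x) B, ?_, ?_, ?_, ?_, ?_, ?_, ?_, ?_⟩
      · rw [Finset.card_insert_of_notMem hxB, hBk]
      · refine Finset.insert_subset (Finset.mem_filter.2
          ⟨Finset.mem_image_of_mem _ (hWc hx), hxb⟩) hB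
      · exact Finset.insert_subset hx'c
          (Finset.insert_subset (inv_mem_of_mem_ftEdges hc hx'c) hWc)
      · intro y hy
        simp only [Finset.mem_insert] at hy ⊢
        rcases hy with rfl | rfl | hy
        · exact Or.inr (Or.inl rfl)
        · exact Or.inl (G.inv_inv _)
        · exact Or.inr (Or.inr (hWinv y hy))
      · simp [hxW]
      · rw [Finset.card_insert_of_notMem, Finset.card_insert_of_notMem hix'W, hWk]
        · ring
        · simp [hix'.symm, hx'W]
      · intro y hy hyr
        simp only [Finset.mem_insert] at hyr ⊢
        rcases hyr with hyr | hyr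
        · have : y ∈ ({x, x'} : Finset F) := by
            rw [← hx2]
            exact Finset.mem_filter.2 ⟨hy, hyr⟩
          rcases Finset.mem_insert.1 this with rfl | h
          · exact Or.inr (Or.inr hx)
          · exact Or.inl (Finset.mem_singleton.1 h)
        · exact Or.inr (Or.inr (hBW y hy hyr))
      · have himg : (insert x' (insert (G.inv x') W)).image G.edgeOf =
            insert (G.edgeOf x') (W.image G.edgeOf) := by
          rw [Finset.image_insert, Finset.image_insert, edgeOf_inv, Finset.insert_idem]
        have hne : G.edgeOf x' ≠ G.edgeOf x₀ :=
          fun h => hnot (h ▸ Finset.mem_image_of_mem _ hxW)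
        rw [himg, Finset.erase_insert_of_ne hne, Finset.prod_insert
          (fun h => hnot (Finset.mem_of_mem_erase h)), Finset.prod_insert hxB]
        refine mul_dvd_mul ?_ hdvd
        rw [← hrx']
        exact hw x' hx' (by rwa [hrx'])
  obtain ⟨W, B, hBk, hB, hWc, -, -, -, -, hdvd⟩ := main _ le_rfl
  rw [← Finset.eq_of_subset_of_card_le hB hBk.ge]
  exact hdvd.trans (Finset.prod_dvd_prod_of_subset _ _ _
    (Finset.erase_subset_erase _ (Finset.image_subset_image hWc)))

/-! #### Sums and products over the edges of the stabilization -/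

theorem sum_edges_subset {M : Type*} [AddCommMonoid M] {c : Finset F} (hc : c ∈ G.ftEdges)
    (f : Finset F → M) :
    ∑ e ∈ G.edges.filter (fun e => e ⊆ c), f e = ∑ e ∈ c.image G.edgeOf, f e := by
  refine Finset.sum_congr ?_ fun _ _ => rfl
  ext e
  rw [Finset.mem_filter, Finset.mem_image, mem_edges]
  constructor
  · rintro ⟨⟨x, -, rfl⟩, h⟩
    exact ⟨x, (edgeOf_subset_iff hc).1 h, rfl⟩
  · rintro ⟨x, hx, rfl⟩
    exact ⟨⟨x, inv_ne_of_mem_core (subset_core_of_mem_ftEdges hc hx), rfl⟩,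
      (edgeOf_subset_iff hc).2 hx⟩

theorem biUnion_ftEdges_image {β : Type*} [DecidableEq β] (f : F → β) :
    G.ftEdges.biUnion (fun c => c.image f) = G.core.image f := by
  ext b
  simp only [Finset.mem_biUnion, Finset.mem_image]
  constructor
  · rintro ⟨c, hc, x, hx, rfl⟩
    exact ⟨x, subset_core_of_mem_ftEdges hc hx, rfl⟩
  · rintro ⟨x, hx, rfl⟩
    exact ⟨_, ftEdgeOf_mem_ftEdges hx, x, self_mem_ftEdgeOf hx, rfl⟩

theorem prod_ftEdges_edges (δ : Finset F → ℕ) :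
    ∏ c ∈ G.ftEdges, ∏ e ∈ c.image G.edgeOf, δ e = ∏ e ∈ G.core.image G.edgeOf, δ e := by
  rw [← biUnion_ftEdges_image, Finset.prod_biUnion]
  intro c hc c' hc' hne
  rw [Function.onFun, Finset.disjoint_left]
  intro e he he'
  obtain ⟨x, hx, rfl⟩ := Finset.mem_image.1 he
  obtain ⟨y, hy, hyx⟩ := Finset.mem_image.1 he'
  have : x ∈ c' := by
    rw [← edgeOf_subset_iff hc', ← hyx, edgeOf_subset_iff hc']
    exact hy
  exact hne ((eq_ftEdgeOf hc hx).trans (eq_ftEdgeOf hc' this).symm)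

theorem prod_ftEdges_bivalent (w : F → ℕ) :
    ∏ c ∈ G.ftEdges, ∏ v ∈ G.bivalent c, w v =
      ∏ v ∈ (G.core.image G.root).filter (fun v => G.coreVal v = 2), w v := by
  have : (G.core.image G.root).filter (fun v => G.coreVal v = 2) =
      G.ftEdges.biUnion G.bivalent := by
    rw [← biUnion_ftEdges_image, Finset.filter_biUnion]
    rfl
  rw [this, Finset.prod_biUnion]
  intro c hc c' hc' hne
  rw [Function.onFun, Finset.disjoint_left]
  intro v hv hv'
  obtain ⟨hv1, hv2⟩ := Finset.mem_filter.1 hv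
  obtain ⟨x, hx, rfl⟩ := Finset.mem_image.1 hv1
  obtain ⟨y, hy, hyx⟩ := Finset.mem_image.1 (Finset.mem_filter.1 hv').1
  have : y ∈ c := mem_of_merges hc hx ⟨subset_core_of_mem_ftEdges hc hx,
    subset_core_of_mem_ftEdges hc' hy, Or.inr ⟨hyx, hv2⟩⟩
  exact hne ((eq_ftEdgeOf hc this).trans (eq_ftEdgeOf hc' hy).symm)

end DiscreteGraph

/-! ### Local divisibility at a vertex and the order of the deck group -/

namespace AdmissibleCover

open DiscreteGraph

variable {F K : Type*} [Fintype F] [DecidableEq F] [Fintype K] [DecidableEq K]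
  {G : DiscreteGraph F} {H : DiscreteGraph K} (π : AdmissibleCover G H)

theorem map_mem_vertices {v : F} (hv : v ∈ G.vertices) : π.toFun v ∈ H.vertices := by
  rw [mem_vertices, ← π.map_root, mem_vertices.1 hv]

theorem map_mem_star {v x : F} (hv : v ∈ G.vertices) (hx : x ∈ G.star v) :
    π.toFun x ∈ H.star (π.toFun v) := by
  obtain ⟨h1, h2⟩ := mem_star.1 hx
  refine mem_star.2 ⟨by rw [← π.map_root, h1], fun h => h2 ?_⟩
  have := mem_vertices.1 (π.nonContracting x (h ▸ π.map_mem_vertices hv))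
  rw [← this, h1]

theorem edgeDeg_edgeOf (x : F) : π.edgeDeg (G.edgeOf x) = π.deg x := by
  unfold edgeDeg edgeOf
  rw [Finset.sup_insert, Finset.sup_singleton, π.deg_inv, max_self]

theorem edgeDeg_pos {e : Finset F} (he : e ∈ G.edges) : 0 < π.edgeDeg e := by
  obtain ⟨x, -, rfl⟩ := mem_edges.1 he
  rw [edgeDeg_edgeOf]
  exact π.deg_pos x

theorem val_eq {v : F} (hv : v ∈ G.vertices) (h3 : H.val (π.toFun v) = 3) :
    G.val v = π.deg v + 2 := by
  have := π.riemannHurwitz v hv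
  rw [h3] at this
  push_cast at this
  omega

/-- The number of tuples of permutations in the definition of the local Hurwitz number. -/
noncomputable def hurwitzCount (v : F) : ℕ :=
  Nat.card {σ : Fin ((H.star (π.toFun v)).toList.map (π.localPartition v)).length →
      Equiv.Perm (Fin (π.deg v)) //
    IsHurwitzTuple ((H.star (π.toFun v)).toList.map (π.localPartition v)).get σ}

theorem localHurwitz_eq (v : F) :
    π.localHurwitz v = (π.hurwitzCount v : ℚ) / (π.deg v).factorial := rfl

/-- This is `factorial_mul_card_dvd` for the star of `v`, with flags indexed by the position of
their image in the list of branch points. Over a trivalent vertex the Riemann–Hurwitz condition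
reads `val = deg + 2`, the genus zero count required by the second alternative. -/
theorem factorial_mul_card_dvd_hurwitzCount {v : F} (hv : v ∈ G.vertices)
    (P : Subgroup (Equiv.Perm (G.star v))) (hP : ∀ p ∈ P, ∀ x, π.toFun (p x) = π.toFun x)
    (hd : ∀ p ∈ P, ∀ x, π.deg (p x) = π.deg x) (w : ℕ)
    (hw : (∀ e, (∀ x : G.star v, (∀ p ∈ P, p x = x) → e ∣ π.deg x) → e ∣ w) ∨
      (H.val (π.toFun v) = 3 ∧
        ∃ T : Finset (G.star v), 3 ≤ T.card ∧ ∀ x ∈ T, ∀ p ∈ P, p x = x)) :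
    (π.deg v).factorial * Nat.card P ∣ w * (π.hurwitzCount v * π.combFactor v) := by
  set L := (H.star (π.toFun v)).toList with hL
  have hmem : ∀ x : G.star v, π.toFun x ∈ L := fun x =>
    Finset.mem_toList.2 (π.map_mem_star hv x.2)
  let κ : G.star v → Fin (L.map (π.localPartition v)).length := fun x =>
    ⟨L.idxOf (π.toFun x), by rw [List.length_map]; exact List.idxOf_lt_length_of_mem (hmem x)⟩
  have hκ : ∀ x i, κ x = i ↔ π.toFun x = L[i.1]'(by simpa using i.2) := by
    intro x i
    constructor
    · rintro rfl
      exact (List.getElem_idxOf _).symm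
    · intro h
      apply Fin.ext
      change L.idxOf (π.toFun x) = i.1
      rw [h]
      exact (Finset.nodup_toList _).idxOf_getElem _ _
  have hparts : partsOver κ (fun x => π.deg x) = (L.map (π.localPartition v)).get := by
    funext i
    rw [List.get_eq_getElem, List.getElem_map]
    unfold partsOver localPartition
    have : (G.star v).filter (fun x => π.toFun x = L[i.1]'(by simpa using i.2)) =
        (Finset.univ.filter fun x => κ x = i).map (Function.Embedding.subtype _) := by
      ext x
      simp only [Finset.mem_filter, Finset.mem_map, Finset.mem_univ, true_and, hκ,
        Function.Embedding.subtype_apply, Subtype.exists, exists_and_left, exists_prop,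
        and_comm]
      simp
    rw [this, Finset.map_val, Multiset.map_map]
    rfl
  have hcomb : π.combFactor v = ∏ i, ∏ w ∈ (partsOver κ (fun x => π.deg x) i).toFinset,
      ((partsOver κ (fun x => π.deg x) i).count w).factorial := by
    rw [hparts]
    unfold combFactor
    simp only [List.get_eq_getElem]
    rw [Fin.prod_univ_fun_getElem (L.map (π.localPartition v))
      (fun m => ∏ w ∈ m.toFinset, (m.count w).factorial), List.map_map, hL,
      ← Finset.prod_map_toList]
    rfl
  have := factorial_mul_card_dvd (D := π.deg v) κ (fun x => π.deg x) P ?_ hd w ?_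
  · rw [hcomb]
    unfold hurwitzCount
    rwa [hparts] at this ⊢
  · intro p hp x
    exact Fin.ext (by simp only [κ, hP p hp x])
  · refine hw.imp id fun ⟨h3, hT⟩ => ⟨?_, ?_, hT⟩
    · rw [List.length_map, hL, Finset.length_toList]
      exact h3
    · rw [Fintype.card_coe]
      exact π.val_eq hv h3

/-! #### The group of deck transformations fixing the core -/

/-- The automorphisms of the source over the target that fix the core and the stars of `T`. -/
def deckGroup (T : Finset F) : Subgroup (Equiv.Perm F) where
  carrier := {φ | (∀ x, φ (G.root x) = G.root (φ x)) ∧ (∀ x, φ (G.inv x) = G.inv (φ x)) ∧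
    (∀ x, π.toFun (φ x) = π.toFun x) ∧ (∀ x, π.deg (φ x) = π.deg x) ∧
    (∀ x ∈ G.core, φ x = x) ∧ ∀ v ∈ T, ∀ x ∈ G.star v, φ x = x}
  mul_mem' := by
    rintro φ ψ ⟨h1, h2, h3, h4, h5, h6⟩ ⟨k1, k2, k3, k4, k5, k6⟩
    refine ⟨fun x => ?_, fun x => ?_, fun x => ?_, fun x => ?_, fun x hx => ?_, fun v hv x hx => ?_⟩
    · simp only [Equiv.Perm.mul_apply, k1, h1]
    · simp only [Equiv.Perm.mul_apply, k2, h2]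
    · simp only [Equiv.Perm.mul_apply, k3, h3]
    · simp only [Equiv.Perm.mul_apply, k4, h4]
    · simp only [Equiv.Perm.mul_apply, k5 x hx, h5 x hx]
    · simp only [Equiv.Perm.mul_apply, k6 v hv x hx, h6 v hv x hx]
  one_mem' := ⟨fun _ => rfl, fun _ => rfl, fun _ => rfl, fun _ => rfl, fun _ _ => rfl,
    fun _ _ _ _ => rfl⟩
  inv_mem' := by
    rintro φ ⟨h1, h2, h3, h4, h5, h6⟩
    have hinv : ∀ x, φ (φ⁻¹ x) = x := φ.apply_symm_apply
    refine ⟨fun x => ?_, fun x => ?_, fun x => ?_, fun x => ?_, fun x hx => ?_, fun v hv x hx => ?_⟩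
    · rw [Equiv.Perm.inv_eq_iff_eq, h1, hinv]
    · rw [Equiv.Perm.inv_eq_iff_eq, h2, hinv]
    · rw [← h3, hinv]
    · rw [← h4, hinv]
    · rw [Equiv.Perm.inv_eq_iff_eq, h5 x hx]
    · rw [Equiv.Perm.inv_eq_iff_eq, h6 v hv x hx]

variable {π}

theorem star_iff_of_fixed {T : Finset F} {v : F} (hfix : ∀ φ ∈ π.deckGroup T, φ v = v)
    {φ : Equiv.Perm F} (hφ : φ ∈ π.deckGroup T) (x : F) : φ x ∈ G.star v ↔ x ∈ G.star v := by
  rw [mem_star, mem_star, ← hφ.1]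
  have hv := hfix φ hφ
  constructor
  · rintro ⟨h1, h2⟩
    exact ⟨φ.injective (h1.trans hv.symm), fun h => h2 (by rw [h, hv])⟩
  · rintro ⟨h1, h2⟩
    exact ⟨by rw [h1, hv], fun h => h2 (φ.injective (h.trans hv.symm))⟩

/-- The action of deck transformations on the star of a fixed vertex. -/
def starHom {T : Finset F} {v : F} (hfix : ∀ φ ∈ π.deckGroup T, φ v = v) :
    π.deckGroup T →* Equiv.Perm (G.star v) where
  toFun φ := φ.1.subtypePerm (star_iff_of_fixed hfix φ.2)
  map_one' := rfl
  map_mul' _ _ := rfl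

/-- One step of a filtration: restricting to the star of the fixed vertex `v` has kernel `deckGroup
(insert v T)`, and the image is a group of flag permutations to which the local divisibility
applies. -/
theorem card_deckGroup_dvd {T : Finset F} {v : F} (hv : v ∈ G.vertices)
    (hfix : ∀ φ ∈ π.deckGroup T, φ v = v) (w : ℕ)
    (hw : (∀ e, (∀ x ∈ G.star v, (∀ φ ∈ π.deckGroup T, φ x = x) → e ∣ π.deg x) → e ∣ w) ∨
      (H.val (π.toFun v) = 3 ∧
        ∃ S ⊆ G.star v, 3 ≤ S.card ∧ ∀ x ∈ S, ∀ φ ∈ π.deckGroup T, φ x = x)) :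
    Nat.card (π.deckGroup T) * (π.deg v).factorial ∣
      w * (π.hurwitzCount v * π.combFactor v) * Nat.card (π.deckGroup (insert v T)) := by
  have hker : Nat.card (starHom hfix).ker = Nat.card (π.deckGroup (insert v T)) := by
    refine Nat.card_congr
      { toFun := fun φ => ⟨φ.1.1, φ.1.2.1, φ.1.2.2.1, φ.1.2.2.2.1, φ.1.2.2.2.2.1,
          φ.1.2.2.2.2.2.1, fun u hu x hx => ?_⟩
        invFun := fun φ => ⟨⟨φ.1, φ.2.1, φ.2.2.1, φ.2.2.2.1, φ.2.2.2.2.1, φ.2.2.2.2.2.1,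
          fun u hu => φ.2.2.2.2.2.2 u (Finset.mem_insert_of_mem hu)⟩, ?_⟩
        left_inv := fun φ => rfl
        right_inv := fun φ => rfl }
    · rcases Finset.mem_insert.1 hu with rfl | hu
      · exact congrArg Subtype.val (Equiv.congr_fun (MonoidHom.mem_ker.1 φ.2) ⟨x, hx⟩)
      · exact φ.1.2.2.2.2.2.2 u hu x hx
    · rw [MonoidHom.mem_ker]
      ext x
      exact φ.2.2.2.2.2.2 v (Finset.mem_insert_self _ _) x x.2
  have hcard : Nat.card (π.deckGroup T) =
      Nat.card (starHom hfix).range * Nat.card (starHom hfix).ker := by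
    rw [Subgroup.card_eq_card_quotient_mul_card_subgroup (starHom hfix).ker,
      Nat.card_congr (QuotientGroup.quotientKerEquivRange (starHom hfix)).toEquiv]
  have hrange : ∀ x : G.star v, (∀ φ ∈ π.deckGroup T, φ x = x) →
      ∀ p ∈ (starHom hfix).range, p x = x := by
    rintro x hx _ ⟨φ, rfl⟩
    exact Subtype.ext (hx φ.1 φ.2)
  have hrange' : ∀ x : G.star v, (∀ p ∈ (starHom hfix).range, p x = x) →
      ∀ φ ∈ π.deckGroup T, φ x = x := fun x hx φ hφ =>
    congrArg Subtype.val (hx _ ⟨⟨φ, hφ⟩, rfl⟩)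
  have := π.factorial_mul_card_dvd_hurwitzCount hv (starHom hfix).range ?_ ?_ w ?_
  · rw [hcard, hker, mul_comm, ← mul_assoc]
    exact mul_dvd_mul_right this _
  · rintro _ ⟨φ, rfl⟩ x
    exact φ.2.2.2.1 x
  · rintro _ ⟨φ, rfl⟩ x
    exact φ.2.2.2.2.1 x
  · refine hw.imp (fun h e he => h e fun x hx hφ => he ⟨x, hx⟩ (hrange ⟨x, hx⟩ hφ)) ?_
    rintro ⟨h3, S, hS, hS3, hSφ⟩
    refine ⟨h3, S.subtype (· ∈ G.star v), ?_, fun x hx => hrange x ?_⟩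
    · rwa [Finset.card_subtype, Finset.filter_true_of_mem hS]
    · exact hSφ x (Finset.mem_subtype.1 hx)

variable (π) in
/-- The contribution of a vertex of the core to the order of the group of deck transformations. -/
noncomputable def coreWeight (v : F) : ℕ :=
  if G.coreVal v = 2 then (G.core.filter fun x => G.root x = v).gcd π.deg else 1

theorem coreWeight_dvd {x : F} (hx : x ∈ G.core) (h2 : G.coreVal (G.root x) = 2) :
    π.coreWeight (G.root x) ∣ π.edgeDeg (G.edgeOf x) := by
  rw [coreWeight, if_pos h2, edgeDeg_edgeOf]
  exact Finset.gcd_dvd (by simp [hx])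

theorem core_subset_star {x : F} (hx : x ∈ G.core) : x ∈ G.star (G.root x) :=
  mem_star_root (inv_ne_of_mem_core hx)

/-- The core vertices are treated one at a time. Each has at least two flags fixed by the deck
group; with exactly two, the gcd of their weights is an admissible factor, and with three or more,
rigidity allows the factor `1`. -/
theorem card_deckGroup_empty_dvd (h3 : ∀ A ∈ H.vertices, H.val A = 3) (T : Finset F)
    (hT : T ⊆ G.core.image G.root) :
    Nat.card (π.deckGroup ∅) * ∏ v ∈ T, (π.deg v).factorial ∣
      (∏ v ∈ T, π.coreWeight v * (π.hurwitzCount v * π.combFactor v)) *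
        Nat.card (π.deckGroup T) := by
  induction T using Finset.induction_on with
  | empty => simp
  | insert v T hvT ih =>
    have hTc : T ⊆ G.core.image G.root := (Finset.subset_insert _ _).trans hT
    obtain ⟨x, hx, rfl⟩ := Finset.mem_image.1 (hT (Finset.mem_insert_self v T))
    have hfixc : ∀ y ∈ G.core, ∀ φ ∈ π.deckGroup T, φ y = y := fun y hy φ hφ =>
      hφ.2.2.2.2.1 y hy
    have hstep := card_deckGroup_dvd (T := T) (root_mem_vertices x)
      (fun φ hφ => by rw [hφ.1, hfixc x hx φ hφ]) (π.coreWeight (G.root x)) (by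
        by_cases h2 : G.coreVal (G.root x) = 2
        · left
          intro e he
          rw [coreWeight, if_pos h2]
          refine Finset.dvd_gcd fun y hy => ?_
          obtain ⟨hy1, hy2⟩ := Finset.mem_filter.1 hy
          exact he y (hy2 ▸ core_subset_star hy1) (hfixc y hy1)
        · right
          refine ⟨h3 _ (π.map_mem_vertices (root_mem_vertices x)),
            G.core.filter fun y => G.root y = G.root x, fun y hy => ?_, ?_, fun y hy => ?_⟩
          · obtain ⟨hy1, hy2⟩ := Finset.mem_filter.1 hy
            exact hy2 ▸ core_subset_star hy1
          · have := two_le_coreVal hx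
            unfold coreVal at this h2
            omega
          · exact hfixc y (Finset.mem_filter.1 hy).1)
    rw [Finset.prod_insert hvT, Finset.prod_insert hvT]
    calc Nat.card (π.deckGroup ∅) *
          ((π.deg (G.root x)).factorial * ∏ v ∈ T, (π.deg v).factorial)
        = (Nat.card (π.deckGroup ∅) * ∏ v ∈ T, (π.deg v).factorial) *
          (π.deg (G.root x)).factorial := by ring
      _ ∣ ((∏ v ∈ T, π.coreWeight v * (π.hurwitzCount v * π.combFactor v)) *
          Nat.card (π.deckGroup T)) * (π.deg (G.root x)).factorial :=
        mul_dvd_mul_right (ih hTc) _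
      _ = (∏ v ∈ T, π.coreWeight v * (π.hurwitzCount v * π.combFactor v)) *
          (Nat.card (π.deckGroup T) * (π.deg (G.root x)).factorial) := by ring
      _ ∣ _ := mul_dvd_mul_left _ hstep
      _ = _ := by ring

theorem card_deckGroup_vertices (h3 : ∀ A ∈ H.vertices, H.val A = 3) :
    Nat.card (π.deckGroup G.vertices) = 1 := by
  rw [Nat.card_eq_one_iff_unique]
  refine ⟨⟨fun φ ψ => ?_⟩, ⟨1⟩⟩
  have key : ∀ φ ∈ π.deckGroup G.vertices, ∀ x, φ x = x := by
    intro φ hφ x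
    by_cases hx : x ∈ G.vertices
    · have hval := π.val_eq hx (h3 _ (π.map_mem_vertices hx))
      obtain ⟨y, hy⟩ : (G.star x).Nonempty := by
        rw [← Finset.card_pos]
        unfold val at hval
        omega
      rw [← (mem_star.1 hy).1, hφ.1, hφ.2.2.2.2.2 x hx y hy]
    · refine hφ.2.2.2.2.2 (G.root x) (root_mem_vertices x) x (mem_star.2 ⟨rfl, fun h => hx ?_⟩)
      exact mem_vertices.2 h.symm
  exact Subtype.ext (Equiv.ext fun x => (key φ.1 φ.2 x).trans (key ψ.1 ψ.2 x).symm)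

/-- The set `T` is enlarged across a boundary edge. The half-edge of this edge at the new vertex is
fixed because its opposite half lies in a fixed star, so its weight is an admissible factor.
Afterwards the edge lies inside the enlarged set, so no edge is used twice. -/
theorem card_deckGroup_dvd_of_core_subset (h3 : ∀ A ∈ H.vertices, H.val A = 3)
    (hG : G.IsConnected) (T : Finset F) (hT : T ⊆ G.vertices) (hne : T.Nonempty) :
    Nat.card (π.deckGroup T) * ∏ v ∈ G.vertices \ T, (π.deg v).factorial ∣
      (∏ v ∈ G.vertices \ T, π.hurwitzCount v * π.combFactor v) *
        ∏ e ∈ G.edges.filter (fun e => ¬ ∀ x ∈ e, G.root x ∈ T), π.edgeDeg e := by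
  induction hn : (G.vertices \ T).card using Nat.strong_induction_on generalizing T with
  | _ n ih =>
    subst hn
    by_cases hTV : G.vertices ⊆ T
    · rw [Finset.sdiff_eq_empty_iff_subset.2 hTV, hT.antisymm hTV, card_deckGroup_vertices h3]
      simp
    · obtain ⟨u, hu, huT⟩ := Finset.not_subset.1 hTV
      obtain ⟨t, ht⟩ := hne
      obtain ⟨x, hx, hxT, hixT⟩ := hG.exists_crossing ht (hT ht) hu huT
      set v := G.root x with hv
      have hvV : v ∈ G.vertices := root_mem_vertices x
      have hfix : ∀ φ ∈ π.deckGroup T, φ x = x := by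
        intro φ hφ
        have h1 := hφ.2.2.2.2.2 _ hixT (G.inv x) (mem_star_root (inv_inv_ne hx))
        rw [hφ.2.1] at h1
        rw [← G.inv_inv (φ x), h1, G.inv_inv]
      have hstep := card_deckGroup_dvd (T := T) hvV
        (fun φ hφ => by rw [hv, hφ.1, hfix φ hφ]) (π.deg x)
        (Or.inl fun e he => he x (mem_star_root hx) hfix)
      have hsd : G.vertices \ T = insert v (G.vertices \ insert v T) := by
        ext y
        simp only [Finset.mem_sdiff, Finset.mem_insert, not_or]
        constructor
        · rintro ⟨h1, h2⟩
          by_cases hy : y = v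
          · exact Or.inl hy
          · exact Or.inr ⟨h1, hy, h2⟩
        · rintro (rfl | ⟨h1, -, h2⟩)
          · exact ⟨hvV, hxT⟩
          · exact ⟨h1, h2⟩
      have hvn : v ∉ G.vertices \ insert v T := by simp
      have hrec := ih (G.vertices \ insert v T).card
        (by rw [hsd, Finset.card_insert_of_notMem hvn]; exact Nat.lt_succ_self _) (insert v T)
        (Finset.insert_subset hvV hT) (Finset.insert_nonempty _ _) rfl
      have hedge : π.deg x * ∏ e ∈ G.edges.filter (fun e => ¬ ∀ x ∈ e, G.root x ∈ insert v T),
          π.edgeDeg e ∣ ∏ e ∈ G.edges.filter (fun e => ¬ ∀ x ∈ e, G.root x ∈ T),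
          π.edgeDeg e := by
        rw [← π.edgeDeg_edgeOf x, ← Finset.prod_insert]
        · refine Finset.prod_dvd_prod_of_subset _ _ _ (Finset.insert_subset ?_ ?_)
          · refine Finset.mem_filter.2 ⟨edgeOf_mem_edges hx, fun h => hxT ?_⟩
            exact h x (mem_edgeOf.2 (Or.inl rfl))
          · intro e he
            obtain ⟨h1, h2⟩ := Finset.mem_filter.1 he
            exact Finset.mem_filter.2 ⟨h1, fun h => h2 fun y hy =>
              Finset.mem_insert_of_mem (h y hy)⟩
        · intro he
          refine (Finset.mem_filter.1 he).2 fun y hy => ?_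
          rcases mem_edgeOf.1 hy with rfl | rfl
          · exact Finset.mem_insert_self _ _
          · exact Finset.mem_insert_of_mem hixT
      rw [hsd, Finset.prod_insert hvn, Finset.prod_insert hvn]
      set A := ∏ v ∈ G.vertices \ insert v T, (π.deg v).factorial
      set B := ∏ v ∈ G.vertices \ insert v T, π.hurwitzCount v * π.combFactor v
      set E := ∏ e ∈ G.edges.filter (fun e => ¬ ∀ x ∈ e, G.root x ∈ insert v T), π.edgeDeg e
      calc Nat.card (π.deckGroup T) * ((π.deg v).factorial * A)
          = (Nat.card (π.deckGroup T) * (π.deg v).factorial) * A := by ring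
        _ ∣ (π.deg x * (π.hurwitzCount v * π.combFactor v) *
            Nat.card (π.deckGroup (insert v T))) * A := mul_dvd_mul_right hstep _
        _ = π.deg x * (π.hurwitzCount v * π.combFactor v) *
            (Nat.card (π.deckGroup (insert v T)) * A) := by ring
        _ ∣ π.deg x * (π.hurwitzCount v * π.combFactor v) * (B * E) := mul_dvd_mul_left _ hrec
        _ = (π.hurwitzCount v * π.combFactor v * B) * (π.deg x * E) := by ring
        _ ∣ _ := mul_dvd_mul_left _ hedge

/-- The order of the group of deck transformations fixing the core divides the product of the
local contributions. -/
theorem card_deckGroup_mul_prod_dvd (h3 : ∀ A ∈ H.vertices, H.val A = 3)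
    (hG : G.IsConnected) (hcore : G.core.Nonempty) :
    Nat.card (π.deckGroup ∅) * ∏ v ∈ G.vertices, (π.deg v).factorial ∣
      (∏ v ∈ G.vertices, π.hurwitzCount v * π.combFactor v) *
        (∏ v ∈ (G.core.image G.root).filter (fun v => G.coreVal v = 2), π.coreWeight v) *
        ∏ e ∈ G.edges \ G.core.image G.edgeOf, π.edgeDeg e := by
  set T := G.core.image G.root with hTdef
  have hT : T ⊆ G.vertices := by
    intro v hv
    obtain ⟨x, -, rfl⟩ := Finset.mem_image.1 hv
    exact root_mem_vertices x
  have h1 := card_deckGroup_empty_dvd (π := π) h3 T subset_rfl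
  have h2 := card_deckGroup_dvd_of_core_subset (π := π) h3 hG T hT (hcore.image _)
  have hedge : ∏ e ∈ G.edges.filter (fun e => ¬ ∀ x ∈ e, G.root x ∈ T), π.edgeDeg e ∣
      ∏ e ∈ G.edges \ G.core.image G.edgeOf, π.edgeDeg e := by
    refine Finset.prod_dvd_prod_of_subset _ _ _ fun e he => ?_
    obtain ⟨he1, he2⟩ := Finset.mem_filter.1 he
    refine Finset.mem_sdiff.2 ⟨he1, fun hc => he2 ?_⟩
    obtain ⟨x, hx, rfl⟩ := Finset.mem_image.1 hc
    intro y hy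
    rcases mem_edgeOf.1 hy with rfl | rfl
    · exact Finset.mem_image_of_mem _ hx
    · exact Finset.mem_image_of_mem _ (inv_mem_core hx)
  have hw : ∏ v ∈ T, π.coreWeight v = ∏ v ∈ T.filter (fun v => G.coreVal v = 2),
      π.coreWeight v := by
    rw [Finset.prod_filter]
    refine Finset.prod_congr rfl fun v _ => ?_
    by_cases h : G.coreVal v = 2
    · rw [if_pos h]
    · rw [if_neg h, coreWeight, if_neg h]
  rw [← hw, ← Finset.prod_sdiff hT, ← Finset.prod_sdiff hT]
  rw [Finset.prod_mul_distrib] at h1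
  set A := ∏ v ∈ G.vertices \ T, (π.deg v).factorial
  set A' := ∏ v ∈ T, (π.deg v).factorial
  set B := ∏ v ∈ G.vertices \ T, π.hurwitzCount v * π.combFactor v
  set B' := ∏ v ∈ T, π.hurwitzCount v * π.combFactor v
  calc Nat.card (π.deckGroup ∅) * (A * A') = (Nat.card (π.deckGroup ∅) * A') * A := by ring
    _ ∣ ((∏ v ∈ T, π.coreWeight v) * B' * Nat.card (π.deckGroup T)) * A :=
      mul_dvd_mul_right h1 _
    _ = ((∏ v ∈ T, π.coreWeight v) * B') * (Nat.card (π.deckGroup T) * A) := by ring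
    _ ∣ ((∏ v ∈ T, π.coreWeight v) * B') * (B * _) :=
      mul_dvd_mul_left _ (h2.trans (mul_dvd_mul_left _ hedge))
    _ = _ := by ring

end AdmissibleCover

/-! ### Extracting factors from the determinant -/

namespace AdmissibleCover

open DiscreteGraph

variable {F K : Type*} [Fintype F] [DecidableEq F] [Fintype K] [DecidableEq K]
  {G : DiscreteGraph F} {H : DiscreteGraph K} (π : AdmissibleCover G H)

/-- The edges of `G` over `h` that are merged into the edge `c` of the stabilization. -/
def mergedFiber (c : Finset F) (h : Finset K) : Finset (Finset F) :=
  (c.image G.edgeOf).filter fun e => e.image π.toFun = h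

/-- The product of the weights of the edges on `c` different from `e`, divided by the
contributions of the bivalent vertices on `c`. -/
noncomputable def chainQuotient (c : Finset F) (e : Finset F) : ℕ :=
  (∏ e' ∈ (c.image G.edgeOf).erase e, π.edgeDeg e') / ∏ v ∈ G.bivalent c, π.coreWeight v

theorem chainQuotient_mul {g : ℕ} (hg : 2 ≤ g) (hG : IsSpine G g G.core) {c : Finset F}
    (hc : c ∈ G.ftEdges) {e : Finset F} (he : e ∈ c.image G.edgeOf) :
    π.chainQuotient c e * ∏ v ∈ G.bivalent c, π.coreWeight v =
      ∏ e' ∈ (c.image G.edgeOf).erase e, π.edgeDeg e' := by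
  obtain ⟨x, hx, rfl⟩ := Finset.mem_image.1 he
  exact Nat.div_mul_cancel (prod_bivalent_dvd hg hG hc hx π.coreWeight π.edgeDeg
    fun x hx h2 => coreWeight_dvd hx h2)

theorem ftEdgeMatrix_apply (c : G.ftEdges) (h : H.edges) :
    π.ftEdgeMatrix c h =
      π.edgeLcm h.1 * ∑ e ∈ π.mergedFiber c.1 h.1, (1 : ℚ) / π.edgeDeg e := by
  unfold ftEdgeMatrix ftMatrix edgeMatrix mergedFiber
  rw [Matrix.mul_apply]
  simp only [Matrix.of_apply]
  rw [Finset.sum_coe_sort G.edges (fun e => (if e ⊆ c.1 then (1 : ℚ) else 0) *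
    (if e.image π.toFun = h.1 then (π.edgeLcm h.1 : ℚ) / π.edgeDeg e else 0)),
    Finset.sum_filter, Finset.mul_sum, ← sum_edges_subset c.2, Finset.sum_filter]
  refine Finset.sum_congr rfl fun e _ => ?_
  split_ifs <;> simp [div_eq_mul_inv]

/-- Multiplying by all weights on `c` cancels the denominator of each summand and leaves the product
of the other weights. That product is the chain quotient times the contributions of the bivalent
vertices. -/
theorem prod_mul_ftEdgeMatrix_apply {g : ℕ} (hg : 2 ≤ g) (hG : IsSpine G g G.core)
    (c : G.ftEdges) (h : H.edges) :
    ((∏ e ∈ c.1.image G.edgeOf, π.edgeDeg e : ℕ) : ℚ) * π.ftEdgeMatrix c h =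
      ((∏ v ∈ G.bivalent c.1, π.coreWeight v : ℕ) : ℚ) *
        (π.edgeLcm h.1 * ((∑ e ∈ π.mergedFiber c.1 h.1, π.chainQuotient c.1 e : ℕ) : ℚ)) := by
  have key : ∀ e ∈ π.mergedFiber c.1 h.1,
      ((∏ e ∈ c.1.image G.edgeOf, π.edgeDeg e : ℕ) : ℚ) * (1 / π.edgeDeg e) =
        ((∏ v ∈ G.bivalent c.1, π.coreWeight v : ℕ) : ℚ) * (π.chainQuotient c.1 e : ℕ) := by
    intro e he
    have he' := (Finset.mem_filter.1 he).1
    have hpos : (π.edgeDeg e : ℚ) ≠ 0 := by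
      obtain ⟨x, -, rfl⟩ := Finset.mem_image.1 he'
      rw [edgeDeg_edgeOf]
      exact_mod_cast (π.deg_pos x).ne'
    rw [← Finset.mul_prod_erase _ _ he', ← π.chainQuotient_mul hg hG c.2 he']
    push_cast
    field_simp
  rw [ftEdgeMatrix_apply, mul_left_comm, Finset.mul_sum, Finset.sum_congr rfl key,
    ← Finset.mul_sum]
  push_cast
  ring

/-- The determinant of the cover, up to the weights of the edges of the core, is an integral
multiple of the contributions of the bivalent vertices and of common factors of the columns. -/
theorem exists_absDet_mul {g : ℕ} (hg : 2 ≤ g) (hG : IsSpine G g G.core) (t : Finset K → ℕ)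
    (ht : ∀ c ∈ G.ftEdges, ∀ h ∈ H.edges, t h ∣ ∑ e ∈ π.mergedFiber c h, π.chainQuotient c e) :
    ∃ N : ℕ, ((∏ e ∈ G.core.image G.edgeOf, π.edgeDeg e : ℕ) : ℚ) * absDet π.ftEdgeMatrix =
      N * ((∏ v ∈ (G.core.image G.root).filter (fun v => G.coreVal v = 2),
        π.coreWeight v : ℕ) : ℚ) * ((∏ h ∈ H.edges, t h : ℕ) : ℚ) *
        ((∏ h ∈ H.edges, π.edgeLcm h : ℕ) : ℚ) := by
  by_cases hne : Nonempty (G.ftEdges ≃ H.edges)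
  · obtain ⟨ε⟩ := hne
    choose! q hq using ht
    let N : Matrix G.ftEdges G.ftEdges ℤ := Matrix.of fun c c' => (q c.1 (ε c').1 : ℤ)
    let R : G.ftEdges → ℚ := fun c => ((∏ e ∈ c.1.image G.edgeOf, π.edgeDeg e : ℕ) : ℚ)
    let w : G.ftEdges → ℚ := fun c => ((∏ v ∈ G.bivalent c.1, π.coreWeight v : ℕ) : ℚ)
    let l : G.ftEdges → ℚ := fun c' => (π.edgeLcm (ε c').1 : ℚ) * (t (ε c').1 : ℚ)
    -- After the rows are scaled by `R`, the factors `w` come out of the rows and the factors `l`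
    -- out of the columns; the integral matrix `N` remains.
    have hM : (Matrix.of fun c c' => R c * (π.ftEdgeMatrix.submatrix id ε) c c') =
        Matrix.of fun c c' => w c * (Matrix.of fun c c' => l c' * (N.map (Int.castRingHom ℚ)) c c')
          c c' := by
      ext c c'
      simp only [Matrix.of_apply, Matrix.submatrix_apply, id, Matrix.map_apply, R, w, l, N]
      rw [prod_mul_ftEdgeMatrix_apply π hg hG, hq c.1 c.2 (ε c').1 (ε c').2]
      push_cast
      simp only [Int.coe_castRingHom, Int.cast_natCast]
      ring
    have hdet := congrArg Matrix.det hM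
    rw [Matrix.det_mul_column, Matrix.det_mul_column, Matrix.det_mul_row, ← RingHom.mapMatrix_apply,
      ← RingHom.map_det] at hdet
    have hR : ∏ c, R c = ((∏ e ∈ G.core.image G.edgeOf, π.edgeDeg e : ℕ) : ℚ) := by
      rw [← prod_ftEdges_edges, Nat.cast_prod]
      exact Finset.prod_coe_sort G.ftEdges
        (fun c => ((∏ e ∈ c.image G.edgeOf, π.edgeDeg e : ℕ) : ℚ))
    have hw : ∏ c, w c = ((∏ v ∈ (G.core.image G.root).filter (fun v => G.coreVal v = 2),
        π.coreWeight v : ℕ) : ℚ) := by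
      rw [← prod_ftEdges_bivalent, Nat.cast_prod]
      exact Finset.prod_coe_sort G.ftEdges
        (fun c => ((∏ v ∈ G.bivalent c, π.coreWeight v : ℕ) : ℚ))
    have hl : ∏ c, l c = ((∏ h ∈ H.edges, π.edgeLcm h : ℕ) : ℚ) *
        ((∏ h ∈ H.edges, t h : ℕ) : ℚ) := by
      rw [Nat.cast_prod, Nat.cast_prod, ← Finset.prod_mul_distrib,
        Equiv.prod_comp ε (fun h : H.edges => (π.edgeLcm h.1 : ℚ) * (t h.1 : ℚ))]
      exact Finset.prod_coe_sort H.edges (fun h => (π.edgeLcm h : ℚ) * (t h : ℚ))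
    rw [hR, hw, hl] at hdet
    refine ⟨N.det.natAbs, ?_⟩
    rw [absDet_eq π.ftEdgeMatrix ε]
    have habs := congrArg abs hdet
    rw [abs_mul, abs_mul, abs_mul, abs_mul] at habs
    rw [Nat.abs_cast, Nat.abs_cast, Nat.abs_cast, Nat.abs_cast] at habs
    rw [habs, Nat.cast_natAbs, Int.cast_abs, Int.coe_castRingHom]
    ring
  · refine ⟨0, ?_⟩
    unfold absDet
    rw [dif_neg hne]
    simp

/-- If no core half-edge lay above `y`, the column of its edge would be zero. A core half-edge over
the opposite half is turned around by the involution. -/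
theorem exists_core_over {y : K} (hdet : absDet π.ftEdgeMatrix ≠ 0) (hy : H.inv y ≠ y) :
    ∃ x ∈ G.core, π.toFun x = y := by
  by_cases hne : Nonempty (G.ftEdges ≃ H.edges)
  · obtain ⟨ε⟩ := hne
    rw [absDet_eq π.ftEdgeMatrix ε, abs_ne_zero] at hdet
    by_contra! hcon
    refine hdet (Matrix.det_eq_zero_of_column_eq_zero (ε.symm ⟨_, edgeOf_mem_edges hy⟩) fun c => ?_)
    rw [Matrix.submatrix_apply, Equiv.apply_symm_apply, ftEdgeMatrix_apply]
    have : π.mergedFiber (id c).1 (H.edgeOf y) = ∅ := by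
      rw [Finset.eq_empty_iff_forall_notMem]
      intro e he
      obtain ⟨he1, he2⟩ := Finset.mem_filter.1 he
      obtain ⟨x, hx, rfl⟩ := Finset.mem_image.1 he1
      have hxc := subset_core_of_mem_ftEdges c.2 hx
      have hxy : π.toFun x ∈ H.edgeOf y := by
        rw [← he2]
        exact Finset.mem_image_of_mem _ (mem_edgeOf.2 (Or.inl rfl))
      rcases mem_edgeOf.1 hxy with h | h
      · exact hcon x hxc h
      · exact hcon (G.inv x) (inv_mem_core hxc) (by rw [π.map_inv, h, H.inv_inv])
    rw [this, Finset.sum_empty, mul_zero]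
  · unfold absDet at hdet
    rw [dif_neg hne] at hdet
    exact absurd rfl hdet

end AdmissibleCover

/-! ### Valencies and legs -/

namespace DiscreteGraph

variable {F : Type*} [Fintype F] [DecidableEq F] {G : DiscreteGraph F}

theorem sum_val : ∑ v ∈ G.vertices, G.val v = 2 * G.edges.card + G.legs.card := by
  have h1 := two_mul_card_image_edgeOf (G := G) (W := Finset.univ.filter fun x => G.inv x ≠ x)
    (fun x hx => by
      rw [Finset.mem_filter] at hx
      exact ⟨hx.2, Finset.mem_filter.2 ⟨Finset.mem_univ _, inv_inv_ne hx.2⟩⟩)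
  change 2 * G.edges.card = _ at h1
  rw [h1]
  have h2 : ∀ v ∈ G.vertices, G.val v =
      ((Finset.univ.filter fun x => x ∉ G.vertices).filter fun x => G.root x = v).card := by
    intro v hv
    unfold val
    congr 1
    ext x
    rw [mem_star, Finset.mem_filter, Finset.mem_filter, mem_vertices]
    constructor
    · rintro ⟨rfl, h⟩
      exact ⟨⟨Finset.mem_univ _, Ne.symm h⟩, rfl⟩
    · rintro ⟨⟨-, h⟩, rfl⟩
      exact ⟨rfl, Ne.symm h⟩
  rw [Finset.sum_congr rfl h2, ← Finset.card_eq_sum_card_fiberwise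
    (fun x _ => root_mem_vertices x), ← Finset.card_union_of_disjoint]
  · congr 1
    ext x
    simp only [Finset.mem_filter, Finset.mem_univ, true_and, Finset.mem_union, mem_legs]
    constructor
    · intro h
      by_cases hx : G.inv x = x
      · exact Or.inr ⟨h, hx⟩
      · exact Or.inl hx
    · rintro (h | h)
      · exact fun hv => h (inv_eq_of_mem_vertices hv)
      · exact h.1
  · rw [Finset.disjoint_left]
    intro x hx hx'
    exact (Finset.mem_filter.1 hx).2 (mem_legs.1 hx').2

theorem IsStableMarked.mark_mem_legs {L : Type*} {g : ℕ} {mark : L → F}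
    (h : G.IsStableMarked g mark) (l : L) : mark l ∈ G.legs :=
  (h.mark_range _).2 ⟨l, rfl⟩

theorem IsStableMarked.mark_mem_star {L : Type*} {g : ℕ} {mark : L → F}
    (h : G.IsStableMarked g mark) (l : L) : mark l ∈ G.star (G.root (mark l)) :=
  mem_star.2 ⟨rfl, fun hl => (mem_legs.1 (h.mark_mem_legs l)).1 (mem_vertices.2 hl.symm)⟩

theorem IsStableMarked.card_legs {L : Type*} [Fintype L] {g : ℕ} {mark : L → F}
    (h : G.IsStableMarked g mark) : G.legs.card = Fintype.card L := by
  have : G.legs = Finset.univ.image mark := by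
    ext x
    simp [h.mark_range]
  rw [this, Finset.card_image_of_injective _ h.mark_injective, Finset.card_univ]

end DiscreteGraph

/-! ### The ramification profile -/

theorem weierstrassProfile_of_ne {g : ℕ} {k : Fin (3 * g)} (hk : k.val ≠ 0) :
    weierstrassProfile g k = 2 :: List.replicate (g - 2) 1 := if_neg hk

theorem length_weierstrassProfile {g : ℕ} (hg : 2 ≤ g) {k : Fin (3 * g)} (hk : k.val ≠ 0) :
    (weierstrassProfile g k).length = g - 1 := by
  rw [weierstrassProfile_of_ne hk, List.length_cons, List.length_replicate]
  omega

theorem sum_weierstrassProfile {g : ℕ} (hg : 2 ≤ g) (k : Fin (3 * g)) :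
    (weierstrassProfile g k).sum = g := by
  by_cases hk : k.val = 0
  · simp [weierstrassProfile, hk]
  · rw [weierstrassProfile_of_ne hk, List.sum_cons, List.sum_replicate, smul_eq_mul]
    omega

theorem weierstrassProfile_get_le {g : ℕ} {k : Fin (3 * g)} (hk : k.val ≠ 0)
    (j : Fin (weierstrassProfile g k).length) :
    (weierstrassProfile g k).get j ≤ 1 + if j.val = 0 then 1 else 0 := by
  have h := weierstrassProfile_of_ne hk
  have key : ∀ (l : List ℕ) (hl : l = 2 :: List.replicate (g - 2) 1) (j : Fin l.length),
      l.get j ≤ 1 + if j.val = 0 then 1 else 0 := by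
    rintro _ rfl ⟨j, hj⟩
    rcases j with _ | j
    · simp
    · simp
  exact key _ h j

/-! ### Trivalence of the target and vertices with two simple legs -/

namespace ACObject

open DiscreteGraph

variable {F K : Type*} [Fintype F] [DecidableEq F] [Fintype K] [DecidableEq K] {g : ℕ}
  (π : ACObject F K g 0 g (weierstrassProfile g))

section Trivalent

variable {π}

theorem IsTopDimensional.card_vertices (hg : 2 ≤ g) (hπ : π.IsTopDimensional) :
    π.trgt.vertices.card = 3 * g - 2 := by
  have h1 := π.trgt_stable.genus
  unfold IsTopDimensional at hπ
  omega

/-- The valencies sum to `2(3g - 3) + 3g = 3(3g - 2)`, three times the number of vertices, so the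
lower bound three is attained everywhere. -/
theorem IsTopDimensional.val_eq_three (hg : 2 ≤ g) (hπ : π.IsTopDimensional) :
    ∀ A ∈ π.trgt.vertices, π.trgt.val A = 3 := by
  have h1 := hπ.card_vertices hg
  have h2 := π.trgt_stable.card_legs
  rw [Fintype.card_fin] at h2
  have h3 := sum_val (G := π.trgt)
  have h4 : ∑ A ∈ π.trgt.vertices, 3 = ∑ A ∈ π.trgt.vertices, π.trgt.val A := by
    rw [h3, h2, hπ, Finset.sum_const, h1, smul_eq_mul]
    omega
  exact fun A hA => ((Finset.sum_eq_sum_iff_of_le fun A hA => π.trgt_stable.valency A hA).1 h4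
    A hA).symm

theorem IsTopDimensional.edges_nonempty (hg : 2 ≤ g) (hπ : π.IsTopDimensional) :
    π.trgt.edges.Nonempty := by
  rw [← Finset.card_pos, hπ]
  omega

end Trivalent

/-- The flags over a leg of the target are the legs prescribed by the marking. -/
theorem exists_srcMark_eq (hg : 2 ≤ g) {x : F} {k : Fin (3 * g)}
    (hx : π.cover.toFun x = π.trgtMark k) : ∃ j, π.srcMark ⟨k, j⟩ = x := by
  set A := π.trgt.root (π.trgtMark k) with hA
  set Z := Finset.univ.filter fun x => π.cover.toFun x = π.trgtMark k with hZ
  have hleg := mem_legs.1 (π.trgt_stable.mark_mem_legs k)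
  -- Balancing at each vertex above the root of the leg converts the total degree `g` into the total
  -- weight over the leg.
  have hsum : ∑ x ∈ Z, π.cover.deg x = g := by
    refine Eq.trans ?_ (π.degree A (root_mem_vertices _))
    rw [← Finset.sum_fiberwise_of_maps_to
      (t := π.src.vertices.filter fun V => π.cover.toFun V = A) (g := π.src.root)]
    · refine Finset.sum_congr rfl fun V hV => ?_
      obtain ⟨hV1, hV2⟩ := Finset.mem_filter.1 hV
      rw [π.cover.balanced V hV1 (π.trgtMark k)
        (by rw [hV2]; exact π.trgt_stable.mark_mem_star k)]
      refine Finset.sum_congr ?_ fun _ _ => rfl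
      ext x
      simp only [hZ, Finset.mem_filter, Finset.mem_univ, true_and, mem_star]
      constructor
      · rintro ⟨h1, h2⟩
        refine ⟨⟨h2, ?_⟩, h1⟩
        rintro rfl
        exact hleg.1 (h1 ▸ π.cover.map_mem_vertices hV1)
      · rintro ⟨⟨h1, -⟩, h2⟩
        exact ⟨h2, h1⟩
    · intro x hx
      rw [hZ, Finset.mem_filter] at hx
      exact Finset.mem_filter.2 ⟨root_mem_vertices x, by rw [π.cover.map_root, hx.2]⟩
  have hinj : Function.Injective fun j => π.srcMark ⟨k, j⟩ := fun j j' h => by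
    have := π.src_stable.mark_injective h
    simpa using this
  have hsub : Finset.univ.image (fun j => π.srcMark ⟨k, j⟩) ⊆ Z := by
    intro y hy
    obtain ⟨j, -, rfl⟩ := Finset.mem_image.1 hy
    exact Finset.mem_filter.2 ⟨Finset.mem_univ _, π.map_leg k j⟩
  have hsum' : ∑ x ∈ Finset.univ.image (fun j => π.srcMark ⟨k, j⟩), π.cover.deg x = g := by
    rw [Finset.sum_image fun _ _ _ _ h => hinj h, Finset.sum_congr rfl fun j _ => π.deg_leg k j]
    simp only [List.get_eq_getElem]
    rw [Fin.sum_univ_getElem, sum_weierstrassProfile hg]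
  -- The marked legs already have total weight `g`, which leaves no room for another flag of
  -- positive weight.
  by_contra! hcon
  have hxZ : x ∈ Z \ Finset.univ.image (fun j => π.srcMark ⟨k, j⟩) := by
    refine Finset.mem_sdiff.2 ⟨Finset.mem_filter.2 ⟨Finset.mem_univ _, hx⟩, fun h => ?_⟩
    obtain ⟨j, -, hj⟩ := Finset.mem_image.1 h
    exact hcon j hj
  have h1 := Finset.sum_sdiff (f := π.cover.deg) hsub
  have h2 := Finset.single_le_sum (f := π.cover.deg) (fun _ _ => Nat.zero_le _) hxZ
  have h3 := π.cover.deg_pos x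
  omega

theorem map_ne_trgtMark (hg : 2 ≤ g) {x : F} (hx : π.src.inv x ≠ x) (k : Fin (3 * g)) :
    π.cover.toFun x ≠ π.trgtMark k := by
  intro h
  obtain ⟨j, rfl⟩ := π.exists_srcMark_eq hg h
  exact hx (mem_legs.1 (π.src_stable.mark_mem_legs _)).2

/-- Among the legs over a simple leg only the one in position `0` has weight two; all others have
weight one. -/
theorem deg_le_card_add_one (hg : 2 ≤ g) {V : F} (hV : V ∈ π.src.vertices) {k : Fin (3 * g)}
    (hk : k.val ≠ 0) (hVk : π.cover.toFun V = π.trgt.root (π.trgtMark k)) :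
    π.cover.deg V ≤
      ((π.src.star V).filter fun x => π.cover.toFun x = π.trgtMark k).card + 1 := by
  have hlen : 0 < (weierstrassProfile g k).length := by
    rw [length_weierstrassProfile hg hk]
    omega
  rw [π.cover.balanced V hV (π.trgtMark k) (by rw [hVk]; exact π.trgt_stable.mark_mem_star k)]
  set S := (π.src.star V).filter fun x => π.cover.toFun x = π.trgtMark k with hS
  have hle : ∀ x ∈ S, π.cover.deg x ≤ 1 + if x = π.srcMark ⟨k, ⟨0, hlen⟩⟩ then 1 else 0 := by
    intro x hx
    obtain ⟨j, rfl⟩ := π.exists_srcMark_eq hg (Finset.mem_filter.1 hx).2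
    rw [π.deg_leg]
    refine (weierstrassProfile_get_le hk j).trans ?_
    by_cases hj : j.val = 0
    · rw [if_pos hj, if_pos]
      congr
      exact Fin.ext hj
    · rw [if_neg hj]
      exact Nat.add_le_add_left (Nat.zero_le _) _
  refine (Finset.sum_le_sum hle).trans ?_
  rw [Finset.sum_add_distrib, Finset.sum_const, smul_eq_mul, mul_one, Finset.sum_ite_eq']
  split_ifs <;> omega

/-- The legs with simple ramification at the vertex `A`. -/
def simpleLegs (A : K) : Finset (SimpleIndex g) :=
  Finset.univ.filter fun k => π.trgt.root (π.trgtMark k.1) = A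

variable {π}

theorem mem_simpleLegs {A : K} {k : SimpleIndex g} :
    k ∈ π.simpleLegs A ↔ π.trgt.root (π.trgtMark k.1) = A := by
  simp [simpleLegs]

theorem trgtMark_ne {y : K} (hy : π.trgt.inv y ≠ y) (k : Fin (3 * g)) : y ≠ π.trgtMark k := by
  rintro rfl
  exact hy (mem_legs.1 (π.trgt_stable.mark_mem_legs k)).2

/-- By connectedness one of the three flags at `A` is a half-edge. -/
theorem IsTopDimensional.card_simpleLegs_le (hg : 2 ≤ g) (hπ : π.IsTopDimensional) {A : K}
    (hA : A ∈ π.trgt.vertices) : (π.simpleLegs A).card ≤ 2 := by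
  obtain ⟨y, hy, hyA⟩ := π.trgt_stable.connected.exists_halfEdge (hπ.edges_nonempty hg) hA
  have hinj : Set.InjOn (fun k : SimpleIndex g => π.trgtMark k.1) (π.simpleLegs A) :=
    fun k _ k' _ h => Subtype.ext (π.trgt_stable.mark_injective h)
  have hsub : insert y ((π.simpleLegs A).image fun k => π.trgtMark k.1) ⊆ π.trgt.star A := by
    refine Finset.insert_subset (hyA ▸ mem_star_root hy) fun z hz => ?_
    obtain ⟨k, hk, rfl⟩ := Finset.mem_image.1 hz
    exact (mem_simpleLegs.1 hk) ▸ π.trgt_stable.mark_mem_star k.1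
  have h := Finset.card_le_card hsub
  rw [Finset.card_insert_of_notMem, Finset.card_image_of_injOn hinj] at h
  · have := hπ.val_eq_three hg A hA
    unfold val at this
    omega
  · intro hmem
    obtain ⟨k, -, hk⟩ := Finset.mem_image.1 hmem
    exact trgtMark_ne hy k.1 hk.symm

theorem IsTopDimensional.star_eq (hg : 2 ≤ g) (hπ : π.IsTopDimensional) {y : K}
    (hy : π.trgt.inv y ≠ y) (h2 : 2 ≤ (π.simpleLegs (π.trgt.root y)).card) :
    ∃ k k' : SimpleIndex g, k ≠ k' ∧ π.trgt.root (π.trgtMark k.1) = π.trgt.root y ∧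
      π.trgt.root (π.trgtMark k'.1) = π.trgt.root y ∧
      π.trgt.star (π.trgt.root y) = {π.trgtMark k.1, π.trgtMark k'.1, y} := by
  obtain ⟨k, hk, k', hk', hne⟩ := Finset.one_lt_card.1 h2
  rw [mem_simpleLegs] at hk hk'
  refine ⟨k, k', hne, hk, hk', ?_⟩
  have hne' : π.trgtMark k.1 ≠ π.trgtMark k'.1 := fun h =>
    hne (Subtype.ext (π.trgt_stable.mark_injective h))
  symm
  refine Finset.eq_of_subset_of_card_le ?_ ?_
  · intro z hz
    simp only [Finset.mem_insert, Finset.mem_singleton] at hz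
    rcases hz with rfl | rfl | rfl
    · exact hk ▸ π.trgt_stable.mark_mem_star k.1
    · exact hk' ▸ π.trgt_stable.mark_mem_star k'.1
    · exact mem_star_root hy
  · rw [Finset.card_eq_three.2 ⟨_, _, _, hne', (trgtMark_ne hy k.1).symm,
      (trgtMark_ne hy k'.1).symm, rfl⟩]
    exact (hπ.val_eq_three hg _ (root_mem_vertices y)).le

/-- Over a vertex with two legs with simple ramification, the core passes through vertices of
degree two. -/
theorem IsTopDimensional.core_over_cherry (hg : 2 ≤ g) (hπ : π.IsTopDimensional) {x : F}
    (hx : x ∈ π.src.core)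
    (h2 : 2 ≤ (π.simpleLegs (π.trgt.root (π.cover.toFun x))).card) :
    π.cover.deg x = 1 ∧ π.src.coreVal (π.src.root x) = 2 ∧
      ∀ x' ∈ π.src.core, π.src.root x' = π.src.root x →
        π.cover.toFun x' = π.cover.toFun x := by
  set V := π.src.root x with hV
  set y := π.cover.toFun x with hy
  have hVv : V ∈ π.src.vertices := root_mem_vertices x
  have hπV : π.cover.toFun V = π.trgt.root y := π.cover.map_root x
  have hxs : ∀ x' ∈ π.src.core, π.src.root x' = V → x' ∈ π.src.star V := fun x' hx' h =>
    h ▸ AdmissibleCover.core_subset_star hx'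
  have hys : y ∈ π.trgt.star (π.trgt.root y) := hπV ▸ π.cover.map_mem_star hVv (hxs x hx rfl)
  have hyinv : π.trgt.inv y ≠ y := by
    intro hyi
    have : y ∈ π.trgt.legs := mem_legs.2 ⟨fun h => (mem_star.1 hys).2 (mem_vertices.1 h).symm, hyi⟩
    obtain ⟨k, hk⟩ := (π.trgt_stable.mark_range y).1 this
    exact π.map_ne_trgtMark hg (inv_ne_of_mem_core hx) k hk.symm
  obtain ⟨k, k', hne, hk, hk', hstar⟩ := hπ.star_eq hg hyinv h2
  have hover : ∀ x' ∈ π.src.core, π.src.root x' = V → π.cover.toFun x' = y := by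
    intro x' hx' hr
    have h := π.cover.map_mem_star hVv (hxs x' hx' hr)
    rw [hπV, hstar] at h
    simp only [Finset.mem_insert, Finset.mem_singleton] at h
    rcases h with h | h | h
    · exact absurd h (π.map_ne_trgtMark hg (inv_ne_of_mem_core hx') k.1)
    · exact absurd h (π.map_ne_trgtMark hg (inv_ne_of_mem_core hx') k'.1)
    · exact h
  -- Let `D` be the degree of `V`. At least `D - 1` legs lie over each simple leg and the valency is
  -- `D + 2`, so at most `4 - D` half-edges lie over `y`. At least two of these are in the core, and
  -- their number is at most `D`; hence `D = 2` and there are exactly two, both of weight one.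
  have hb1 := π.deg_le_card_add_one hg hVv k.2 (hπV.trans hk.symm)
  have hb2 := π.deg_le_card_add_one hg hVv k'.2 (hπV.trans hk'.symm)
  have hval := π.cover.val_eq hVv (hπ.val_eq_three hg _ (π.cover.map_mem_vertices hVv))
  have hsplit : π.src.val V = ∑ z ∈ π.trgt.star (π.trgt.root y),
      ((π.src.star V).filter fun x => π.cover.toFun x = z).card :=
    Finset.card_eq_sum_card_fiberwise fun x hx => hπV ▸ π.cover.map_mem_star hVv hx
  have hne' : π.trgtMark k.1 ≠ π.trgtMark k'.1 := fun h =>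
    hne (Subtype.ext (π.trgt_stable.mark_injective h))
  rw [hstar, Finset.sum_insert (by simp [hne', (trgtMark_ne hyinv k.1).symm]),
    Finset.sum_insert (by simp [(trgtMark_ne hyinv k'.1).symm]), Finset.sum_singleton] at hsplit
  set S := (π.src.star V).filter fun x => π.cover.toFun x = y with hS
  have hcore : π.src.core.filter (fun x' => π.src.root x' = V) ⊆ S := by
    intro x' hx'
    obtain ⟨h1, h2⟩ := Finset.mem_filter.1 hx'
    exact Finset.mem_filter.2 ⟨hxs x' h1 h2, hover x' h1 h2⟩
  have hc1 : π.src.coreVal V ≤ S.card := Finset.card_le_card hcore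
  have hc2 : 2 ≤ π.src.coreVal V := two_le_coreVal hx
  have hdeg : π.cover.deg V = ∑ x ∈ S, π.cover.deg x := π.cover.balanced V hVv y (hπV ▸ hys)
  have hle : S.card ≤ ∑ x ∈ S, π.cover.deg x := by
    rw [Finset.card_eq_sum_ones]
    exact Finset.sum_le_sum fun x _ => π.cover.deg_pos x
  have hxS : x ∈ S := hcore (by simp [hx, hV])
  have heq : ∑ x ∈ S, 1 = ∑ x ∈ S, π.cover.deg x := by
    rw [← Finset.card_eq_sum_ones]
    omega
  refine ⟨?_, by omega, hover⟩
  exact ((Finset.sum_eq_sum_iff_of_le fun x _ => π.cover.deg_pos x).1 heq x hxS).symm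

variable (π) in
/-- The factor that the symmetry of two legs contributes to the column of an edge. -/
def cherryFactor (h : Finset K) : ℕ :=
  if ∃ y ∈ h, 2 ≤ (π.simpleLegs (π.trgt.root y)).card then 2 else 1

/-- Over an edge at a cherry the edges on `c` have weight one, so omitting any of them gives the
same chain quotient and the sum is their number times a constant. Their halves on the cherry side
meet in pairs at bivalent core vertices, so the number is even. -/
theorem IsTopDimensional.cherryFactor_dvd (hg : 2 ≤ g) (hπ : π.IsTopDimensional) {c : Finset F}
    (hc : c ∈ π.src.ftEdges) {h : Finset K} (hh : h ∈ π.trgt.edges) :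
    π.cherryFactor h ∣ ∑ e ∈ π.cover.mergedFiber c h, π.cover.chainQuotient c e := by
  unfold cherryFactor
  split_ifs with hex
  swap
  · exact one_dvd _
  obtain ⟨z, hzh, hz2⟩ := hex
  obtain ⟨y, hy, hy2, rfl⟩ : ∃ y, π.trgt.inv y ≠ y ∧
      2 ≤ (π.simpleLegs (π.trgt.root y)).card ∧ π.trgt.edgeOf y = h := by
    obtain ⟨y₀, hy₀, rfl⟩ := mem_edges.1 hh
    rcases mem_edgeOf.1 hzh with rfl | rfl
    · exact ⟨_, hy₀, hz2, rfl⟩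
    · exact ⟨_, inv_inv_ne hy₀, hz2, edgeOf_inv _⟩
  have hcc := subset_core_of_mem_ftEdges hc
  set X := c.filter fun x => π.cover.toFun x = y with hX
  have hcherry : ∀ x ∈ X, π.cover.deg x = 1 ∧ π.src.coreVal (π.src.root x) = 2 ∧
      ∀ x' ∈ π.src.core, π.src.root x' = π.src.root x → π.cover.toFun x' = y := by
    intro x hx
    obtain ⟨h1, h2⟩ := Finset.mem_filter.1 hx
    have := hπ.core_over_cherry hg (hcc h1) (by rwa [h2])
    rwa [h2] at this
  have hfib : π.cover.mergedFiber c (π.trgt.edgeOf y) = X.image π.src.edgeOf := by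
    ext e
    simp only [AdmissibleCover.mergedFiber, Finset.mem_filter, Finset.mem_image]
    constructor
    · rintro ⟨⟨x, hx, rfl⟩, hxy⟩
      have hm : y ∈ (π.src.edgeOf x).image π.cover.toFun := by
        rw [hxy]
        exact mem_edgeOf.2 (Or.inl rfl)
      obtain ⟨z, hz, hzy⟩ := Finset.mem_image.1 hm
      refine ⟨z, Finset.mem_filter.2 ⟨?_, hzy⟩, edgeOf_eq_iff.2 (mem_edgeOf.1 hz)⟩
      exact (edgeOf_subset_iff hc).2 hx hz
    · rintro ⟨x, hx, rfl⟩
      obtain ⟨h1, h2⟩ := Finset.mem_filter.1 hx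
      refine ⟨⟨x, h1, rfl⟩, ?_⟩
      rw [edgeOf, Finset.image_insert, Finset.image_singleton, π.cover.map_inv, h2]
      rfl
  have hinj : Set.InjOn π.src.edgeOf X := by
    intro x hx x' hx' h
    rcases edgeOf_eq_iff.1 h with h | h
    · exact h
    · exfalso
      apply hy
      have h1 := (Finset.mem_filter.1 hx).2
      have h2 := (Finset.mem_filter.1 hx').2
      rw [h, π.cover.map_inv, h2] at h1
      exact h1
  have hconst : ∀ x ∈ X, π.cover.chainQuotient c (π.src.edgeOf x) =
      (∏ e ∈ c.image π.src.edgeOf, π.cover.edgeDeg e) /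
        ∏ v ∈ π.src.bivalent c, π.cover.coreWeight v := by
    intro x hx
    unfold AdmissibleCover.chainQuotient
    rw [Finset.prod_erase _ (by rw [AdmissibleCover.edgeDeg_edgeOf, (hcherry x hx).1])]
  rw [hfib, Finset.sum_image hinj, Finset.sum_congr rfl hconst, Finset.sum_const, smul_eq_mul]
  refine Dvd.dvd.mul_right ?_ _
  rw [Finset.card_eq_sum_card_image π.src.root X]
  refine Finset.dvd_sum fun v hv => ?_
  obtain ⟨x, hx, rfl⟩ := Finset.mem_image.1 hv
  obtain ⟨-, hval, hover⟩ := hcherry x hx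
  have hxc := (Finset.mem_filter.1 hx).1
  have : X.filter (fun z => π.src.root z = π.src.root x) =
      π.src.core.filter (fun z => π.src.root z = π.src.root x) := by
    ext z
    simp only [hX, Finset.mem_filter]
    constructor
    · rintro ⟨⟨h1, -⟩, h2⟩
      exact ⟨hcc h1, h2⟩
    · rintro ⟨h1, h2⟩
      exact ⟨⟨mem_of_merges hc hxc ⟨hcc hxc, h1, Or.inr ⟨h2, hval⟩⟩, hover z h1 h2⟩, h2⟩
  rw [this]
  exact hval.symm.dvd

end ACObject

/-! ### Composition and inversion of automorphisms -/

namespace AdmissibleCover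

variable {F K : Type*} [Fintype F] [DecidableEq F] [Fintype K] [DecidableEq K]
  {G : DiscreteGraph F} {H : DiscreteGraph K} {π : AdmissibleCover G H}

theorem IsAut.one : π.IsAut 1 1 :=
  ⟨fun _ => rfl, fun _ => rfl, fun _ => rfl, fun _ => rfl, fun _ => rfl, fun _ => rfl⟩

theorem IsAut.mul {φ φ' : Equiv.Perm F} {ψ ψ' : Equiv.Perm K} (h : π.IsAut φ ψ)
    (h' : π.IsAut φ' ψ') : π.IsAut (φ * φ') (ψ * ψ') where
  src_root x := by simp only [Equiv.Perm.mul_apply, h'.src_root, h.src_root]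
  src_inv x := by simp only [Equiv.Perm.mul_apply, h'.src_inv, h.src_inv]
  trgt_root x := by simp only [Equiv.Perm.mul_apply, h'.trgt_root, h.trgt_root]
  trgt_inv x := by simp only [Equiv.Perm.mul_apply, h'.trgt_inv, h.trgt_inv]
  comm x := by simp only [Equiv.Perm.mul_apply, h.comm, h'.comm]
  deg_eq x := by simp only [Equiv.Perm.mul_apply, h.deg_eq, h'.deg_eq]

theorem IsAut.inv {φ : Equiv.Perm F} {ψ : Equiv.Perm K} (h : π.IsAut φ ψ) : π.IsAut φ⁻¹ ψ⁻¹ := by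
  have hφ : ∀ x, φ (φ⁻¹ x) = x := φ.apply_symm_apply
  have hψ : ∀ x, ψ (ψ⁻¹ x) = x := ψ.apply_symm_apply
  refine ⟨fun x => ?_, fun x => ?_, fun x => ?_, fun x => ?_, fun x => ?_, fun x => ?_⟩
  · rw [Equiv.Perm.inv_eq_iff_eq, h.src_root, hφ]
  · rw [Equiv.Perm.inv_eq_iff_eq, h.src_inv, hφ]
  · rw [Equiv.Perm.inv_eq_iff_eq, h.trgt_root, hψ]
  · rw [Equiv.Perm.inv_eq_iff_eq, h.trgt_inv, hψ]
  · apply ψ.injective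
    rw [← h.comm, hφ, hψ]
  · rw [← h.deg_eq, hφ]

end AdmissibleCover

namespace ACObject

open DiscreteGraph

variable {F K : Type*} [Fintype F] [DecidableEq F] [Fintype K] [DecidableEq K] {g : ℕ}
  {π : ACObject F K g 0 g (weierstrassProfile g)}

/-! #### Symmetries -/

/-- This is where a nonzero determinant constrains symmetries: above `y` there is a core half-edge,
and it is fixed. -/
theorem target_fixed (hdet : absDet π.cover.ftEdgeMatrix ≠ 0) {φ : Equiv.Perm F}
    {ψ : Equiv.Perm K} (h : π.cover.IsAut φ ψ) (hφ : AdmissibleCover.InducesIdOnFt π.src φ) {y : K}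
    (hy : π.trgt.inv y ≠ y) : ψ y = y := by
  obtain ⟨x, hx, rfl⟩ := π.cover.exists_core_over hdet hy
  rw [← h.comm, hφ x hx]

theorem target_vertex_fixed (hg : 2 ≤ g) (hπ : π.IsTopDimensional)
    (hdet : absDet π.cover.ftEdgeMatrix ≠ 0) {φ : Equiv.Perm F}
    {ψ : Equiv.Perm K} (h : π.cover.IsAut φ ψ) (hφ : AdmissibleCover.InducesIdOnFt π.src φ) {A : K}
    (hA : A ∈ π.trgt.vertices) : ψ A = A := by
  obtain ⟨y, hy, rfl⟩ := π.trgt_stable.connected.exists_halfEdge (hπ.edges_nonempty hg) hA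
  rw [h.trgt_root, target_fixed hdet h hφ hy]

theorem target_eq_one (hg : 2 ≤ g) (hπ : π.IsTopDimensional)
    (hdet : absDet π.cover.ftEdgeMatrix ≠ 0) {φ : Equiv.Perm F}
    {ψ : Equiv.Perm K} (h : π.cover.IsAut φ ψ) (hφ : AdmissibleCover.InducesIdOnFt π.src φ)
    (hm : ∀ k, ψ (π.trgtMark k) = π.trgtMark k) (y : K) : ψ y = y := by
  by_cases hy : y ∈ π.trgt.vertices
  · exact target_vertex_fixed hg hπ hdet h hφ hy
  · by_cases hyi : π.trgt.inv y = y
    · obtain ⟨k, rfl⟩ := (π.trgt_stable.mark_range y).1 (mem_legs.2 ⟨hy, hyi⟩)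
      exact hm k
    · exact target_fixed hdet h hφ hyi

theorem ofSubtype_val_ne (β : Equiv.Perm (SimpleIndex g)) (k : SimpleIndex g) :
    Equiv.Perm.ofSubtype β k.1 = (β k).1 := Equiv.Perm.ofSubtype_apply_coe β k

theorem ofSubtype_of_eq_zero (β : Equiv.Perm (SimpleIndex g)) {k : Fin (3 * g)} (hk : k.val = 0) :
    Equiv.Perm.ofSubtype β k = k :=
  Equiv.Perm.ofSubtype_apply_of_not_mem β (by simpa using hk)

theorem length_ofSubtype (hg : 2 ≤ g) (β : Equiv.Perm (SimpleIndex g)) (k : Fin (3 * g)) :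
    (weierstrassProfile g (Equiv.Perm.ofSubtype β k)).length =
      (weierstrassProfile g k).length := by
  by_cases hk : k.val = 0
  · rw [ofSubtype_of_eq_zero β hk]
  · rw [ofSubtype_val_ne β ⟨k, hk⟩, length_weierstrassProfile hg (β ⟨k, hk⟩).2,
      length_weierstrassProfile hg hk]

variable (π) in
/-- The subgroup of permutations of the legs of the target that stabilize `π`. -/
def horizontalGroup (hg : 2 ≤ g) : Subgroup (Equiv.Perm (SimpleIndex g)) where
  carrier := {β | ∃ (φ : Equiv.Perm F) (ψ : Equiv.Perm K), π.cover.IsAut φ ψ ∧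
      AdmissibleCover.InducesIdOnFt π.src φ ∧
      (∀ k, ψ (π.trgtMark k) = π.trgtMark (Equiv.Perm.ofSubtype β k)) ∧
      (∀ k j j', j.val = j'.val →
        φ (π.srcMark ⟨k, j⟩) = π.srcMark ⟨Equiv.Perm.ofSubtype β k, j'⟩)}
  one_mem' := by
    refine ⟨1, 1, AdmissibleCover.IsAut.one, fun _ _ => rfl, fun k => by simp, ?_⟩
    intro k j j' h
    have : ∀ k' (hk : k' = k) (j' : Fin (weierstrassProfile g k').length), j.val = j'.val →
        π.srcMark ⟨k, j⟩ = π.srcMark ⟨k', j'⟩ := by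
      rintro _ rfl j' h
      rw [Fin.ext h]
    exact this _ (by simp) j' h
  mul_mem' := by
    rintro β β' ⟨φ, ψ, h1, h2, h3, h4⟩ ⟨φ', ψ', h1', h2', h3', h4'⟩
    refine ⟨φ * φ', ψ * ψ', h1.mul h1', fun x hx => ?_, fun k => ?_, fun k j j' hj => ?_⟩
    · rw [Equiv.Perm.mul_apply, h2' x hx, h2 x hx]
    · rw [Equiv.Perm.mul_apply, h3', h3, map_mul, Equiv.Perm.mul_apply]
    · have hj' : j.val < (weierstrassProfile g (Equiv.Perm.ofSubtype β' k)).length := by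
        rw [length_ofSubtype hg]
        exact j.2
      rw [Equiv.Perm.mul_apply, h4' k j ⟨j.val, hj'⟩ rfl]
      -- The type of the position depends on the index of the leg, so the claim is generalized to
      -- any `k'` equal to the composite image.
      have key : ∀ k' (hk : k' = Equiv.Perm.ofSubtype β (Equiv.Perm.ofSubtype β' k))
          (j' : Fin (weierstrassProfile g k').length), j.val = j'.val →
          φ (π.srcMark ⟨Equiv.Perm.ofSubtype β' k, ⟨j.val, hj'⟩⟩) = π.srcMark ⟨k', j'⟩ := by
        rintro _ rfl j' h
        exact h4 _ _ _ h
      exact key _ (by rw [map_mul, Equiv.Perm.mul_apply]) j' hj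
  inv_mem' := by
    rintro β ⟨φ, ψ, h1, h2, h3, h4⟩
    have hβ : ∀ k, Equiv.Perm.ofSubtype β (Equiv.Perm.ofSubtype β⁻¹ k) = k := fun k => by
      rw [← Equiv.Perm.mul_apply, ← map_mul, mul_inv_cancel, map_one, Equiv.Perm.one_apply]
    refine ⟨φ⁻¹, ψ⁻¹, h1.inv, fun x hx => ?_, fun k => ?_, fun k j j' hj => ?_⟩
    · rw [Equiv.Perm.inv_eq_iff_eq, h2 x hx]
    · rw [Equiv.Perm.inv_eq_iff_eq, h3, hβ]
    · rw [Equiv.Perm.inv_eq_iff_eq]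
      have key : ∀ k' (hk : Equiv.Perm.ofSubtype β (Equiv.Perm.ofSubtype β⁻¹ k) = k')
          (i : Fin (weierstrassProfile g k').length), j'.val = i.val →
          φ (π.srcMark ⟨Equiv.Perm.ofSubtype β⁻¹ k, j'⟩) = π.srcMark ⟨k', i⟩ := by
        rintro _ rfl i h
        exact h4 _ _ _ h
      exact (key _ (hβ k) j hj.symm).symm

/-- Since all target vertices are fixed, a horizontal symmetry keeps each simple leg at its vertex.
The stabilizer is thus a subgroup of a Young subgroup, whose order is the product of factorials. -/
theorem horizontalStab_dvd_prod_factorial (hg : 2 ≤ g) (hπ : π.IsTopDimensional)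
    (hdet : absDet π.cover.ftEdgeMatrix ≠ 0) :
    π.horizontalStab ∣ ∏ A : K, (π.simpleLegs A).card.factorial := by
  let f : SimpleIndex g → K := fun k => π.trgt.root (π.trgtMark k.1)
  let S : Subgroup (Equiv.Perm (SimpleIndex g)) :=
    { carrier := {β | f ∘ β = f}
      one_mem' := rfl
      mul_mem' := fun {β β'} h h' => by
        funext k
        exact (congrFun h (β' k)).trans (congrFun h' k)
      inv_mem' := fun {β} h => by
        funext k
        have := congrFun h (β⁻¹ k)
        simp only [Function.comp] at this ⊢
        rw [← this]
        congr 1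
        exact β.apply_symm_apply k }
  have hS : Nat.card S = ∏ A : K, (π.simpleLegs A).card.factorial := by
    have h1 : Nat.card S = Nat.card {β : Equiv.Perm (SimpleIndex g) // f ∘ β = f} := rfl
    rw [h1, Nat.card_eq_fintype_card, DomMulAct.stabilizer_card]
    refine Finset.prod_congr rfl fun A _ => ?_
    rw [Fintype.card_subtype]
    rfl
  rw [← hS]
  refine Subgroup.card_dvd_of_le (H := π.horizontalGroup hg) ?_
  rintro β ⟨φ, ψ, h1, h2, h3, -⟩
  funext k
  change π.trgt.root (π.trgtMark (β k).1) = π.trgt.root (π.trgtMark k.1)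
  rw [← ofSubtype_val_ne, ← h3, ← h1.trgt_root,
    target_vertex_fixed hg hπ hdet h1 h2 (root_mem_vertices _)]

/-- Each cherry contributes `2!` and has a single half-edge, whose edge carries the cherry factor
`2`. No edge is shared by two cherries: it would be the only edge of the target, which has `3g - 2 ≥
4` vertices. -/
theorem IsTopDimensional.prod_factorial_dvd (hg : 2 ≤ g) (hπ : π.IsTopDimensional) :
    ∏ A : K, (π.simpleLegs A).card.factorial ∣ ∏ h ∈ π.trgt.edges, π.cherryFactor h := by
  set C : Finset K := Finset.univ.filter fun A => 2 ≤ (π.simpleLegs A).card with hC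
  have hCV : ∀ A ∈ C, A ∈ π.trgt.vertices := by
    intro A hA
    rw [hC, Finset.mem_filter] at hA
    obtain ⟨k, hk⟩ : (π.simpleLegs A).Nonempty := Finset.card_pos.1 (by omega)
    exact mem_simpleLegs.1 hk ▸ root_mem_vertices _
  have hex : ∀ A ∈ C, ∃ y, π.trgt.inv y ≠ y ∧ π.trgt.root y = A := fun A hA =>
    π.trgt_stable.connected.exists_halfEdge (hπ.edges_nonempty hg) (hCV A hA)
  choose! y hy hyA using hex
  have hinj : Set.InjOn (fun A => π.trgt.edgeOf (y A)) C := by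
    intro A hA B hB hAB
    by_contra hne
    rcases edgeOf_eq_iff.1 hAB with h | h
    · exact hne (by rw [← hyA A hA, ← hyA B hB, h])
    -- The two simple legs leave room for only one half-edge at a cherry.
    · have hstar : ∀ D ∈ C, ∀ z, π.trgt.root z = D → π.trgt.inv z ≠ z → z = y D := by
        intro D hD z hz hzi
        have h2 := (Finset.mem_filter.1 hD).2
        obtain ⟨k, k', -, -, -, hst⟩ := hπ.star_eq hg (hy D hD) (by rwa [hyA D hD])
        have hzm : z ∈ π.trgt.star (π.trgt.root (y D)) := by
          rw [hyA D hD, ← hz]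
          exact mem_star_root hzi
        rw [hst] at hzm
        simp only [Finset.mem_insert, Finset.mem_singleton] at hzm
        rcases hzm with hzm | hzm | hzm
        · exact absurd hzm (trgtMark_ne hzi _)
        · exact absurd hzm (trgtMark_ne hzi _)
        · exact hzm
      have hinv : ∀ z, π.trgt.root z ∈ ({A, B} : Finset K) →
          π.trgt.root (π.trgt.inv z) ∈ ({A, B} : Finset K) := by
        intro z hz
        by_cases hzi : π.trgt.inv z = z
        · rwa [hzi]
        · simp only [Finset.mem_insert, Finset.mem_singleton] at hz ⊢
          rcases hz with hz | hz
          · rw [hstar A hA z hz hzi, h, π.trgt.inv_inv, hyA B hB]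
            exact Or.inr rfl
          · rw [hstar B hB z hz hzi, ← h, hyA A hA]
            exact Or.inl rfl
      have hsub : π.trgt.vertices ⊆ {A, B} := by
        intro v hv
        have := π.trgt_stable.connected.induction
          (fun z => π.trgt.root z ∈ ({A, B} : Finset K))
          (fun z => by rw [π.trgt.root_root])
          (fun z => ⟨hinv z, fun h => by simpa [π.trgt.inv_inv] using hinv _ h⟩)
          (x := A) (by rw [mem_vertices.1 (hCV A hA)]; simp) v
        simpa only [mem_vertices.1 hv] using this
      have h1 := Finset.card_le_card hsub
      have h2 : ({A, B} : Finset K).card ≤ 2 := Finset.card_le_two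
      have h3 := hπ.card_vertices hg
      omega
  have h1 : ∏ A : K, (π.simpleLegs A).card.factorial = ∏ A ∈ C, 2 := by
    rw [hC, Finset.prod_filter]
    refine Finset.prod_congr rfl fun A _ => ?_
    split_ifs with h
    · have := hπ.card_simpleLegs_le hg (hCV A (Finset.mem_filter.2 ⟨Finset.mem_univ _, h⟩))
      rw [le_antisymm this h]
      rfl
    · have : (π.simpleLegs A).card = 0 ∨ (π.simpleLegs A).card = 1 := by omega
      rcases this with h | h <;> rw [h] <;> rfl
  have h2 : ∏ h ∈ C.image (fun A => π.trgt.edgeOf (y A)), π.cherryFactor h = ∏ A ∈ C, 2 := by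
    rw [Finset.prod_image hinj]
    refine Finset.prod_congr rfl fun A hA => ?_
    refine if_pos ⟨y A, mem_edgeOf.2 (Or.inl rfl), ?_⟩
    rw [hyA A hA]
    exact (Finset.mem_filter.1 hA).2
  rw [h1, ← h2]
  refine Finset.prod_dvd_prod_of_subset _ _ _ fun h hh => ?_
  obtain ⟨A, hA, rfl⟩ := Finset.mem_image.1 hh
  exact edgeOf_mem_edges (hy A hA)

variable (π) in
/-- The compatible pairs of a deck transformation and a permutation of the legs of weight `1`. -/
def verticalPairs : Subgroup (Equiv.Perm F × (SimpleIndex g → Equiv.Perm (Fin (g - 2)))) where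
  carrier := {s | s.1 ∈ π.cover.deckGroup ∅ ∧
      (∀ k j, k.val = 0 ∨ j.val = 0 → s.1 (π.srcMark ⟨k, j⟩) = π.srcMark ⟨k, j⟩) ∧
      (∀ (k : SimpleIndex g) (a : Fin (g - 2)) (j j' : Fin (weierstrassProfile g k.1).length),
        j.val = a.val + 1 → j'.val = (s.2 k a).val + 1 →
          s.1 (π.srcMark ⟨k.1, j⟩) = π.srcMark ⟨k.1, j'⟩)}
  one_mem' := by
    refine ⟨one_mem _, fun _ _ _ => rfl, fun k a j j' h h' => ?_⟩
    have : j = j' := Fin.ext (h.trans h'.symm)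
    rw [this]
    rfl
  mul_mem' := by
    rintro ⟨φ, α⟩ ⟨φ', α'⟩ ⟨h1, h2, h3⟩ ⟨h1', h2', h3'⟩
    refine ⟨mul_mem h1 h1', fun k j h => ?_, fun k a j j' h h' => ?_⟩
    · exact (congrArg φ (h2' k j h)).trans (h2 k j h)
    · have hj : (α' k a).val + 1 < (weierstrassProfile g k.1).length := by
        have h5 := (α' k a).2
        have h6 := congrArg List.length (weierstrassProfile_of_ne k.2)
        rw [List.length_cons, List.length_replicate] at h6
        omega
      exact (congrArg φ (h3' k a j ⟨_, hj⟩ h rfl)).trans (h3 k (α' k a) ⟨_, hj⟩ j' rfl h')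
  inv_mem' := by
    rintro ⟨φ, α⟩ ⟨h1, h2, h3⟩
    refine ⟨inv_mem h1, fun k j h => ?_, fun k a j j' h h' => ?_⟩
    · exact (Equiv.Perm.inv_eq_iff_eq).2 (h2 k j h).symm
    · refine (Equiv.Perm.inv_eq_iff_eq).2 (h3 k ((α k)⁻¹ a) j' j h' ?_).symm
      rw [h]
      simp

/-- Markings are injective, so the deck transformation determines the permutation of the labels. -/
theorem card_verticalPairs_dvd (hg : 2 ≤ g) :
    Nat.card π.verticalPairs ∣ Nat.card (π.cover.deckGroup ∅) := by
  let f : π.verticalPairs →* π.cover.deckGroup ∅ :=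
    { toFun := fun s => ⟨s.1.1, s.2.1⟩
      map_one' := rfl
      map_mul' := fun _ _ => rfl }
  refine Subgroup.card_dvd_of_injective f ?_
  rintro ⟨⟨φ, α⟩, h1, h2, h3⟩ ⟨⟨φ', α'⟩, h1', h2', h3'⟩ hf
  have hφ : φ = φ' := congrArg Subtype.val hf
  subst hφ
  refine Subtype.ext (Prod.ext rfl ?_)
  funext k
  ext a
  have hlen := length_weierstrassProfile hg k.2
  have hj : ∀ b : Fin (g - 2), b.val + 1 < (weierstrassProfile g k.1).length := fun b => by
    have := b.2
    omega
  have h4 := h3 k a ⟨_, hj a⟩ ⟨_, hj (α k a)⟩ rfl rfl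
  have h5 := h3' k a ⟨_, hj a⟩ ⟨_, hj (α' k a)⟩ rfl rfl
  have h6 := π.src_stable.mark_injective (h4.symm.trans h5)
  simpa using h6

/-- A vertical symmetry fixes all target legs and is therefore trivial on the target. The stabilizer
is the projection of `verticalPairs` to its second factor, while the first projection embeds
`verticalPairs` into the deck group. -/
theorem verticalStab_dvd (hg : 2 ≤ g) (hπ : π.IsTopDimensional)
    (hdet : absDet π.cover.ftEdgeMatrix ≠ 0) :
    π.verticalStab ∣ Nat.card (π.cover.deckGroup ∅) := by
  let p := (MonoidHom.snd (Equiv.Perm F) (SimpleIndex g → Equiv.Perm (Fin (g - 2)))).comp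
    π.verticalPairs.subtype
  have h : π.verticalStab = Nat.card p.range := by
    refine Nat.card_congr (Equiv.subtypeEquivRight fun α => ?_)
    constructor
    · rintro ⟨φ, ψ, h1, h2, h3, h4, h5⟩
      have hψ := target_eq_one hg hπ hdet h1 h2 h3
      exact ⟨⟨(φ, α), ⟨h1.src_root, h1.src_inv, fun x => by rw [h1.comm, hψ], h1.deg_eq, h2,
        fun v hv => absurd hv (Finset.notMem_empty v)⟩, h4, h5⟩, rfl⟩
    · rintro ⟨⟨⟨φ, α⟩, h1, h4, h5⟩, rfl⟩
      exact ⟨φ, 1, ⟨h1.1, h1.2.1, fun _ => rfl, fun _ => rfl, h1.2.2.1, h1.2.2.2.1⟩,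
        h1.2.2.2.2.1, fun _ => rfl, h4, h5⟩
  rw [h]
  exact (Subgroup.card_range_dvd p).trans (card_verticalPairs_dvd hg)

/-! #### Integrality -/

theorem exists_multiplicity_eq (hg : 2 ≤ g) (hπ : π.IsTopDimensional) :
    ∃ N : ℕ, π.multiplicity = (N : ℚ) := by
  by_cases hdet : absDet π.cover.ftEdgeMatrix = 0
  · exact ⟨0, by simp [multiplicity, hdet]⟩
  have h3 := hπ.val_eq_three hg
  have hcore : π.src.core.Nonempty := by
    obtain ⟨h, hh⟩ := hπ.edges_nonempty hg
    obtain ⟨y, hy, -⟩ := mem_edges.1 hh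
    obtain ⟨x, hx, -⟩ := π.cover.exists_core_over hdet hy
    exact ⟨x, hx⟩
  have hspine := π.src_stable.connected.isSpine_core hg π.src_stable.genus
  obtain ⟨N, hN⟩ := π.cover.exists_absDet_mul hg hspine π.cherryFactor
    fun c hc h hh => hπ.cherryFactor_dvd hg hc hh
  obtain ⟨a, ha⟩ := (mul_dvd_mul_right (verticalStab_dvd hg hπ hdet) _).trans
    (AdmissibleCover.card_deckGroup_mul_prod_dvd (π := π.cover) h3 π.src_stable.connected hcore)
  obtain ⟨b, hb⟩ := (horizontalStab_dvd_prod_factorial hg hπ hdet).trans (hπ.prod_factorial_dvd hg)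
  have hVS : (π.verticalStab : ℚ) ≠ 0 := by
    have h1 : Nat.card (π.cover.deckGroup ∅) ≠ 0 := Nat.card_pos.ne'
    exact_mod_cast fun h0 => h1 (by simpa [h0] using verticalStab_dvd hg hπ hdet)
  have hHS : (π.horizontalStab : ℚ) ≠ 0 := by
    have h1 : ∏ A : K, (π.simpleLegs A).card.factorial ≠ 0 :=
      Finset.prod_ne_zero_iff.2 fun A _ => Nat.factorial_ne_zero _
    exact_mod_cast fun h0 => h1
      (by simpa [h0] using horizontalStab_dvd_prod_factorial hg hπ hdet)
  have hfac : ((∏ v ∈ π.src.vertices, (π.cover.deg v).factorial : ℕ) : ℚ) ≠ 0 := by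
    exact_mod_cast Finset.prod_ne_zero_iff.2 fun v _ => Nat.factorial_ne_zero _
  have hlcm : ((∏ h ∈ π.trgt.edges, π.cover.edgeLcm h : ℕ) : ℚ) ≠ 0 := by
    have : ∏ h ∈ π.trgt.edges, π.cover.edgeLcm h ≠ 0 := by
      refine Finset.prod_ne_zero_iff.2 fun h _ => ?_
      unfold AdmissibleCover.edgeLcm
      rw [Ne, Finset.lcm_eq_zero_iff]
      rintro ⟨e, he, he0⟩
      exact (π.cover.edgeDeg_pos (Finset.mem_filter.1 he).1).ne' he0
    exact_mod_cast this
  have hcoreE : π.src.core.image π.src.edgeOf ⊆ π.src.edges := by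
    intro e he
    obtain ⟨x, hx, rfl⟩ := Finset.mem_image.1 he
    exact edgeOf_mem_edges (inv_ne_of_mem_core hx)
  set VS := (π.verticalStab : ℚ)
  set HS := (π.horizontalStab : ℚ)
  set D := ((∏ v ∈ π.src.vertices, (π.cover.deg v).factorial : ℕ) : ℚ) with hD
  set L := ((∏ h ∈ π.trgt.edges, π.cover.edgeLcm h : ℕ) : ℚ) with hL
  set C := ((∏ v ∈ π.src.vertices, π.cover.hurwitzCount v * π.cover.combFactor v : ℕ) : ℚ) with hC
  set W := ((∏ v ∈ (π.src.core.image π.src.root).filter (fun v => π.src.coreVal v = 2),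
    π.cover.coreWeight v : ℕ) : ℚ) with hW
  set E := ((∏ e ∈ π.src.edges \ π.src.core.image π.src.edgeOf, π.cover.edgeDeg e : ℕ) : ℚ)
    with hE
  set E' := ((∏ e ∈ π.src.core.image π.src.edgeOf, π.cover.edgeDeg e : ℕ) : ℚ) with hE'
  have hweight : π.cover.standardWeight = E * E' * (C / D) / L := by
    unfold AdmissibleCover.standardWeight
    congr 1
    · congr 1
      · rw [hE, hE', ← Nat.cast_mul, Finset.prod_sdiff hcoreE, Nat.cast_prod]
      · rw [hC, hD, Nat.cast_prod, Nat.cast_prod, ← Finset.prod_div_distrib]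
        refine Finset.prod_congr rfl fun v _ => ?_
        rw [AdmissibleCover.localHurwitz_eq]
        push_cast
        ring
    · rw [hL, Nat.cast_prod]
  have ha' : C * W * E = VS * D * a := by
    have := congrArg (Nat.cast : ℕ → ℚ) ha
    rwa [Nat.cast_mul, Nat.cast_mul, Nat.cast_mul, Nat.cast_mul] at this
  have hb' : ((∏ h ∈ π.trgt.edges, π.cherryFactor h : ℕ) : ℚ) = HS * b := by
    rw [hb, Nat.cast_mul]
  rw [hb'] at hN
  -- The cofactor `a` remains after dividing the local contributions by VS and the degree
  -- factorials, `b` after dividing the cherry factors by HS, and `N` is the integral determinant.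
  refine ⟨a * b * N, ?_⟩
  unfold multiplicity
  rw [hweight]
  change E * E' * (C / D) / L * absDet π.cover.ftEdgeMatrix / (HS * VS) = _
  have h1 : E * E' * (C / D) / L * absDet π.cover.ftEdgeMatrix =
      E * (C / D) / L * (E' * absDet π.cover.ftEdgeMatrix) := by ring
  rw [h1, hN]
  -- The factor `W` extracted from the determinant joins the Hurwitz factors and the expunged
  -- weights to form the product divisible by VS, and the column factor `L` cancels the lcms in the
  -- standard weight.
  have h2 : E * (C / D) / L * (N * W * (HS * b) * L) = (C * W * E) / D * (L / L) * N * HS * b := by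
    ring
  rw [h2, ha', div_self hlcm]
  push_cast
  field_simp

end ACObject

end TropicalCovers

theorem mainTheorem8 {F K : Type*} [Fintype F] [DecidableEq F] [Fintype K] [DecidableEq K]
    (g : ℕ) (hg : 2 ≤ g)
    (π : TropicalCovers.ACObject F K g 0 g (TropicalCovers.weierstrassProfile g))
    (hπ : π.IsTopDimensional) :
    ∃ N : ℕ, π.multiplicity = (N : ℚ) :=
  TropicalCovers.ACObject.exists_multiplicity_eq hg hπ
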